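/- Let $W$ be a vector space over $\mathbb C$ and put $\mathcal E(W)=\operatorname{Hom}_{\mathbb C}(W,W((x)))$, with $1_W\in\mathcal E(W)$ the identity operator. Expansions. Let $\mathbb C_*(x_1,x_2)$ be the localization of $\mathbb C[[x_1,x_2]]$ at the nonzero polynomials, and let $\iota_{x_2,x_1}:\mathbb C_*(x_1,x_2)\to\mathbb C((x_2))((x_1))$ be the ring embedding extending the inclusion of $\mathbb C[[x_1,x_2]]$ ($\iota_{x,x_0}$ is defined in the same way, with values in $\mathbb C((x))((x_0))$). For $\psi(x)=\sum_n\psi_nx^n\in\mathbb C((x))$ put $$\iota_{x_2,x_1}(\psi(x_2-x_1))=\sum_n\psi_n\sum_{i\ge 0}\binom{n}{i}(-1)^ix_1^ix_2^{n-i}.$$ Locality. A subset $U\subset\mathcal E(W)$ is *pseudo-local* if for any $a(x),b(x)\in U$ there exist $0\ne p\in\mathbb C[x_1^{\pm1},x_2^{\pm1}]$ and finitely many $q_i\in\mathbb C_*(x_1,x_2)$, $u_i(x),v_i(x)\in U$ with $$p(x_1,x_2)a(x_1)b(x_2)=\sum_i\iota_{x_2,x_1}(q_i(x_1,x_2))\,u_i(x_2)v_i(x_1).$$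 It is *$\mathcal S$-local* if for any $a(x),b(x)\in U$ there exist $k\in\mathbb N$ and finitely many $\psi_i\in\mathbb C((x))$, $u_i(x),v_i(x)\in U$ with $$(x_1-x_2)^ka(x_1)b(x_2)=\sum_i(x_1-x_2)^k\,\iota_{x_2,x_1}(\psi_i(x_2-x_1))\,u_i(x_2)v_i(x_1).$$ Generation. A sequence $(\psi^{(1)},\dots,\psi^{(r)})$ in $\mathcal E(W)$ is *quasi compatible* if there is a nonzero polynomial $p(x,y)$ such that $\prod_{i<j}p(x_i,x_j)\,\psi^{(1)}(x_1)\cdots\psi^{(r)}(x_r)\in\operatorname{Hom}(W,W((x_1,\dots,x_r)))$; a subset of $\mathcal E(W)$ is quasi compatible if every finite sequence in it is. For a quasi compatible pair $(a,b)$ and $n\in\mathbb Z$, let $a(x)_nb(x)\in\mathcal E(W)$ be the coefficient of $x_0^{-n-1}$ in $$Y_{\mathcal E}(a(x),x_0)b(x)=\iota_{x,x_0}\bigl(p(x_0+x,x)^{-1}\bigr)\,\bigl(p(x_1,x)a(x_1)b(x)\bigr)\big|_{x_1=x+x_0},$$ where $p$ is any nonzero polynomial with $p(x_1,x_2)a(x_1)b(x_2)\in\operatorname{Hom}(W,W((x_1,x_2)))$,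 and $x_1^i$ becomes $(x+x_0)^i$ expanded in nonnegative powers of $x_0$. A quasi compatible subspace $U$ is *closed* if $a(x)_nb(x)\in U$ for all $a(x),b(x)\in U$ and $n\in\mathbb Z$. Write $\langle S\rangle$ for the smallest closed quasi compatible subspace of $\mathcal E(W)$ containing $S\cup\{1_W\}$, when it exists (this is the space underlying the nonlocal vertex algebra generated by $S$). **Proposition.** Let $S$ be a subset of $\mathcal E(W)$. 1. If $S$ is pseudo-local, then $\langle S\rangle$ exists and is pseudo-local. 2. If $S$ is $\mathcal S$-local, then $\langle S\rangle$ exists and is $\mathcal S$-local. -/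

import Mathlib

open scoped BigOperators

noncomputable section

namespace FormalCalculus

/-! ### Scalars: `ℂ_*(x, y)` and its expansion in `ℂ((y))((x))` -/

/-- `ℂ((y))((x))`: Laurent series in the outer variable `x` whose coefficients are Laurent series
in the inner variable `y`.  It is a field. -/
def IterLaurent : Type := LaurentSeries (LaurentSeries ℂ)

instance : Field IterLaurent := inferInstanceAs (Field (HahnSeries ℤ (LaurentSeries ℂ)))

/-- `ℂ((y))((x))` as the ring of iterated Laurent series. -/
def IterLaurent.equiv : LaurentSeries (LaurentSeries ℂ) ≃+* IterLaurent where
  toFun f := f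
  invFun f := f
  left_inv _ := rfl
  right_inv _ := rfl
  map_mul' _ _ := rfl
  map_add' _ _ := rfl

/-- The coefficient of `x ^ i * y ^ j` in an element of `ℂ((y))((x))`. -/
def IterLaurent.coeff₂ (f : IterLaurent) (i j : ℤ) : ℂ :=
  ((IterLaurent.equiv.symm f).coeff i).coeff j

/-- The inclusion `ℂ[[y]] → ℂ((y))`, the variable `y` being the only one in `Fin 1`. -/
def expandInner : MvPowerSeries (Fin 1) ℂ →+* LaurentSeries ℂ :=
  (HahnSeries.ofPowerSeries ℤ ℂ).comp
    (MvPowerSeries.renameEquiv ℂ (Equiv.ofUnique (Fin 1) Unit) :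
      MvPowerSeries (Fin 1) ℂ →+* PowerSeries ℂ)

/-- The inclusion `ℂ[[x, y]] = ℂ[[y]][[x]] → ℂ((y))((x))`, where `x` is variable `0` and `y` is
variable `1`. -/
def expandPS : MvPowerSeries (Fin 2) ℂ →+* IterLaurent :=
  (IterLaurent.equiv : LaurentSeries (LaurentSeries ℂ) →+* IterLaurent).comp
    ((HahnSeries.ofPowerSeries ℤ (LaurentSeries ℂ)).comp
      ((PowerSeries.map expandInner).comp
        (MvPowerSeries.finSuccEquiv ℂ 1 :
          MvPowerSeries (Fin 2) ℂ →+* PowerSeries (MvPowerSeries (Fin 1) ℂ))))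

theorem expandPS_injective : Function.Injective expandPS := by
  have h1 : Function.Injective expandInner :=
    HahnSeries.ofPowerSeries_injective.comp (AlgEquiv.injective _)
  have h2 := PowerSeries.map_injective _ h1
  exact IterLaurent.equiv.injective.comp
    (HahnSeries.ofPowerSeries_injective.comp (h2.comp (AlgEquiv.injective _)))

/-- The multiplicative set of nonzero polynomials inside `ℂ[[x, y]]`. -/
def nonzeroPolys : Submonoid (MvPowerSeries (Fin 2) ℂ) :=
  (nonZeroDivisors (MvPolynomial (Fin 2) ℂ)).map
    (MvPolynomial.coeToMvPowerSeries.ringHom :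
      MvPolynomial (Fin 2) ℂ →+* MvPowerSeries (Fin 2) ℂ)

/-- `ℂ_*(x, y)`: the localization of `ℂ[[x, y]]` at the nonzero polynomials. -/
abbrev CStar : Type := Localization nonzeroPolys

theorem isUnit_expandPS (y : nonzeroPolys) : IsUnit (expandPS (y : MvPowerSeries (Fin 2) ℂ)) := by
  obtain ⟨_, p, hp, rfl⟩ := y
  refine IsUnit.mk0 (G₀ := IterLaurent) _ fun h => nonZeroDivisors.ne_zero hp ?_
  have h' := expandPS_injective (h.trans (map_zero expandPS).symm)
  simpa using h'

/-- `ι_{y,x} : ℂ_*(x, y) → ℂ((y))((x))`, the ring embedding extending the inclusion of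
`ℂ[[x, y]]` (again `x` is variable `0` and `y` is variable `1`). -/
def iota : CStar →+* IterLaurent :=
  IsLocalization.lift (P := IterLaurent) (M := nonzeroPolys) (g := expandPS) isUnit_expandPS

/-- For `ψ ∈ ℂ((z))`, the series `ι_{y,x}(ψ(y - x)) ∈ ℂ((y))((x))`: every power `(y - x) ^ n`,
`n ∈ ℤ`, is expanded by the binomial theorem in nonnegative powers of `x`,
`(y - x) ^ n = ∑_{i ≥ 0} (n choose i) (-1) ^ i x ^ i y ^ (n - i)`, so the coefficient of
`x ^ i * y ^ j` is `(-1) ^ i ((i + j) choose i) ψ_{i + j}` for `i ≥ 0`. -/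
def expandDiff (ψ : LaurentSeries ℂ) : IterLaurent :=
  IterLaurent.equiv (HahnSeries.ofSuppBddBelow
    (fun i : ℤ => HahnSeries.ofSuppBddBelow
      (fun j : ℤ => if 0 ≤ i then
        (-1 : ℂ) ^ i.toNat * (Ring.choose (i + j) i.toNat : ℤ) * ψ.coeff (i + j) else 0)
      (by
        refine ⟨ψ.order - i, fun j hj => ?_⟩
        by_contra hlt
        apply hj
        have : ψ.coeff (i + j) = 0 := HahnSeries.coeff_eq_zero_of_lt_order (by omega)
        simp [this]))
    (by
      refine ⟨0, fun i hi => ?_⟩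
      by_contra hlt
      apply hi
      ext j
      simp [hlt]))

/-! ### Operator-valued formal series -/

variable {W : Type*} [AddCommGroup W] [Module ℂ W]

/-- `ℰ(W) = Hom(W, W((x)))`.  For `a : E W`, the coefficient of `x ^ i` in `a(x)` is
`HVertexOperator.coeff a i : W →ₗ[ℂ] W`. -/
abbrev E (W : Type*) [AddCommGroup W] [Module ℂ W] : Type _ := VertexOperator ℂ W

/-- The identity operator `1_W`, as a constant series in `ℰ(W)`. -/
def oneW (W : Type*) [AddCommGroup W] [Module ℂ W] : E W where
  toFun w := HahnModule.of ℂ (HahnSeries.single 0 w)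
  map_add' u v := by rw [HahnSeries.single_add, HahnModule.of_add]
  map_smul' c v := by
    apply HahnModule.ext
    funext i
    change (HahnSeries.single (0 : ℤ) (c • v)).coeff i = c • (HahnSeries.single (0 : ℤ) v).coeff i
    rw [HahnSeries.coeff_single, HahnSeries.coeff_single]
    split_ifs <;> simp

/-- `(End W)[[x_s ^ ± 1 | s ∈ σ]]`, a series being given by its coefficients. -/
abbrev OpSeries (σ W : Type*) [AddCommGroup W] [Module ℂ W] : Type _ :=
  (σ → ℤ) → Module.End ℂ W

/-- The product `ψ₁(x₁) ⋯ ψ_r(x_r)` in `(End W)[[x₁ ^ ± 1, …, x_r ^ ± 1]]`. -/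
def opProd {r : ℕ} (ψ : Fin r → E W) : OpSeries (Fin r) W :=
  fun k => (List.ofFn fun i => (HVertexOperator.coeff (ψ i) (k i) : Module.End ℂ W)).prod

/-- The ring `ℂ[x_s ^ ± 1 | s ∈ σ]` of Laurent polynomials. -/
abbrev LaurentPoly (σ : Type*) : Type _ := AddMonoidAlgebra ℂ (σ → ℤ)

/-- The inclusion of polynomials into Laurent polynomials. -/
def toLaurent {σ : Type*} [DecidableEq σ] : MvPolynomial σ ℂ →ₐ[ℂ] LaurentPoly σ :=
  MvPolynomial.aeval fun s => AddMonoidAlgebra.single (Pi.single s 1) 1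

/-- The product of a Laurent polynomial with an operator-valued formal series. -/
def laurentMul {σ : Type*} (p : LaurentPoly σ) (F : OpSeries σ W) : OpSeries σ W :=
  fun k => p.coeff.sum fun m c => c • F (k - m)

/-- The series `F` lies in `Hom(W, W((x₁, …, x_r)))`. -/
def IsHomLaurent {σ : Type*} (F : OpSeries σ W) : Prop :=
  ∀ w : W, ∃ N : ℤ, ∀ k : σ → ℤ, F k w ≠ 0 → ∀ s, N ≤ k s

/-! ### Quasi compatibility -/

/-- The polynomial `∏_{i < j} p(x_i, x_j)`. -/
def pairProduct (r : ℕ) (p : MvPolynomial (Fin 2) ℂ) : MvPolynomial (Fin r) ℂ :=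
  ∏ i : Fin r, ∏ j ∈ Finset.Ioi i, MvPolynomial.rename ![i, j] p

/-- Quasi compatibility of an ordered sequence in `ℰ(W)`. -/
def QuasiCompatibleSeq {r : ℕ} (ψ : Fin r → E W) : Prop :=
  ∃ p : MvPolynomial (Fin 2) ℂ, p ≠ 0 ∧
    IsHomLaurent (laurentMul (toLaurent (pairProduct r p)) (opProd ψ))

/-- A subset of `ℰ(W)` is quasi compatible if every finite sequence in it is. -/
def IsQuasiCompatible (U : Set (E W)) : Prop :=
  ∀ (r : ℕ) (ψ : Fin r → E W), (∀ i, ψ i ∈ U) → QuasiCompatibleSeq ψ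

/-! ### The products `a(x)ₙ b(x)` -/

/-- `W((y))`, a vector space over the field `ℂ((y))`. -/
def LaurentW (W : Type*) [AddCommGroup W] [Module ℂ W] : Type _ := HahnModule ℤ ℂ W

instance : AddCommGroup (LaurentW W) := inferInstanceAs (AddCommGroup (HahnModule ℤ ℂ W))

instance : Module ℂ (LaurentW W) := inferInstanceAs (Module ℂ (HahnModule ℤ ℂ W))

instance : Module (LaurentSeries ℂ) (LaurentW W) :=
  inferInstanceAs (Module (HahnSeries ℤ ℂ) (HahnModule ℤ ℂ W))

/-- `W((y))((x))`, a vector space over the field `ℂ((y))((x))`. -/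
def IterLaurentW (W : Type*) [AddCommGroup W] [Module ℂ W] : Type _ :=
  HahnModule ℤ (LaurentSeries ℂ) (LaurentW W)

instance : AddCommGroup (IterLaurentW W) :=
  inferInstanceAs (AddCommGroup (HahnModule ℤ (LaurentSeries ℂ) (LaurentW W)))

instance : Module IterLaurent (IterLaurentW W) :=
  inferInstanceAs (Module (HahnSeries ℤ (LaurentSeries ℂ))
    (HahnModule ℤ (LaurentSeries ℂ) (LaurentW W)))

/-- The element `∑ᵢ f(i) x ^ i` of `W((y))((x))`. -/
def IterLaurentW.mk (f : HahnSeries ℤ (LaurentW W)) : IterLaurentW W :=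
  HahnModule.of (LaurentSeries ℂ) f

/-- The coefficient of `x ^ i` in an element of `W((y))((x))`, as an element of `W((y))`. -/
def outerCoeff (F : IterLaurentW W) (i : ℤ) : HahnModule ℤ ℂ W :=
  (((HahnModule.of (LaurentSeries ℂ)).symm F : HahnSeries ℤ (LaurentW W)).coeff i : LaurentW W)

/-- The coefficient of `x ^ i * y ^ j` in an element of `W((y))((x))`. -/
def coeff₂ (F : IterLaurentW W) (i j : ℤ) : W :=
  ((HahnModule.of ℂ).symm (outerCoeff F i)).coeff j

/-- The coefficient of `x₀ ^ t * x ^ s` in `F(x + x₀, x) w`, where `F ∈ Hom(W, W((x₁, x)))` and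
`x₁ ^ i` becomes `(x + x₀) ^ i = ∑_{t ≥ 0} (i choose t) x ^ (i - t) x₀ ^ t`. Only finitely many
summands are nonzero. -/
def substCoeff (F : OpSeries (Fin 2) W) (t s : ℤ) (w : W) : W :=
  if 0 ≤ t then ∑ᶠ i : ℤ, (Ring.choose i t.toNat : ℤ) • F ![i, s + t - i] w else 0

theorem substCoeff_bddBelow {F : OpSeries (Fin 2) W} (hF : IsHomLaurent F) (t : ℤ) (w : W) :
    BddBelow (Function.support fun s => substCoeff F t s w) := by
  obtain ⟨N, hN⟩ := hF w
  refine ⟨2 * N - t, fun s hs => ?_⟩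
  by_contra hlt
  apply hs
  have h0 : ∀ i : ℤ, F ![i, s + t - i] w = 0 := by
    intro i
    by_contra hne
    have h1 := hN _ hne 0
    have h2 := hN _ hne 1
    simp at h1 h2
    omega
  simp [substCoeff, h0]

theorem substCoeff_finite {F : OpSeries (Fin 2) W} (hF : IsHomLaurent F) (t s : ℤ) (w : W) :
    (Function.support fun i : ℤ =>
      (Ring.choose i t.toNat : ℤ) • F ![i, s + t - i] w).Finite := by
  obtain ⟨N, hN⟩ := hF w
  refine (Set.finite_Icc N (s + t - N)).subset fun i hi => ?_
  have hne : F ![i, s + t - i] w ≠ 0 := by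
    intro h
    apply hi
    simp [h]
  have h1 := hN _ hne 0
  have h2 := hN _ hne 1
  simp at h1 h2
  exact ⟨h1, by omega⟩

/-- `F(x + x₀, x) w ∈ W((x))((x₀))` for `F(x₁, x) ∈ Hom(W, W((x₁, x)))`; the outer variable is
`x₀` and the inner one is `x`. -/
def substShift (F : OpSeries (Fin 2) W) (hF : IsHomLaurent F) (w : W) : IterLaurentW W :=
  IterLaurentW.mk (HahnSeries.ofSuppBddBelow
    (fun t : ℤ => (HahnModule.of ℂ
      (HahnSeries.ofSuppBddBelow (fun s => substCoeff F t s w) (substCoeff_bddBelow hF t w)) :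
        HahnModule ℤ ℂ W))
    (by
      refine ⟨0, fun t ht => ?_⟩
      by_contra hlt
      apply ht
      apply HahnModule.ext
      funext s
      simp [substCoeff, hlt]
      rfl))

theorem coeff₂_substShift (F : OpSeries (Fin 2) W) (hF : IsHomLaurent F) (w : W) (t s : ℤ) :
    coeff₂ (substShift F hF w) t s = substCoeff F t s w :=
  rfl

theorem iterLaurentW_ext {F G : IterLaurentW W} (h : ∀ i j, coeff₂ F i j = coeff₂ G i j) :
    F = G := by
  apply HahnModule.ext
  funext i
  apply HahnModule.ext
  funext j
  exact h i j

theorem substShift_add (F : OpSeries (Fin 2) W) (hF : IsHomLaurent F) (v w : W) :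
    substShift F hF (v + w) = substShift F hF v + substShift F hF w := by
  apply iterLaurentW_ext
  intro t s
  have h : coeff₂ (substShift F hF v + substShift F hF w) t s
      = coeff₂ (substShift F hF v) t s + coeff₂ (substShift F hF w) t s := rfl
  rw [h, coeff₂_substShift, coeff₂_substShift, coeff₂_substShift]
  unfold substCoeff
  split_ifs
  · rw [← finsum_add_distrib (substCoeff_finite hF t s v) (substCoeff_finite hF t s w)]
    simp [smul_add]
  · simp

/-- The constant `c` as an element of `ℂ((y))((x))`. -/
def constC (c : ℂ) : IterLaurent :=
  IterLaurent.equiv (HahnSeries.single 0 (HahnSeries.single 0 c))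

theorem outerCoeff_C_smul (c : ℂ) (F : IterLaurentW W) (i : ℤ) :
    outerCoeff (constC c • F) i = c • outerCoeff F i := by
  have h : outerCoeff (constC c • F) i
      = (HahnSeries.single (0 : ℤ) c : LaurentSeries ℂ) • outerCoeff F i :=
    HahnModule.coeff_single_zero_smul (Γ := ℤ) (R := LaurentSeries ℂ) (V := LaurentW W)
  rw [h]
  exact HahnModule.single_zero_smul_eq_smul ℤ

theorem substShift_smul (F : OpSeries (Fin 2) W) (hF : IsHomLaurent F) (c : ℂ) (w : W) :
    substShift F hF (c • w) = constC c • substShift F hF w := by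
  apply iterLaurentW_ext
  intro t s
  have h : coeff₂ (constC c • substShift F hF w) t s
      = c • coeff₂ (substShift F hF w) t s := by
    unfold coeff₂
    rw [outerCoeff_C_smul]
    rfl
  rw [h, coeff₂_substShift, coeff₂_substShift]
  unfold substCoeff
  split_ifs
  · rw [smul_finsum' c (substCoeff_finite hF t s w)]
    simp [smul_comm c]
  · simp

/-- The polynomial `p(x₀ + x, x)` in the variables `x₀` (variable `0`) and `x` (variable `1`). -/
def shiftPoly (p : MvPolynomial (Fin 2) ℂ) : MvPolynomial (Fin 2) ℂ :=
  MvPolynomial.aeval ![MvPolynomial.X 0 + MvPolynomial.X 1, MvPolynomial.X 1] p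

/-- `p(x₁, x₂) a(x₁) b(x₂) ∈ Hom(W, W((x₁, x₂)))`. -/
abbrev Clears (p : MvPolynomial (Fin 2) ℂ) (a b : E W) : Prop :=
  IsHomLaurent (laurentMul (toLaurent p) (opProd ![a, b]))

/-- The vector `(Y_ℰ(a(x), x₀) b(x)) w ∈ W((x))((x₀))`, i.e.
`ι_{x,x₀}(p(x₀ + x, x)⁻¹) (p(x₁, x) a(x₁) b(x) w)|_{x₁ = x + x₀}`, computed with a polynomial `p`
such that `p(x₁, x₂) a(x₁) b(x₂) ∈ Hom(W, W((x₁, x₂)))`. -/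
def vertexOp (p : MvPolynomial (Fin 2) ℂ) (a b : E W) (h : Clears p a b) (w : W) :
    IterLaurentW W :=
  (expandPS (shiftPoly p : MvPowerSeries (Fin 2) ℂ))⁻¹ •
    substShift (laurentMul (toLaurent p) (opProd ![a, b])) h w

theorem vertexOp_add (p : MvPolynomial (Fin 2) ℂ) (a b : E W) (h : Clears p a b) (v w : W) :
    vertexOp p a b h (v + w) = vertexOp p a b h v + vertexOp p a b h w := by
  unfold vertexOp
  rw [substShift_add]
  rw [smul_add]

theorem vertexOp_smul (p : MvPolynomial (Fin 2) ℂ) (a b : E W) (h : Clears p a b) (c : ℂ) (w : W) :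
    vertexOp p a b h (c • w) = constC c • vertexOp p a b h w := by
  unfold vertexOp
  rw [substShift_smul]
  exact smul_comm _ _ _

/-- `a(x)ₙ b(x) ∈ ℰ(W)`, the coefficient of `x₀ ^ (-n-1)` in `Y_ℰ(a(x), x₀) b(x)`, computed with a
nonzero polynomial `p` such that `p(x₁, x₂) a(x₁) b(x₂) ∈ Hom(W, W((x₁, x₂)))`. -/
def nthProduct (p : MvPolynomial (Fin 2) ℂ) (a b : E W) (h : Clears p a b) (n : ℤ) : E W where
  toFun w := outerCoeff (vertexOp p a b h w) (-n - 1)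
  map_add' v w := by
    rw [vertexOp_add]
    rfl
  map_smul' c w := by
    rw [vertexOp_smul, outerCoeff_C_smul, RingHom.id_apply]

/-- `U` is closed: `a(x)ₙ b(x) ∈ U` for all `a(x), b(x) ∈ U` and `n ∈ ℤ`, where `a(x)ₙ b(x)` may be
computed with any admissible nonzero polynomial. -/
def IsClosedUnderProducts (U : Set (E W)) : Prop :=
  ∀ a ∈ U, ∀ b ∈ U, ∀ p : MvPolynomial (Fin 2) ℂ, p ≠ 0 → ∀ h : Clears p a b,
    ∀ n : ℤ, nthProduct p a b h n ∈ U

/-- The closed quasi compatible subspaces of `ℰ(W)` that contain `S ∪ {1_W}`. -/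
def closedSubspacesContaining (S : Set (E W)) : Set (Submodule ℂ (E W)) :=
  {U | IsQuasiCompatible (U : Set (E W)) ∧ IsClosedUnderProducts (U : Set (E W)) ∧
    S ∪ {oneW W} ⊆ U}

/-- `⟨S⟩`, the intersection of all closed quasi compatible subspaces containing `S ∪ {1_W}`. -/
def generated (S : Set (E W)) : Submodule ℂ (E W) :=
  sInf (closedSubspacesContaining S)

/-! ### Pseudo-locality and `𝒮`-locality -/

/-- `u(x₂) v(x₁) w` as an element of `W((x₂))((x₁))`. -/
def oppositeProd (u v : E W) (w : W) : IterLaurentW W :=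
  IterLaurentW.mk ((((HahnModule.of ℂ).symm (v w)).map u : HahnSeries ℤ (HahnModule ℤ ℂ W)))

/-- `U` is pseudo-local: for `a, b ∈ U` there are a nonzero Laurent polynomial `p` and finitely many
`q_l ∈ ℂ_*(x, y)`, `u_l, v_l ∈ U` with
`p(x₁, x₂) a(x₁) b(x₂) = ∑_l ι_{x₂,x₁}(q_l(x₁, x₂)) u_l(x₂) v_l(x₁)`. -/
def IsPseudoLocal (U : Set (E W)) : Prop :=
  ∀ a ∈ U, ∀ b ∈ U, ∃ p : LaurentPoly (Fin 2), p ≠ 0 ∧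
    ∃ (r : ℕ) (q : Fin r → CStar) (u v : Fin r → E W),
      (∀ l, u l ∈ U ∧ v l ∈ U) ∧
      ∀ (w : W) (i j : ℤ), laurentMul p (opProd ![a, b]) ![i, j] w =
        coeff₂ (∑ l, iota (q l) • oppositeProd (u l) (v l) w) i j

/-- `U` is `𝒮`-local: for `a, b ∈ U` there are `k ∈ ℕ` and finitely many `ψ_l ∈ ℂ((x))`,
`u_l, v_l ∈ U` with `(x₁ - x₂)^k a(x₁) b(x₂) =
∑_l (x₁ - x₂)^k ι_{x₂,x₁}(ψ_l(x₂ - x₁)) u_l(x₂) v_l(x₁)`. -/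
def IsSLocal (U : Set (E W)) : Prop :=
  ∀ a ∈ U, ∀ b ∈ U, ∃ (k r : ℕ) (ψ : Fin r → LaurentSeries ℂ) (u v : Fin r → E W),
      (∀ l, u l ∈ U ∧ v l ∈ U) ∧
      ∀ (w : W) (i j : ℤ),
        laurentMul (toLaurent ((MvPolynomial.X 0 - MvPolynomial.X 1) ^ k))
          (opProd ![a, b]) ![i, j] w =
        coeff₂ (∑ l, (expandPS (MvPowerSeries.X 0 - MvPowerSeries.X 1) ^ k * expandDiff (ψ l)) •
          oppositeProd (u l) (v l) w) i j

end FormalCalculus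

end

/-! The difficulty is that `a(x₁)b(x₂)w` lies in `W((x₁))((x₂))` while `u(x₂)v(x₁)w` lies in
`W((x₂))((x₁))`. Both lie in the space of small series, those with finitely many nonzero terms in
every orthant. It contains the products of operators in every order and is a module over the power
series ring (`SmallSeries`, `wordSeries`). After clearing denominators, both kinds of locality
become the same relation in this module: `p(x,y) a(x)b(y) = ∑ f_l(x,y) u_l(y)v_l(x)`, with `p` in a
monoid `D` of nonzero polynomials and the `f_l` in an algebra `Q ⊇ D` of power series stable under
divided derivatives (`ExchangeKind`, `Exchanges`). For pseudo-locality, `D` is all nonzero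
polynomials and `Q` is all power series; for `𝒮`-locality, `D` is the powers of `x - y` and `Q` is
the power series in `y - x`.

Exchange relations imply quasi compatibility (`HasExchange.isQuasiCompatible`). To bound a product
below in one variable, move the operator carrying that variable to the far right, where it acts
first on the fixed vector `w`. Multiplication by power series preserves lower bounds.

Exchange relations pass to the products `a(x)ₙb(x)` (`Exchanges.nthProduct_left`,
`Exchanges.nthProduct_right`). On the left, move `c(x₃)` through `b(x₂)` and then through `a(x₁)`,
obtaining `f(x₂,x₃) f'(x₁,x₃) a(x₁)b(x₂)c(x₃)` as a combination of products `u(x₃)a'(x₁)b'(x₂)`. The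
substitution `x₁ = x₂ + x₀` turns this into a relation between generating series of `n`th products.
The auxiliary factor `p(x₂+x₀,x₂)` is cancelled because series bounded below in `x₀` embed in a
vector space over `ℂ((x₂))((x₀))` (`Shiftable.slicesIn`). By Taylor's formula the coefficients of
`f'(x₂+x₀,x₃)` in `x₀` are divided derivatives of `f'`, and the generating series is truncated below
in `x₀`. The relations between its coefficients are therefore triangular and can be solved
recursively (`SlicesIn.exists_denominator`).

Finally `⟨S⟩` is the increasing union of the subspaces obtained from `S ∪ {1_W}` by adjoining
products and taking spans. The exchange relations hold at every stage, hence on the union, and are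
then translated back into each form of locality. -/

open scoped BigOperators

noncomputable section

namespace FormalCalculus

/-! ### Small series and the action of power series on them -/

section SmallSeries

variable {σ τ : Type*} [Fintype σ] [Fintype τ] {V V' : Type*} [AddCommGroup V] [Module ℂ V]
  [AddCommGroup V'] [Module ℂ V']

/-- Every orthant contains only finitely many exponents of nonzero terms of `F`. -/
def IsSmall (F : (σ → ℤ) → V) : Prop :=
  ∀ K : ℤ, ∃ N : ℤ, ∀ k, (∀ s, k s ≤ K) → F k ≠ 0 → ∀ s, N ≤ k s

variable (σ V) in
/-- The series with finitely many nonzero terms in every orthant, as a subspace. -/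
def smallSubmodule : Submodule ℂ ((σ → ℤ) → V) where
  carrier := {F | IsSmall F}
  zero_mem' K := ⟨0, fun k _ h => (h rfl).elim⟩
  add_mem' {F G} hF hG K := by
    obtain ⟨N, hN⟩ := hF K
    obtain ⟨M, hM⟩ := hG K
    refine ⟨min N M, fun k hk h s => ?_⟩
    by_cases hf : F k = 0
    · have : G k ≠ 0 := fun hg => h (by simp [hf, hg])
      exact (min_le_right _ _).trans (hM k hk this s)
    · exact (min_le_left _ _).trans (hN k hk hf s)
  smul_mem' c F hF K := by
    obtain ⟨N, hN⟩ := hF K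
    exact ⟨N, fun k hk h s => hN k hk (fun h0 => h (by simp [h0])) s⟩

variable (σ V) in
/-- Formal series in the variables `σ` having finitely many nonzero terms in every orthant. -/
def SmallSeries : Type _ := smallSubmodule σ V

instance : AddCommGroup (SmallSeries σ V) := inferInstanceAs (AddCommGroup (smallSubmodule σ V))

instance : FunLike (SmallSeries σ V) (σ → ℤ) V where
  coe F := F.1
  coe_injective _ _ h := Subtype.ext h

/-- A small function as a small series. -/
def SmallSeries.mk (F : (σ → ℤ) → V) (hF : IsSmall F) : SmallSeries σ V := ⟨F, hF⟩

@[simp] theorem SmallSeries.mk_apply (F : (σ → ℤ) → V) (hF : IsSmall F) (k : σ → ℤ) :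
    SmallSeries.mk F hF k = F k := rfl

@[ext] theorem SmallSeries.ext {F G : SmallSeries σ V} (h : ∀ k, F k = G k) : F = G :=
  DFunLike.ext _ _ h

theorem SmallSeries.isSmall (F : SmallSeries σ V) : IsSmall (F : (σ → ℤ) → V) := F.2

@[simp] theorem SmallSeries.zero_apply (k : σ → ℤ) : (0 : SmallSeries σ V) k = 0 := rfl

@[simp] theorem SmallSeries.add_apply (F G : SmallSeries σ V) (k : σ → ℤ) :
    (F + G) k = F k + G k := rfl

@[simp] theorem SmallSeries.sub_apply (F G : SmallSeries σ V) (k : σ → ℤ) :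
    (F - G) k = F k - G k := rfl

/-- Evaluation at an exponent. -/
def SmallSeries.eval (k : σ → ℤ) : SmallSeries σ V →+ V where
  toFun F := F k
  map_zero' := rfl
  map_add' _ _ := rfl

@[simp] theorem SmallSeries.sum_apply {ι : Type*} (t : Finset ι) (F : ι → SmallSeries σ V)
    (k : σ → ℤ) : (∑ i ∈ t, F i) k = ∑ i ∈ t, F i k :=
  map_sum (SmallSeries.eval k) F t

open Classical in
/-- The coefficient of a power series at an integral exponent. -/
def intCoeff (f : MvPowerSeries σ ℂ) (m : σ → ℤ) : ℂ :=
  if 0 ≤ m then MvPowerSeries.coeff (Finsupp.equivFunOnFinite.symm fun s => (m s).toNat) f else 0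

theorem intCoeff_of_not_nonneg (f : MvPowerSeries σ ℂ) {m : σ → ℤ} (hm : ¬ 0 ≤ m) :
    intCoeff f m = 0 := if_neg hm

theorem nonneg_of_intCoeff_ne_zero {f : MvPowerSeries σ ℂ} {m : σ → ℤ} (h : intCoeff f m ≠ 0) :
    0 ≤ m := by
  by_contra hm
  exact h (intCoeff_of_not_nonneg f hm)

theorem intCoeff_natCast (f : MvPowerSeries σ ℂ) (m : σ →₀ ℕ) :
    intCoeff f (fun s => (m s : ℤ)) = MvPowerSeries.coeff m f := by
  rw [intCoeff, if_pos (show (0 : σ → ℤ) ≤ _ from fun s => by simp)]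
  congr
  ext s
  simp

@[simp] theorem intCoeff_zero (m : σ → ℤ) : intCoeff (0 : MvPowerSeries σ ℂ) m = 0 := by
  simp [intCoeff]

@[simp] theorem intCoeff_add (f g : MvPowerSeries σ ℂ) (m : σ → ℤ) :
    intCoeff (f + g) m = intCoeff f m + intCoeff g m := by
  unfold intCoeff
  split_ifs <;> simp

theorem intCoeff_monomial [DecidableEq σ] (n : σ →₀ ℕ) (c : ℂ) (m : σ → ℤ) :
    intCoeff (MvPowerSeries.monomial n c) m = if m = (fun s => (n s : ℤ)) then c else 0 := by
  by_cases hm : 0 ≤ m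
  · rw [intCoeff, if_pos hm, MvPowerSeries.coeff_monomial]
    congr 1
    apply propext
    constructor
    · rintro rfl
      ext s
      simpa using (Int.toNat_of_nonneg (hm s)).symm
    · rintro rfl
      ext s
      simp
  · rw [intCoeff_of_not_nonneg _ hm, if_neg]
    rintro rfl
    exact hm fun s => by simp

theorem intCoeff_one [DecidableEq σ] (m : σ → ℤ) :
    intCoeff (1 : MvPowerSeries σ ℂ) m = if m = 0 then 1 else 0 := by
  have := intCoeff_monomial (0 : σ →₀ ℕ) 1 m
  rw [MvPowerSeries.monomial_zero_one] at this
  rw [this]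
  congr 1

theorem intCoeff_mul [DecidableEq σ] (f g : MvPowerSeries σ ℂ) (m : σ → ℤ) :
    intCoeff (f * g) m = ∑ a ∈ Finset.Icc 0 m, intCoeff f (m - a) * intCoeff g a := by
  by_cases hm : 0 ≤ m
  · rw [intCoeff, if_pos hm, MvPowerSeries.coeff_mul]
    refine Finset.sum_bij' (fun p _ => fun s => (p.2 s : ℤ))
      (fun a _ => (Finsupp.equivFunOnFinite.symm fun s => (m s - a s).toNat,
        Finsupp.equivFunOnFinite.symm fun s => (a s).toNat)) ?_ ?_ ?_ ?_ ?_
    · intro p hp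
      rw [Finset.HasAntidiagonal.mem_antidiagonal] at hp
      rw [Finset.mem_Icc]
      refine ⟨fun s => by simp, fun s => ?_⟩
      have := DFunLike.congr_fun hp s
      have h0 := hm s
      simp at this h0
      dsimp only
      omega
    · intro a ha
      rw [Finset.mem_Icc] at ha
      rw [Finset.HasAntidiagonal.mem_antidiagonal]
      ext s
      have h1 : 0 ≤ a s := ha.1 s
      have h2 : a s ≤ m s := ha.2 s
      simp
      omega
    · intro p hp
      rw [Finset.HasAntidiagonal.mem_antidiagonal] at hp
      ext s
      · have := DFunLike.congr_fun hp s
        have h0 := hm s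
        simp at this h0 ⊢
        omega
      · simp
    · intro a ha
      rw [Finset.mem_Icc] at ha
      ext s
      simpa using ha.1 s
    · intro p hp
      rw [Finset.HasAntidiagonal.mem_antidiagonal] at hp
      rw [intCoeff_natCast]
      have : (m - fun s => (p.2 s : ℤ)) = fun s => (p.1 s : ℤ) := by
        ext s
        have := DFunLike.congr_fun hp s
        have h0 := hm s
        simp at this h0 ⊢
        omega
      rw [this, intCoeff_natCast]
  · rw [intCoeff_of_not_nonneg _ hm, Finset.Icc_eq_empty hm, Finset.sum_empty]

/-- The action of power series on small series. -/
def smulFun (f : MvPowerSeries σ ℂ) (F : (σ → ℤ) → V) (k : σ → ℤ) : V :=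
  ∑ᶠ l, intCoeff f (k - l) • F l

/-- Because `intCoeff f` vanishes off the nonnegative orthant, only `l ≤ k` can contribute. Any
finite set containing the contributing exponents may be used, so that one box can serve several sums
at once. -/
theorem smulFun_eq_sum (f : MvPowerSeries σ ℂ) (F : (σ → ℤ) → V) (k : σ → ℤ)
    (T : Finset (σ → ℤ)) (hT : ∀ l, l ≤ k → intCoeff f (k - l) ≠ 0 → F l ≠ 0 → l ∈ T) :
    smulFun f F k = ∑ l ∈ T, intCoeff f (k - l) • F l := by
  apply finsum_eq_sum_of_support_subset
  intro l hl
  have h1 : intCoeff f (k - l) ≠ 0 := fun h => hl (by simp [h])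
  have h2 : F l ≠ 0 := fun h => hl (by simp [h])
  exact hT l (sub_nonneg.1 (nonneg_of_intCoeff_ne_zero h1)) h1 h2

theorem IsSmall.exists_bound {F : (σ → ℤ) → V} (hF : IsSmall F) (k : σ → ℤ) :
    ∃ N : σ → ℤ, ∀ l, l ≤ k → F l ≠ 0 → N ≤ l := by
  -- Smallness is stated for orthants with equal bounds in all directions; the sum of absolute
  -- values dominates every coordinate of `k`.
  obtain ⟨N, hN⟩ := hF (∑ s, |k s|)
  refine ⟨fun _ => N, fun l hl h => hN l (fun s => ?_) h⟩
  exact (hl s).trans ((le_abs_self _).trans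
    (Finset.single_le_sum (f := fun s => |k s|) (fun i _ => abs_nonneg _) (Finset.mem_univ s)))

/-- Multiplication by a power series only raises exponents. This is how all lower bounds on supports
survive the action. -/
theorem exists_of_smulFun_ne_zero {f : MvPowerSeries σ ℂ} {F : (σ → ℤ) → V} {k : σ → ℤ}
    (h : smulFun f F k ≠ 0) : ∃ l ≤ k, F l ≠ 0 := by
  by_contra hc
  push Not at hc
  apply h
  rw [smulFun_eq_sum f F k ∅ fun l hl _ h2 => (h2 (hc l hl)).elim, Finset.sum_empty]

theorem IsSmall.smulFun {F : (σ → ℤ) → V} (hF : IsSmall F) (f : MvPowerSeries σ ℂ) :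
    IsSmall (smulFun f F) := by
  intro K
  obtain ⟨N, hN⟩ := hF K
  refine ⟨N, fun k hk h s => ?_⟩
  obtain ⟨l, hl, h0⟩ := exists_of_smulFun_ne_zero h
  exact (hN l (fun s => (hl s).trans (hk s)) h0 s).trans (hl s)

instance : SMul (MvPowerSeries σ ℂ) (SmallSeries σ V) where
  smul f F := ⟨smulFun f F, F.2.smulFun f⟩

theorem SmallSeries.smul_eq_sum (f : MvPowerSeries σ ℂ) (F : SmallSeries σ V) (k : σ → ℤ)
    (T : Finset (σ → ℤ)) (hT : ∀ l, l ≤ k → intCoeff f (k - l) ≠ 0 → F l ≠ 0 → l ∈ T) :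
    (f • F) k = ∑ l ∈ T, intCoeff f (k - l) • F l := smulFun_eq_sum f F k T hT

theorem SmallSeries.smul_eq_sum_Icc [DecidableEq σ] (f : MvPowerSeries σ ℂ) (F : SmallSeries σ V)
    {k N : σ → ℤ} (hN : ∀ l, l ≤ k → F l ≠ 0 → N ≤ l) :
    (f • F) k = ∑ l ∈ Finset.Icc N k, intCoeff f (k - l) • F l :=
  F.smul_eq_sum f k _ fun l hl _ h => Finset.mem_Icc.2 ⟨hN l hl h, hl⟩

theorem SmallSeries.exists_of_smul_ne_zero {f : MvPowerSeries σ ℂ} {F : SmallSeries σ V}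
    {k : σ → ℤ} (h : (f • F) k ≠ 0) : ∃ l ≤ k, F l ≠ 0 :=
  exists_of_smulFun_ne_zero h

open Classical in
instance : Module (MvPowerSeries σ ℂ) (SmallSeries σ V) where
  one_smul F := by
    ext k
    rw [F.smul_eq_sum 1 k {k}]
    · simp [intCoeff_one]
    · intro l _ h _
      rw [intCoeff_one] at h
      have : k - l = 0 := by
        by_contra h'
        exact h (if_neg h')
      simp [sub_eq_zero.1 this]
  -- Both products are written over the same box from `N` to `k`. Interchanging the sums leaves, for
  -- each `l`, the Cauchy product of `f` and `g` at `k - l`, with its index shifted by `l`.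
  mul_smul f g F := by
    ext k
    obtain ⟨N, hN⟩ := F.isSmall.exists_bound k
    have hN' : ∀ l, l ≤ k → (g • F) l ≠ 0 → N ≤ l := fun l hl h => by
      obtain ⟨l', hl', h'⟩ := exists_of_smulFun_ne_zero h
      exact (hN l' (hl'.trans hl) h').trans hl'
    rw [SmallSeries.smul_eq_sum_Icc _ _ hN, SmallSeries.smul_eq_sum_Icc _ _ hN']
    have h1 : ∀ a ∈ Finset.Icc N k, intCoeff f (k - a) • (g • F) a =
        ∑ l ∈ Finset.Icc N k, (intCoeff f (k - a) * intCoeff g (a - l)) • F l := by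
      intro a ha
      rw [F.smul_eq_sum g a (Finset.Icc N k), Finset.smul_sum]
      · simp [mul_smul]
      · intro l hl _ h
        have := hl.trans (Finset.mem_Icc.1 ha).2
        exact Finset.mem_Icc.2 ⟨hN l this h, this⟩
    rw [Finset.sum_congr rfl h1, Finset.sum_comm]
    refine Finset.sum_congr rfl fun l hl => ?_
    rw [← Finset.sum_smul]
    congr 1
    rw [intCoeff_mul]
    rw [← Finset.sum_subset (s₁ := Finset.Icc l k)
      (Finset.Icc_subset_Icc (Finset.mem_Icc.1 hl).1 le_rfl)]
    · refine Finset.sum_bij' (fun a _ => a + l) (fun a _ => a - l) ?_ ?_ ?_ ?_ ?_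
      · intro a ha
        rw [Finset.mem_Icc] at ha ⊢
        exact ⟨le_add_of_nonneg_left ha.1, by rw [← le_sub_iff_add_le]; exact ha.2⟩
      · intro a ha
        rw [Finset.mem_Icc] at ha ⊢
        exact ⟨sub_nonneg.2 ha.1, sub_le_sub_right ha.2 l⟩
      · intro a _
        simp
      · intro a _
        simp
      · intro a _
        rw [add_sub_cancel_right, sub_sub, add_comm a l]
    · intro a _ ha'
      have : ¬ l ≤ a := fun h => ha' (Finset.mem_Icc.2 ⟨h, by
        have := ‹a ∈ Finset.Icc N k›; exact (Finset.mem_Icc.1 this).2⟩)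
      rw [intCoeff_of_not_nonneg g (fun h => this (sub_nonneg.1 h)), mul_zero]
  smul_zero f := by
    ext k
    rw [SmallSeries.smul_eq_sum f 0 k ∅ (by simp)]
    simp
  smul_add f F G := by
    ext k
    obtain ⟨N, hN⟩ := F.isSmall.exists_bound k
    obtain ⟨M, hM⟩ := G.isSmall.exists_bound k
    have hF : ∀ l, l ≤ k → F l ≠ 0 → N ⊓ M ≤ l := fun l hl h => inf_le_left.trans (hN l hl h)
    have hG : ∀ l, l ≤ k → G l ≠ 0 → N ⊓ M ≤ l := fun l hl h => inf_le_right.trans (hM l hl h)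
    have hFG : ∀ l, l ≤ k → (F + G) l ≠ 0 → N ⊓ M ≤ l := fun l hl h => by
      by_cases h0 : F l = 0
      · exact hG l hl fun h' => h (by simp [h0, h'])
      · exact hF l hl h0
    rw [SmallSeries.add_apply, SmallSeries.smul_eq_sum_Icc _ _ hF,
      SmallSeries.smul_eq_sum_Icc _ _ hG, SmallSeries.smul_eq_sum_Icc _ _ hFG,
      ← Finset.sum_add_distrib]
    simp
  add_smul f g F := by
    ext k
    obtain ⟨N, hN⟩ := F.isSmall.exists_bound k
    rw [SmallSeries.add_apply, SmallSeries.smul_eq_sum_Icc _ _ hN,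
      SmallSeries.smul_eq_sum_Icc _ _ hN, SmallSeries.smul_eq_sum_Icc _ _ hN,
      ← Finset.sum_add_distrib]
    simp [add_smul]
  zero_smul F := by
    ext k
    rw [SmallSeries.smul_eq_sum 0 F k ∅ (by simp)]
    simp

/-- Linear maps between the coefficient spaces act on small series. -/
def SmallSeries.map (T : V →ₗ[ℂ] V') (F : SmallSeries σ V) : SmallSeries σ V' :=
  ⟨fun k => T (F k), fun K => by
    obtain ⟨N, hN⟩ := F.isSmall K
    exact ⟨N, fun k hk h => hN k hk fun h0 => h (by simp [h0])⟩⟩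

@[simp] theorem SmallSeries.map_apply (T : V →ₗ[ℂ] V') (F : SmallSeries σ V) (k : σ → ℤ) :
    F.map T k = T (F k) := rfl

theorem SmallSeries.map_smul [DecidableEq σ] (T : V →ₗ[ℂ] V') (f : MvPowerSeries σ ℂ)
    (F : SmallSeries σ V) : (f • F).map T = f • F.map T := by
  ext k
  obtain ⟨N, hN⟩ := F.isSmall.exists_bound k
  rw [map_apply, F.smul_eq_sum_Icc f hN, (F.map T).smul_eq_sum_Icc f
    (fun l hl h => hN l hl fun h0 => h (by simp [h0])), _root_.map_sum]
  simp

theorem SmallSeries.monomial_smul_apply [DecidableEq σ] (n : σ →₀ ℕ) (c : ℂ)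
    (F : SmallSeries σ V) (k : σ → ℤ) :
    (MvPowerSeries.monomial n c • F) k = c • F (fun s => k s - n s) := by
  have key : ∀ l : σ → ℤ, k - l = (fun s => (n s : ℤ)) ↔ l = fun s => k s - n s := by
    intro l
    constructor
    · intro h
      ext s
      have := congrFun h s
      simp at this
      omega
    · rintro rfl
      ext s
      simp
  rw [F.smul_eq_sum _ k {fun s => k s - n s}]
  · rw [Finset.sum_singleton, intCoeff_monomial, if_pos ((key _).2 rfl)]
  · intro l _ h _
    rw [intCoeff_monomial] at h
    rw [Finset.mem_singleton, ← key]
    by_contra h'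
    exact h (if_neg h')

theorem intCoeff_rename {e : τ → σ} (he : Function.Injective e)
    (f : MvPowerSeries τ ℂ) (m : σ → ℤ) (hm : ∀ s, s ∉ Set.range e → m s = 0) :
    intCoeff (MvPowerSeries.rename e f) m = intCoeff f (m ∘ e) := by
  by_cases h : 0 ≤ m
  · have h' : 0 ≤ m ∘ e := fun s => h (e s)
    rw [intCoeff, intCoeff, if_pos h, if_pos h']
    have := MvPowerSeries.coeff_embDomain_rename ⟨e, he⟩ f
      (Finsupp.equivFunOnFinite.symm fun s => ((m ∘ e) s).toNat)
    rw [← this]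
    congr
    ext s
    by_cases hs : s ∈ Set.range e
    · obtain ⟨t, rfl⟩ := hs
      have := Finsupp.embDomain_apply_self ⟨e, he⟩
        (Finsupp.equivFunOnFinite.symm fun s => ((m ∘ e) s).toNat) t
      simp only [Function.Embedding.coeFn_mk] at this
      rw [this]
      simp
    · rw [Finsupp.embDomain_of_notMem_range _ _ _ (by simpa using hs)]
      simp [hm s hs]
  · rw [intCoeff_of_not_nonneg _ h, intCoeff_of_not_nonneg]
    intro h'
    apply h
    intro s
    by_cases hs : s ∈ Set.range e
    · obtain ⟨t, rfl⟩ := hs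
      exact h' t
    · simp [hm s hs]

theorem eq_zero_of_intCoeff_rename_ne_zero {e : τ → σ} {f : MvPowerSeries τ ℂ} {m : σ → ℤ}
    (h : intCoeff (MvPowerSeries.rename e f) m ≠ 0) (s : σ) (hs : s ∉ Set.range e) : m s = 0 := by
  classical
  have hm := nonneg_of_intCoeff_ne_zero h
  rw [intCoeff, if_pos hm] at h
  by_contra hne
  apply h
  apply MvPowerSeries.coeff_rename_eq_zero
  rintro ⟨x, hx⟩
  have h1 := DFunLike.congr_fun hx s
  rw [Finsupp.mapDomain_of_notMem_range _ _ hs] at h1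
  have := hm s
  simp at h1 this
  omega

/-- Multiplication by a series in some of the variables only involves these variables. -/
theorem SmallSeries.rename_smul_apply {e : τ → σ} (he : Function.Injective e)
    (f : MvPowerSeries τ ℂ) (F : SmallSeries σ V) (k : σ → ℤ) (G : SmallSeries τ V)
    (hG : ∀ n, G n = F (Function.extend e n k)) :
    (MvPowerSeries.rename e f • F) k = (f • G) (k ∘ e) := by
  classical
  obtain ⟨N, hN⟩ := G.isSmall.exists_bound (k ∘ e)
  have hinj : Function.Injective fun n : τ → ℤ => Function.extend e n k := fun a b h => by
    ext t
    have := congrFun h (e t)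
    simpa [he.extend_apply] using this
  have hcomp : ∀ n : τ → ℤ, Function.extend e n k ∘ e = n := fun n => by
    ext t
    simp [he.extend_apply]
  rw [G.smul_eq_sum_Icc f hN, F.smul_eq_sum _ k
    ((Finset.Icc N (k ∘ e)).image fun n => Function.extend e n k), Finset.sum_image hinj.injOn]
  · refine Finset.sum_congr rfl fun n _ => ?_
    rw [hG, intCoeff_rename he]
    · congr 2
      ext t
      simp [he.extend_apply]
    · intro s hs
      have : ¬ ∃ a, e a = s := hs
      simp [Function.extend_apply' _ _ _ this]
  · intro l hl h1 h2
    have hl' : l = Function.extend e (l ∘ e) k := by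
      ext s
      by_cases hs : s ∈ Set.range e
      · obtain ⟨t, rfl⟩ := hs
        simp [he.extend_apply]
      · have := eq_zero_of_intCoeff_rename_ne_zero h1 s hs
        rw [Function.extend_apply' _ _ _ hs]
        simp at this
        omega
    rw [Finset.mem_image]
    refine ⟨l ∘ e, Finset.mem_Icc.2 ⟨hN _ (fun t => hl _) ?_, fun t => hl _⟩, hl'.symm⟩
    rwa [hG, ← hl']

end SmallSeries

/-! ### Coefficients of powers of the first variable -/

section Slices

variable {V : Type*} [AddCommGroup V] [Module ℂ V] {n : ℕ}

/-- The coefficient of `x₀ ^ t`, as a series in the remaining variables. -/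
def SmallSeries.slice (t : ℤ) : SmallSeries (Fin (n + 1)) V →+ SmallSeries (Fin n) V where
  toFun F := SmallSeries.mk (fun k => F (Fin.cons t k)) fun K => by
    obtain ⟨N, hN⟩ := F.isSmall (max K t)
    refine ⟨N, fun k hk h s => ?_⟩
    have := hN _ (fun s => ?_) h s.succ
    · simpa using this
    · refine Fin.cases ?_ (fun i => ?_) s
      · simp
      · simpa using Or.inl (hk i)
  map_zero' := rfl
  map_add' _ _ := rfl

@[simp] theorem SmallSeries.slice_apply (t : ℤ) (F : SmallSeries (Fin (n + 1)) V)
    (k : Fin n → ℤ) : F.slice t k = F (Fin.cons t k) := rfl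

/-- The coefficient of `x₀ ^ t` of a power series, as a power series in the remaining variables. -/
def sliceCoeff (t : ℕ) (f : MvPowerSeries (Fin (n + 1)) ℂ) : MvPowerSeries (Fin n) ℂ :=
  fun m => MvPowerSeries.coeff (Finsupp.cons t m) f

theorem intCoeff_sliceCoeff (t : ℕ) (f : MvPowerSeries (Fin (n + 1)) ℂ) (k : Fin n → ℤ) :
    intCoeff (sliceCoeff t f) k = intCoeff f (Fin.cons (t : ℤ) k) := by
  by_cases h : 0 ≤ k
  · have h' : (0 : Fin (n + 1) → ℤ) ≤ Fin.cons (t : ℤ) k := fun s => by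
      refine Fin.cases ?_ (fun i => ?_) s
      · simp
      · simpa using h i
    rw [intCoeff, intCoeff, if_pos h, if_pos h']
    change MvPowerSeries.coeff _ f = _
    congr 2
    ext s
    refine Fin.cases ?_ (fun i => ?_) s
    · simp
    · simp
  · rw [intCoeff_of_not_nonneg _ h, intCoeff_of_not_nonneg]
    intro h'
    exact h fun i => by simpa using h' i.succ

/-- The coefficients of powers of `x₀` in a product with a series bounded below in `x₀`. -/
theorem SmallSeries.slice_smul (f : MvPowerSeries (Fin (n + 1)) ℂ)
    (F : SmallSeries (Fin (n + 1)) V) {N : ℤ} (hN : ∀ k, F k ≠ 0 → N ≤ k 0) (t : ℤ) :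
    (f • F).slice t = ∑ i ∈ Finset.range (t - N + 1).toNat,
      sliceCoeff i f • F.slice (t - i) := by
  ext k
  obtain ⟨M, hM⟩ := F.isSmall.exists_bound (Fin.cons t k)
  have hM' : ∀ i : ℕ, ∀ l, l ≤ k → F.slice (t - i) l ≠ 0 → Fin.tail M ≤ l := by
    intro i l hl h s
    have := hM (Fin.cons (t - i) l) (fun s => ?_) h s.succ
    · exact this
    · refine Fin.cases ?_ (fun i => ?_) s
      · simp
      · simpa using hl i
  -- The slice at `t - i` can be nonzero only if `N ≤ t - i`, which explains the length `(t - N +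
  -- 1).toNat`; it is `0` when `t < N`.
  rw [sum_apply, slice_apply, F.smul_eq_sum f _
    ((Finset.range (t - N + 1).toNat ×ˢ Finset.Icc (Fin.tail M) k).image
      fun p => Fin.cons (t - p.1) p.2), Finset.sum_image, Finset.sum_product]
  · refine Finset.sum_congr rfl fun i _ => ?_
    rw [(F.slice (t - i)).smul_eq_sum_Icc (sliceCoeff i f) (hM' i)]
    refine Finset.sum_congr rfl fun l _ => ?_
    rw [intCoeff_sliceCoeff, slice_apply]
    congr 2
    ext s
    refine Fin.cases ?_ (fun i => ?_) s
    · simp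
    · simp
  · rintro ⟨i, l⟩ _ ⟨i', l'⟩ _ h
    have h0 := congrFun h 0
    have h1 := congrArg Fin.tail h
    simp at h0 h1
    simp [h0, h1]
  · intro l hl h1 h2
    have h0 : l 0 ≤ t := hl 0
    have h3 := hN l h2
    rw [Finset.mem_image]
    refine ⟨((t - l 0).toNat, Fin.tail l), ?_, ?_⟩
    · rw [Finset.mem_product, Finset.mem_range, Finset.mem_Icc]
      exact ⟨by dsimp only; omega, fun s => hM l hl h2 s.succ, fun s => hl s.succ⟩
    · ext s
      refine Fin.cases ?_ (fun i => ?_) s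
      · simp
        omega
      · simp [Fin.tail]

end Slices

/-! ### Products of operators as small series -/

section Words

variable {W : Type*} [AddCommGroup W] [Module ℂ W] {σ : Type*}

theorem exists_coeff_bound (a : E W) (w : W) :
    ∃ N : ℤ, ∀ i, HVertexOperator.coeff a i w ≠ 0 → N ≤ i :=
  ⟨_, fun i hi => not_lt.1 fun h => hi (VertexOperator.coeff_eq_zero_of_lt_order a i w h)⟩

/-- The coefficients of the product `a₁(x_{s₁}) ⋯ a_r(x_{s_r})`. -/
def wordOp (L : List (E W × σ)) (k : σ → ℤ) : Module.End ℂ W :=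
  (L.map fun q => (HVertexOperator.coeff q.1 (k q.2) : Module.End ℂ W)).prod

@[simp] theorem wordOp_nil (k : σ → ℤ) : wordOp ([] : List (E W × σ)) k = 1 := rfl

@[simp] theorem wordOp_cons (q : E W × σ) (L : List (E W × σ)) (k : σ → ℤ) :
    wordOp (q :: L) k = (HVertexOperator.coeff q.1 (k q.2) : Module.End ℂ W) * wordOp L k := by
  simp [wordOp]

@[simp] theorem wordOp_append (L R : List (E W × σ)) (k : σ → ℤ) :
    wordOp (L ++ R) k = wordOp L k * wordOp R k := by
  simp [wordOp]

theorem wordOp_congr {L : List (E W × σ)} {k k' : σ → ℤ} (h : ∀ q ∈ L, k q.2 = k' q.2) :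
    wordOp L k = wordOp L k' := by
  unfold wordOp
  congr 1
  exact List.map_congr_left fun q hq => by rw [h q hq]

/-- The lower bound of `a(x)v` depends on `v`, so the induction must also carry the finiteness of
the set `A` of vectors produced so far. Over a finite set the bounds have a common minimum `M`, and
the next exponent then ranges over the finite interval from `M` to `K`. -/
theorem wordOp_finite (L : List (E W × σ)) (w : W) (K : ℤ) :
    ∃ (A : Finset W) (N : ℤ), ∀ k : σ → ℤ, (∀ q ∈ L, k q.2 ≤ K) →
      wordOp L k w ∈ A ∧ (wordOp L k w ≠ 0 → ∀ q ∈ L, N ≤ k q.2) := by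
  classical
  induction L with
  | nil => exact ⟨{w}, 0, fun k _ => ⟨by simp, by simp⟩⟩
  | cons q L ih =>
    obtain ⟨A, N, h⟩ := ih
    choose b hb using exists_coeff_bound q.1
    obtain ⟨M, hM⟩ : ∃ M : ℤ, ∀ v ∈ A, M ≤ b v := by
      obtain ⟨M, hM⟩ := (A.image b).bddBelow
      exact ⟨M, fun v hv => hM (Finset.mem_coe.2 (Finset.mem_image_of_mem b hv))⟩
    refine ⟨insert 0 ((Finset.Icc M K ×ˢ A).image fun p => HVertexOperator.coeff q.1 p.1 p.2),
      min M N, fun k hk => ?_⟩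
    have hk' : ∀ q ∈ L, k q.2 ≤ K := fun q hq => hk q (List.mem_cons_of_mem _ hq)
    obtain ⟨h1, h2⟩ := h k hk'
    have hval : wordOp (q :: L) k w = HVertexOperator.coeff q.1 (k q.2) (wordOp L k w) := by
      rw [wordOp_cons]
      rfl
    have hlow : wordOp (q :: L) k w ≠ 0 → M ≤ k q.2 := fun h0 =>
      (hM _ h1).trans (hb _ _ (by rwa [← hval]))
    constructor
    · rw [Finset.mem_insert]
      by_cases h0 : wordOp (q :: L) k w = 0
      · exact Or.inl h0
      · refine Or.inr (Finset.mem_image.2 ⟨(k q.2, wordOp L k w), ?_, hval.symm⟩)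
        exact Finset.mem_product.2
          ⟨Finset.mem_Icc.2 ⟨hlow h0, hk q List.mem_cons_self⟩, h1⟩
    · intro h0 q' hq'
      rcases List.mem_cons.1 hq' with rfl | hq'
      · exact (min_le_left _ _).trans (hlow h0)
      · refine (min_le_right _ _).trans (h2 (fun h3 => h0 ?_) q' hq')
        rw [hval, h3, map_zero]

/-- Every variable occurs in the word. -/
def Exhausts (L : List (E W × σ)) : Prop := ∀ s, ∃ q ∈ L, q.2 = s

/-- The product `a₁(x_{s₁}) ⋯ a_r(x_{s_r}) w` as a small series. -/
def wordSeries (L : List (E W × σ)) (hL : Exhausts L) (w : W) : SmallSeries σ W :=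
  SmallSeries.mk (fun k => wordOp L k w) fun K => by
    obtain ⟨A, N, h⟩ := wordOp_finite L w K
    refine ⟨N, fun k hk h0 s => ?_⟩
    obtain ⟨q, hq, rfl⟩ := hL s
    exact (h k fun q _ => hk _).2 h0 q hq

@[simp] theorem wordSeries_apply (L : List (E W × σ)) (hL : Exhausts L) (w : W) (k : σ → ℤ) :
    wordSeries L hL w k = wordOp L k w := rfl

theorem exhausts_pair (a b : E W) : Exhausts [(a, (0 : Fin 2)), (b, 1)] := by
  intro s
  fin_cases s <;> simp

theorem exhausts_opp (u v : E W) : Exhausts [(u, (1 : Fin 2)), (v, 0)] := by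
  intro s
  fin_cases s <;> simp

/-- The series `a(x) b(y) w`. -/
def pairSeries (a b : E W) (w : W) : SmallSeries (Fin 2) W :=
  wordSeries [(a, 0), (b, 1)] (exhausts_pair a b) w

/-- The series `u(y) v(x) w`. -/
def oppSeries (u v : E W) (w : W) : SmallSeries (Fin 2) W :=
  wordSeries [(u, 1), (v, 0)] (exhausts_opp u v) w

theorem pairSeries_apply (a b : E W) (w : W) (k : Fin 2 → ℤ) : pairSeries a b w k =
    HVertexOperator.coeff a (k 0) (HVertexOperator.coeff b (k 1) w) := by
  simp [pairSeries]

theorem oppSeries_apply (u v : E W) (w : W) (k : Fin 2 → ℤ) : oppSeries u v w k =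
    HVertexOperator.coeff u (k 1) (HVertexOperator.coeff v (k 0) w) := by
  simp [oppSeries]

/-- A series in `x_s, x_j` alone changes only the exponents of these two variables, while the
coefficients of `L` and `R` depend only on the others. The multiplication therefore takes place
inside the word, with `wordOp L k` applied as a fixed linear map and `wordOp R k w` as a fixed
vector. -/
theorem rename_smul_context [Fintype σ] {s j : σ} (hsj : s ≠ j) (L R : List (E W × σ))
    (hL : ∀ q ∈ L, q.2 ≠ s ∧ q.2 ≠ j) (hR : ∀ q ∈ R, q.2 ≠ s ∧ q.2 ≠ j)
    (X : W → SmallSeries (Fin 2) W) (Y : SmallSeries σ W) (w : W)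
    (hY : ∀ k, Y k = wordOp L k (X (wordOp R k w) ![k s, k j])) (f : MvPowerSeries (Fin 2) ℂ)
    (k : σ → ℤ) :
    (MvPowerSeries.rename ![s, j] f • Y) k =
      wordOp L k ((f • X (wordOp R k w)) ![k s, k j]) := by
  have hinj : Function.Injective ![s, j] := by
    intro a b
    fin_cases a <;> fin_cases b <;> simp [hsj, hsj.symm]
  have hext : ∀ (n : Fin 2 → ℤ) (A : List (E W × σ)), (∀ q ∈ A, q.2 ≠ s ∧ q.2 ≠ j) →
      wordOp A (Function.extend ![s, j] n k) = wordOp A k := by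
    intro n A hA
    refine wordOp_congr fun q hq => ?_
    rw [Function.extend_apply']
    rintro ⟨t, ht⟩
    have := hA q hq
    fin_cases t <;> simp_all
  rw [SmallSeries.rename_smul_apply hinj f Y k ((X (wordOp R k w)).map (wordOp L k)),
    ← SmallSeries.map_smul, SmallSeries.map_apply]
  · congr 2
    ext i
    fin_cases i <;> rfl
  · intro n
    rw [hY, hext n L hL, hext n R hR, SmallSeries.map_apply]
    congr 2
    ext i
    have h0 := hinj.extend_apply n k 0
    have h1 := hinj.extend_apply n k 1
    fin_cases i
    · exact h0.symm
    · exact h1.symm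

/-- An exchange relation holds inside every word. -/
theorem exchange_in_word [Fintype σ] {ι : Type*} [Fintype ι] {p : MvPowerSeries (Fin 2) ℂ}
    {a b : E W} {f : ι → MvPowerSeries (Fin 2) ℂ} {u v : ι → E W}
    (h : ∀ w, p • pairSeries a b w = ∑ l, f l • oppSeries (u l) (v l) w)
    {s j : σ} (hsj : s ≠ j) (L R : List (E W × σ))
    (hL : ∀ q ∈ L, q.2 ≠ s ∧ q.2 ≠ j) (hR : ∀ q ∈ R, q.2 ≠ s ∧ q.2 ≠ j)
    (h1 : Exhausts (L ++ (a, s) :: (b, j) :: R))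
    (h2 : ∀ l, Exhausts (L ++ (u l, j) :: (v l, s) :: R)) (w : W) :
    MvPowerSeries.rename ![s, j] p • wordSeries _ h1 w =
      ∑ l, MvPowerSeries.rename ![s, j] (f l) • wordSeries _ (h2 l) w := by
  ext k
  rw [rename_smul_context hsj L R hL hR (pairSeries a b) _ w, h, SmallSeries.sum_apply,
    SmallSeries.sum_apply, map_sum]
  · refine Finset.sum_congr rfl fun l _ => ?_
    rw [rename_smul_context hsj L R hL hR (oppSeries (u l) (v l)) _ w]
    intro k
    simp [oppSeries_apply]
  · intro k
    simp [pairSeries_apply]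

end Words

/-! ### Comparison with Laurent polynomials and iterated Laurent series -/

section Bridges

variable {W : Type*} [AddCommGroup W] [Module ℂ W]

theorem laurentMul_add {σ : Type*} (p q : LaurentPoly σ) (F : OpSeries σ W) :
    laurentMul (p + q) F = laurentMul p F + laurentMul q F := by
  classical
  ext k : 1
  simp only [laurentMul, Pi.add_apply, AddMonoidAlgebra.coeff_add]
  exact Finsupp.sum_add_index' (by simp) (by simp [add_smul])

theorem laurentMul_single {σ : Type*} (m : σ → ℤ) (c : ℂ) (F : OpSeries σ W) (k : σ → ℤ) :
    laurentMul (AddMonoidAlgebra.single m c) F k = c • F (k - m) := by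
  simp only [laurentMul, AddMonoidAlgebra.coeff_single]
  exact Finsupp.sum_single_index (by simp)

theorem toLaurent_monomial {σ : Type*} [Fintype σ] [DecidableEq σ] (m : σ →₀ ℕ) (c : ℂ) :
    toLaurent (MvPolynomial.monomial m c) =
      AddMonoidAlgebra.single (fun s => (m s : ℤ)) c := by
  rw [toLaurent, MvPolynomial.aeval_monomial, Finsupp.prod_fintype _ _ (by simp)]
  have h : ∀ s, (AddMonoidAlgebra.single (Pi.single s (1 : ℤ)) (1 : ℂ) : LaurentPoly σ) ^ (m s) =
      AddMonoidAlgebra.single (m s • Pi.single s (1 : ℤ)) 1 := fun s => by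
    rw [AddMonoidAlgebra.single_pow, one_pow]
  simp_rw [h]
  have h2 : ∀ t : Finset σ, (∏ s ∈ t,
      (AddMonoidAlgebra.single (m s • Pi.single s (1 : ℤ)) (1 : ℂ) : LaurentPoly σ)) =
      AddMonoidAlgebra.single (∑ s ∈ t, m s • Pi.single s (1 : ℤ)) 1 := fun t => by
    induction t using Finset.induction_on with
    | empty => rfl
    | insert a t ha ih =>
      rw [Finset.prod_insert ha, Finset.sum_insert ha, ih, AddMonoidAlgebra.single_mul_single,
        one_mul]
  rw [h2, AddMonoidAlgebra.coe_algebraMap]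
  simp only [Function.comp_apply, AddMonoidAlgebra.single_mul_single, zero_add, mul_one,
    Algebra.algebraMap_self, RingHom.id_apply]
  congr 1
  ext s
  simp [Finset.sum_apply, Pi.single_apply]

/-- By additivity this reduces to monomials, which shift exponents in both actions. -/
theorem smul_apply_eq_laurentMul {σ : Type*} [Fintype σ] [DecidableEq σ] (p : MvPolynomial σ ℂ)
    (F : OpSeries σ W) (w : W) (G : SmallSeries σ W) (hG : ∀ k, G k = F k w) (k : σ → ℤ) :
    ((p : MvPowerSeries σ ℂ) • G) k = laurentMul (toLaurent p) F k w := by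
  induction p using MvPolynomial.induction_on' with
  | monomial m c =>
    rw [toLaurent_monomial, laurentMul_single, MvPolynomial.coe_monomial,
      SmallSeries.monomial_smul_apply, hG]
    rfl
  | add p q hp hq =>
    rw [MvPolynomial.coe_add, add_smul, SmallSeries.add_apply, hp, hq, map_add, laurentMul_add]
    rfl

/-- The antidiagonal in Mathlib's formula is projected to its second coordinate, after which any
finite set containing the contributing exponents is allowed. -/
theorem hahnModule_smul_coeff {R V : Type*} [CommRing R] [AddCommGroup V] [Module R V]
    (x : HahnSeries ℤ R) (y : HahnModule ℤ R V) (a : ℤ) (T : Finset ℤ)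
    (hT : ∀ l, x.coeff (a - l) ≠ 0 → ((HahnModule.of R).symm y).coeff l ≠ 0 → l ∈ T) :
    ((HahnModule.of R).symm (x • y)).coeff a =
      ∑ l ∈ T, x.coeff (a - l) • ((HahnModule.of R).symm y).coeff l := by
  rw [HahnModule.coeff_smul]
  refine Finset.sum_of_injOn (fun p => p.2) ?_ ?_ ?_ ?_
  · intro p hp q hq h
    have hp' := ((Finset.mem_vaddAntidiagonal _ _).1 (Finset.mem_coe.1 hp)).2.2
    have hq' := ((Finset.mem_vaddAntidiagonal _ _).1 (Finset.mem_coe.1 hq)).2.2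
    simp only [vadd_eq_add] at hp' hq' h
    ext
    · omega
    · exact h
  · intro p hp
    have hp' := (Finset.mem_vaddAntidiagonal _ _).1 (Finset.mem_coe.1 hp)
    simp only [vadd_eq_add] at hp'
    refine hT _ ?_ hp'.2.1
    have : a - p.2 = p.1 := by omega
    rw [this]
    exact hp'.1
  · intro l _ hl
    by_contra h
    apply hl
    refine ⟨(a - l, l), Finset.mem_coe.2 ((Finset.mem_vaddAntidiagonal _ _).2 ⟨?_, ?_, ?_⟩), rfl⟩
    · exact fun h0 => h (by simp [h0])
    · exact fun h0 => h (by simp [h0])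
    · simp
  · intro p hp
    have hp' := (Finset.mem_vaddAntidiagonal _ _).1 hp
    simp only [vadd_eq_add] at hp'
    have : a - p.2 = p.1 := by omega
    rw [this]

theorem hahnSeries_bddBelow {R : Type*} [Zero R] (x : HahnSeries ℤ R) :
    ∃ N : ℤ, ∀ i, x.coeff i ≠ 0 → N ≤ i :=
  ⟨x.order, fun _ hi => not_lt.1 fun h => hi (HahnSeries.coeff_eq_zero_of_lt_order h)⟩

theorem coeff₂_bounds (F : IterLaurentW W) : ∃ N : ℤ, ∀ i j, coeff₂ F i j ≠ 0 → N ≤ i := by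
  obtain ⟨N, hN⟩ := hahnSeries_bddBelow
    ((HahnModule.of (LaurentSeries ℂ)).symm F : HahnSeries ℤ (LaurentW W))
  refine ⟨N, fun i j h => hN i fun h0 => h ?_⟩
  unfold coeff₂ outerCoeff
  rw [h0]
  rfl

theorem coeff₂_inner_bound (F : IterLaurentW W) (i : ℤ) :
    ∃ N : ℤ, ∀ j, coeff₂ F i j ≠ 0 → N ≤ j :=
  hahnSeries_bddBelow ((HahnModule.of ℂ).symm (outerCoeff F i))

/-- The coefficients of an element of `W((y))((x))` as a small series in `x`, `y`. -/
def toSmall : IterLaurentW W →+ SmallSeries (Fin 2) W where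
  toFun F := SmallSeries.mk (fun k => coeff₂ F (k 0) (k 1)) fun K => by
    obtain ⟨N, hN⟩ := coeff₂_bounds F
    choose b hb using coeff₂_inner_bound F
    obtain ⟨M, hM⟩ := ((Finset.Icc N K).image b).bddBelow
    refine ⟨min N M, fun k hk h s => ?_⟩
    have h0 := hN _ _ h
    fin_cases s
    · exact (min_le_left _ _).trans h0
    · exact (min_le_right _ _).trans ((hM (Finset.mem_coe.2 (Finset.mem_image_of_mem b
        (Finset.mem_Icc.2 ⟨h0, hk 0⟩)))).trans (hb _ _ h))
  map_zero' := rfl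
  map_add' _ _ := rfl

@[simp] theorem toSmall_apply (F : IterLaurentW W) (k : Fin 2 → ℤ) :
    toSmall F k = coeff₂ F (k 0) (k 1) := rfl

theorem toSmall_injective : Function.Injective (toSmall (W := W)) := fun F G h =>
  iterLaurentW_ext fun i j => DFunLike.congr_fun h ![i, j]

/-- Together with `coeff₂_bounds`, this identifies `W((y))((x))` with the small series bounded below
in `x`. -/
theorem exists_toSmall_eq (F : SmallSeries (Fin 2) W) {N : ℤ} (hN : ∀ k, F k ≠ 0 → N ≤ k 0) :
    ∃ G : IterLaurentW W, toSmall G = F := by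
  -- For fixed `i`, smallness in the orthant bounded by `i` controls the exponents `j ≤ i`; the
  -- remaining `j` are bounded below by `i` itself.
  have hin : ∀ i : ℤ, BddBelow (Function.support fun j => F ![i, j]) := fun i => by
    obtain ⟨M, hM⟩ := F.isSmall i
    refine ⟨min M i, fun j hj => ?_⟩
    by_cases hji : j ≤ i
    · have := hM ![i, j] (fun s => by fin_cases s <;> simp [hji]) hj 1
      exact (min_le_left _ _).trans this
    · exact (min_le_right _ _).trans (not_le.1 hji).le
  refine ⟨IterLaurentW.mk (HahnSeries.ofSuppBddBelow (fun i : ℤ => (HahnModule.of ℂ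
    (HahnSeries.ofSuppBddBelow (fun j => F ![i, j]) (hin i)) : HahnModule ℤ ℂ W)) ?_), ?_⟩
  · refine ⟨N, fun i hi => ?_⟩
    by_contra hlt
    apply hi
    apply HahnModule.ext
    funext j
    change F ![i, j] = 0
    by_contra h
    exact hlt (by simpa using hN _ h)
  · ext k
    change F ![k 0, k 1] = F k
    congr
    ext s
    fin_cases s <;> rfl

theorem ofPowerSeries_coeff {R : Type*} [CommSemiring R] (f : PowerSeries R) (i : ℤ) :
    (HahnSeries.ofPowerSeries ℤ R f).coeff i =
      if 0 ≤ i then PowerSeries.coeff i.toNat f else 0 := by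
  split_ifs with h
  · obtain ⟨n, rfl⟩ := Int.eq_ofNat_of_zero_le h
    rw [HahnSeries.ofPowerSeries_apply_coeff]
    simp
  · rw [HahnSeries.ofPowerSeries_apply, HahnSeries.embDomain_of_notMem_range]
    rintro ⟨n, hn⟩
    simp at hn
    omega

theorem expandPS_coeff₂ (f : MvPowerSeries (Fin 2) ℂ) (i j : ℤ) :
    (expandPS f).coeff₂ i j = intCoeff f ![i, j] := by
  have h : (expandPS f).coeff₂ i j = ((HahnSeries.ofPowerSeries ℤ (LaurentSeries ℂ)
      (PowerSeries.map expandInner (MvPowerSeries.finSuccEquiv ℂ 1 f))).coeff i).coeff j := rfl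
  have hnn : (0 : Fin 2 → ℤ) ≤ ![i, j] ↔ 0 ≤ i ∧ 0 ≤ j := by
    simp [Pi.le_def, Fin.forall_fin_two]
  rw [h, ofPowerSeries_coeff, intCoeff]
  by_cases hi : 0 ≤ i
  · rw [if_pos hi, PowerSeries.coeff_map]
    have h' : (expandInner (PowerSeries.coeff i.toNat (MvPowerSeries.finSuccEquiv ℂ 1 f))).coeff j =
      (HahnSeries.ofPowerSeries ℤ ℂ (MvPowerSeries.renameEquiv ℂ (Equiv.ofUnique (Fin 1) Unit)
        (PowerSeries.coeff i.toNat (MvPowerSeries.finSuccEquiv ℂ 1 f)))).coeff j := rfl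
    rw [h', ofPowerSeries_coeff]
    by_cases hj : 0 ≤ j
    · rw [if_pos hj, if_pos (hnn.2 ⟨hi, hj⟩)]
      have h2 := MvPowerSeries.coeff_embDomain_rename
        (Equiv.ofUnique (Fin 1) Unit).toEmbedding
        (PowerSeries.coeff i.toNat (MvPowerSeries.finSuccEquiv ℂ 1 f))
        (Finsupp.single 0 j.toNat)
      rw [MvPowerSeries.coeff_coeff_finSuccEquiv] at h2
      have h3 : Finsupp.cons i.toNat (Finsupp.single (0 : Fin 1) j.toNat) =
          Finsupp.equivFunOnFinite.symm fun s => (![i, j] s).toNat := by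
        ext s
        fin_cases s
        · simp
        · exact Finsupp.cons_succ (0 : Fin 1) i.toNat _ |>.trans (by simp)
      rw [← h3, ← h2, PowerSeries.coeff]
      congr 2
      rw [Finsupp.embDomain_single]
    · rw [if_neg hj, if_neg fun h => hj (hnn.1 h).2]
  · rw [if_neg hi, if_neg fun h => hi (hnn.1 h).1]
    rfl

theorem outerCoeff_smul (x : IterLaurent) (F : IterLaurentW W) (i : ℤ) (T : Finset ℤ)
    (hT : ∀ l, (IterLaurent.equiv.symm x).coeff (i - l) ≠ 0 → outerCoeff F l ≠ 0 → l ∈ T) :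
    outerCoeff (x • F) i =
      ∑ l ∈ T, ((IterLaurent.equiv.symm x).coeff (i - l) • outerCoeff F l : HahnModule ℤ ℂ W) :=
  hahnModule_smul_coeff (R := LaurentSeries ℂ) (V := LaurentW W) x F i T hT

theorem coeff₂_smul (x : IterLaurent) (F : IterLaurentW W) (i j : ℤ) (T : Finset (ℤ × ℤ))
    (hT : ∀ q : ℤ × ℤ, x.coeff₂ (i - q.1) (j - q.2) ≠ 0 → coeff₂ F q.1 q.2 ≠ 0 → q ∈ T) :
    coeff₂ (x • F) i j = ∑ q ∈ T, x.coeff₂ (i - q.1) (j - q.2) • coeff₂ F q.1 q.2 := by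
  classical
  set y := IterLaurent.equiv.symm x with hy
  obtain ⟨N, hN⟩ := hahnSeries_bddBelow y
  obtain ⟨M, hM⟩ := hahnSeries_bddBelow
    ((HahnModule.of (LaurentSeries ℂ)).symm F : HahnSeries ℤ (LaurentW W))
  choose b hb using fun l => hahnSeries_bddBelow (y.coeff l)
  choose c hc using coeff₂_inner_bound F
  set A := Finset.Icc M (i - N)
  -- The range of inner exponents depends on `l`; the union over the finitely many outer exponents
  -- makes the double sum a sum over one product set.
  set B := A.biUnion fun l => Finset.Icc (c l) (j - b (i - l))
  have h1 : coeff₂ (x • F) i j =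
      ∑ l ∈ A, ((HahnModule.of ℂ).symm (y.coeff (i - l) • outerCoeff F l)).coeff j := by
    unfold coeff₂
    rw [outerCoeff_smul x F i A]
    · have : ∀ (t : Finset ℤ) (g : ℤ → HahnModule ℤ ℂ W),
          ((HahnModule.of ℂ).symm (∑ l ∈ t, g l)).coeff j =
            ∑ l ∈ t, ((HahnModule.of ℂ).symm (g l)).coeff j := fun t g => by
        induction t using Finset.induction_on with
        | empty => rfl
        | insert a t ha ih =>
          rw [Finset.sum_insert ha, Finset.sum_insert ha, ← ih]
          rfl
      rw [this]
    · intro l hl hl'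
      have := hN _ hl
      exact Finset.mem_Icc.2 ⟨hM l hl', by omega⟩
  have h2 : ∀ l ∈ A, ((HahnModule.of ℂ).symm (y.coeff (i - l) • outerCoeff F l)).coeff j =
      ∑ m ∈ B, x.coeff₂ (i - l) (j - m) • coeff₂ F l m := by
    intro l hl
    refine hahnModule_smul_coeff (y.coeff (i - l)) (outerCoeff F l) j B fun m hm hm' => ?_
    have := hb _ _ hm
    exact Finset.mem_biUnion.2 ⟨l, hl, Finset.mem_Icc.2 ⟨hc l m hm', by omega⟩⟩
  rw [h1, Finset.sum_congr rfl h2, ← Finset.sum_product']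
  have key : ∀ q : ℤ × ℤ, x.coeff₂ (i - q.1) (j - q.2) • coeff₂ F q.1 q.2 ≠ 0 →
      q ∈ T ∧ q ∈ A ×ˢ B := by
    rintro ⟨l, m⟩ h
    have hx : x.coeff₂ (i - l) (j - m) ≠ 0 := fun h0 => h (by simp [h0])
    have hF : coeff₂ F l m ≠ 0 := fun h0 => h (by simp [h0])
    have e1 : N ≤ i - l := hN _ fun h0 => hx (by
      change (y.coeff (i - l)).coeff (j - m) = 0
      rw [h0]
      rfl)
    have e2 : M ≤ l := hM _ fun h0 => hF (by
      unfold coeff₂ outerCoeff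
      rw [h0]
      rfl)
    have e3 : b (i - l) ≤ j - m := hb _ _ hx
    have e4 : c l ≤ m := hc _ _ hF
    have e5 : l ∈ A := Finset.mem_Icc.2 ⟨e2, by omega⟩
    exact ⟨hT _ hx hF, Finset.mem_product.2
      ⟨e5, Finset.mem_biUnion.2 ⟨l, e5, Finset.mem_Icc.2 ⟨e4, by omega⟩⟩⟩⟩
  rw [← finsum_eq_sum_of_support_subset _ fun q hq => Finset.mem_coe.2 (key q hq).1,
    ← finsum_eq_sum_of_support_subset _ fun q hq => Finset.mem_coe.2 (key q hq).2]

/-- This compatibility lets equations be moved between small series, where the order of operators is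
immaterial, and `W((y))((x))`, where nonzero power series can be inverted. -/
theorem toSmall_smul (f : MvPowerSeries (Fin 2) ℂ) (F : IterLaurentW W) :
    toSmall (expandPS f • F) = f • toSmall F := by
  ext k
  obtain ⟨N, hN⟩ := (toSmall F).isSmall.exists_bound k
  rw [toSmall_apply, (toSmall F).smul_eq_sum_Icc f hN,
    coeff₂_smul _ F _ _ ((Finset.Icc N k).image fun l => (l 0, l 1)), Finset.sum_image]
  · refine Finset.sum_congr rfl fun l _ => ?_
    rw [expandPS_coeff₂, toSmall_apply]
    congr 2
    ext s
    fin_cases s <;> rfl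
  · intro l _ l' _ h
    simp only [Prod.mk.injEq] at h
    ext s
    fin_cases s
    · exact h.1
    · exact h.2
  · rintro ⟨l, m⟩ h h'
    rw [expandPS_coeff₂] at h
    have h0 := nonneg_of_intCoeff_ne_zero h
    have hle : (![l, m] : Fin 2 → ℤ) ≤ k := by
      intro s
      have := h0 s
      fin_cases s <;> simpa using this
    exact Finset.mem_image.2 ⟨![l, m], Finset.mem_Icc.2 ⟨hN _ hle h', hle⟩, rfl⟩

/-- A series in `x`, `y` bounded below in `x` has no torsion. -/
theorem eq_zero_of_smul_eq_zero {f : MvPowerSeries (Fin 2) ℂ} (hf : f ≠ 0)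
    {F : SmallSeries (Fin 2) W} {N : ℤ} (hN : ∀ k, F k ≠ 0 → N ≤ k 0) (h : f • F = 0) :
    F = 0 := by
  obtain ⟨G, rfl⟩ := exists_toSmall_eq F hN
  rw [← toSmall_smul, ← map_zero toSmall] at h
  have h0 := toSmall_injective h
  have hu : expandPS f ≠ 0 := fun h' => hf (expandPS_injective (h'.trans (map_zero _).symm))
  -- The expansion of `f` is a nonzero element of the field `ℂ((y))((x))`, hence invertible.
  have : G = (expandPS f)⁻¹ • (expandPS f • G) := by
    rw [smul_smul, inv_mul_cancel₀ hu, one_smul]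
  rw [this, h0, smul_zero, map_zero]

end Bridges

/-! ### Exchange relations imply quasi compatibility -/

section QuasiCompatibility

variable {W : Type*} [AddCommGroup W] [Module ℂ W]

/-- The small series bounded below in the variable `x_s`. -/
def boundedIn {σ V : Type*} [Fintype σ] [AddCommGroup V] [Module ℂ V] (s : σ) :
    Submodule (MvPowerSeries σ ℂ) (SmallSeries σ V) where
  carrier := {F | ∃ N : ℤ, ∀ k, F k ≠ 0 → N ≤ k s}
  zero_mem' := ⟨0, fun k h => (h rfl).elim⟩
  add_mem' {F G} := by
    rintro ⟨N, hN⟩ ⟨M, hM⟩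
    refine ⟨min N M, fun k h => ?_⟩
    by_cases hf : F k = 0
    · exact (min_le_right _ _).trans (hM k fun hg => h (by simp [hf, hg]))
    · exact (min_le_left _ _).trans (hN k hf)
  smul_mem' f F := by
    rintro ⟨N, hN⟩
    refine ⟨N, fun k h => ?_⟩
    obtain ⟨l, hl, h0⟩ := SmallSeries.exists_of_smul_ne_zero h
    exact (hN l h0).trans (hl s)

theorem mem_boundedIn_iff {σ V : Type*} [Fintype σ] [AddCommGroup V] [Module ℂ V] {s : σ}
    {F : SmallSeries σ V} : F ∈ boundedIn s ↔ ∃ N : ℤ, ∀ k, F k ≠ 0 → N ≤ k s := Iff.rfl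

/-- The rightmost operator acts first, on the fixed vector `w`; its lower bound therefore does not
depend on the other exponents. -/
theorem wordSeries_mem_boundedIn {σ : Type*} [Fintype σ] (L : List (E W × σ)) (a : E W) (s : σ)
    (h : Exhausts (L ++ [(a, s)])) (w : W) :
    wordSeries (L ++ [(a, s)]) h w ∈ boundedIn s := by
  obtain ⟨N, hN⟩ := exists_coeff_bound a w
  refine ⟨N, fun k hk => hN _ fun h0 => hk ?_⟩
  rw [wordSeries_apply, wordOp_append, Module.End.mul_apply, wordOp_cons, wordOp_nil, mul_one, h0,
    map_zero]

/-- Any two elements of `U` satisfy an exchange relation, with respect to some nonzero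
polynomial. -/
def HasExchange (U : Set (E W)) : Prop :=
  ∀ a ∈ U, ∀ b ∈ U, ∃ p : MvPolynomial (Fin 2) ℂ, p ≠ 0 ∧
    ∃ (n : ℕ) (f : Fin n → MvPowerSeries (Fin 2) ℂ) (u v : Fin n → E W),
      (∀ l, u l ∈ U ∧ v l ∈ U) ∧
      ∀ w, (p : MvPowerSeries (Fin 2) ℂ) • pairSeries a b w =
        ∑ l, f l • oppSeries (u l) (v l) w

/-- The product of the `p(x_s, x_j)`, where `x_j` runs over the variables of `R`. -/
def clearRight {σ : Type*} (s : σ) (R : List (E W × σ)) :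
    MvPolynomial (Fin 2) ℂ →* MvPowerSeries σ ℂ where
  toFun p := (R.map fun q =>
    MvPowerSeries.rename ![s, q.2] (p : MvPowerSeries (Fin 2) ℂ)).prod
  map_one' := by simp
  map_mul' p q := by simp [List.prod_map_mul]

theorem exhausts_iff {σ : Type*} (L : List (E W × σ)) :
    Exhausts L ↔ ∀ s, s ∈ L.map Prod.snd := by
  simp [Exhausts]

/-- The operator carrying `x_s` is moved to the right end, by induction on the factors `R` to its
right. Each exchange replaces the operators by others from `U` but keeps the variables, so the
multiplier involves only `x_s` and the variables of `R`. -/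
theorem HasExchange.exists_bounded {U : Set (E W)} (hU : HasExchange U) {σ : Type*} [Fintype σ]
    (R : List (E W × σ)) : ∀ (L : List (E W × σ)) (a : E W) (s : σ),
      (∀ q ∈ L ++ (a, s) :: R, q.1 ∈ U) → ((L ++ (a, s) :: R).map Prod.snd).Nodup →
      ∀ h : Exhausts (L ++ (a, s) :: R), ∃ p : MvPolynomial (Fin 2) ℂ, p ≠ 0 ∧
        ∀ w, clearRight s R p • wordSeries _ h w ∈ boundedIn s := by
  induction R with
  | nil =>
    intro L a s _ _ h
    refine ⟨1, one_ne_zero, fun w => ?_⟩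
    rw [map_one, one_smul]
    exact wordSeries_mem_boundedIn L a s h w
  | cons q R ih =>
    obtain ⟨b, j⟩ := q
    intro L a s hmem hnd h
    obtain ⟨p, hp, n, f, u, v, huv, hx⟩ := hU a (hmem (a, s) (by simp)) b (hmem (b, j) (by simp))
    have hperm : ∀ l, (((L ++ [(u l, j)]) ++ (v l, s) :: R).map Prod.snd).Perm
        ((L ++ (a, s) :: (b, j) :: R).map Prod.snd) := by
      intro l
      simp only [List.map_append, List.map_cons, List.map_nil, List.append_assoc,
        List.cons_append, List.nil_append]
      exact (List.Perm.swap _ _ _).append_left _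
    have hex : ∀ l, Exhausts ((L ++ [(u l, j)]) ++ (v l, s) :: R) := fun l => by
      rw [exhausts_iff] at h ⊢
      exact fun t => (hperm l).mem_iff.2 (h t)
    choose P hP hb using fun l => ih (L ++ [(u l, j)]) (v l) s (by
      intro q hq
      simp only [List.append_assoc, List.mem_append, List.mem_cons, List.cons_append,
        List.nil_append] at hq
      rcases hq with hq | rfl | rfl | hq
      · exact hmem q (by simp [hq])
      · exact (huv l).1
      · exact (huv l).2
      · exact hmem q (by simp [hq])) ((hperm l).nodup_iff.2 hnd) (hex l)
    have hnd' : s ≠ j ∧ (∀ q ∈ L, q.2 ≠ s ∧ q.2 ≠ j) ∧ ∀ q ∈ R, q.2 ≠ s ∧ q.2 ≠ j := by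
      simp only [List.map_append, List.map_cons, List.nodup_append, List.nodup_cons,
        List.mem_cons, List.mem_map, not_or, not_exists, not_and] at hnd
      obtain ⟨h1, ⟨⟨h2, h3⟩, h4, h5⟩, h6⟩ := hnd
      refine ⟨h2, fun q hq => ⟨h6 _ ⟨q, hq, rfl⟩ _ (Or.inl rfl),
        h6 _ ⟨q, hq, rfl⟩ _ (Or.inr (Or.inl rfl))⟩, fun q hq => ⟨h3 q hq, h4 q hq⟩⟩
    have hkey := exchange_in_word hx hnd'.1 L R hnd'.2.1 hnd'.2.2 h (fun l => by
      simpa using hex l)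
    -- The factor `p` performs the first exchange and `P l` bounds the `l`-th resulting word. The
    -- product serves all of them, since surplus polynomial factors preserve boundedness.
    refine ⟨p * ∏ l, P l, mul_ne_zero hp (Finset.prod_ne_zero_iff.2 fun l _ => hP l), fun w => ?_⟩
    have hfac : clearRight s ((b, j) :: R) (p * ∏ l, P l) =
        (clearRight s R p * MvPowerSeries.rename ![s, j]
          ((∏ l, P l : MvPolynomial (Fin 2) ℂ) : MvPowerSeries (Fin 2) ℂ) *
          clearRight s R (∏ l, P l)) *
        MvPowerSeries.rename ![s, j] (p : MvPowerSeries (Fin 2) ℂ) := by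
      have : ∀ p, clearRight s ((b, j) :: R) p =
        MvPowerSeries.rename ![s, j] (p : MvPowerSeries (Fin 2) ℂ) * clearRight s R p :=
        fun p => by simp [clearRight]
      rw [this, map_mul, MvPolynomial.coe_mul, map_mul]
      ring
    rw [hfac, mul_smul, hkey, Finset.smul_sum]
    refine Submodule.sum_mem _ fun l _ => ?_
    have hdvd : ∃ g, clearRight s R (∏ l, P l) = g * clearRight s R (P l) := by
      classical
      refine ⟨clearRight s R (∏ l' ∈ Finset.univ.erase l, P l'), ?_⟩
      rw [← map_mul, mul_comm, Finset.mul_prod_erase _ _ (Finset.mem_univ l)]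
    obtain ⟨g, hg⟩ := hdvd
    have hb' := hb l w
    simp only [List.append_assoc, List.cons_append, List.nil_append] at hb'
    rw [hg, ← mul_assoc, mul_smul, smul_comm (clearRight s R (P l))]
    exact Submodule.smul_mem _ _ (Submodule.smul_mem _ _ hb')

theorem opProd_eq_wordOp {r : ℕ} (ψ : Fin r → E W) (k : Fin r → ℤ) :
    opProd ψ k = wordOp (List.ofFn fun i => (ψ i, i)) k := by
  rw [opProd, wordOp, List.map_ofFn]
  rfl

theorem pairProduct_dvd {r : ℕ} (s : Fin r) (p : MvPolynomial (Fin 2) ℂ) :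
    ∏ j ∈ Finset.Ioi s, MvPolynomial.rename ![s, j] p ∣ pairProduct r p :=
  Finset.dvd_prod_of_mem (fun i => ∏ j ∈ Finset.Ioi i, MvPolynomial.rename ![i, j] p)
    (Finset.mem_univ s)

/-- For each position `s` there is a polynomial clearing the product enough to bound it below in
`x_s`. The product of these polynomials bounds it in every variable at once, and finitely many
bounds have a common minimum. -/
theorem HasExchange.isQuasiCompatible {U : Set (E W)} (hU : HasExchange U) :
    IsQuasiCompatible U := by
  intro r ψ hψ
  set L : List (E W × Fin r) := List.ofFn fun i => (ψ i, i) with hL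
  have hfst : ∀ q ∈ L, q.1 ∈ U := by
    intro q hq
    obtain ⟨i, rfl⟩ := (List.mem_ofFn' _ _).1 hq
    exact hψ i
  have hmap : L.map Prod.snd = List.finRange r := by
    rw [hL, List.map_ofFn, ← List.ofFn_id]
    rfl
  have hex : Exhausts L := by
    rw [exhausts_iff, hmap]
    simp
  have key : ∀ s : Fin r, ∃ p : MvPolynomial (Fin 2) ℂ, p ≠ 0 ∧
      ∀ w, ((∏ j ∈ Finset.Ioi s, MvPolynomial.rename ![s, j] p : MvPolynomial (Fin r) ℂ) :
        MvPowerSeries (Fin r) ℂ) • wordSeries L hex w ∈ boundedIn s := by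
    intro s
    have hsplit : L = L.take s ++ (ψ s, s) :: L.drop (s + 1) := by
      have hlen : (s : ℕ) < L.length := by simp [hL]
      conv_lhs => rw [← List.take_append_drop s L, List.drop_eq_getElem_cons hlen]
      simp [hL]
    have hex' : Exhausts (L.take s ++ (ψ s, s) :: L.drop (s + 1)) := by rwa [← hsplit]
    obtain ⟨p, hp, h⟩ := hU.exists_bounded (L.drop (s + 1)) (L.take s) (ψ s) s
      (by rwa [← hsplit]) (by rw [← hsplit, hmap]; exact List.nodup_finRange r) hex'
    refine ⟨p, hp, fun w => ?_⟩
    have h1 : wordSeries L hex w = wordSeries _ hex' w := by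
      ext k
      simp only [wordSeries_apply]
      rw [← hsplit]
    have h2 : clearRight s (L.drop (s + 1)) p = ((∏ j ∈ Finset.Ioi s,
        MvPolynomial.rename ![s, j] p : MvPolynomial (Fin r) ℂ) : MvPowerSeries (Fin r) ℂ) := by
      have h3 : clearRight s (L.drop (s + 1)) p = (((L.drop (s + 1)).map Prod.snd).map fun j =>
          ((MvPolynomial.rename ![s, j] p : MvPolynomial (Fin r) ℂ) :
            MvPowerSeries (Fin r) ℂ)).prod := by
        simp only [clearRight, MonoidHom.coe_mk, OneHom.coe_mk, List.map_map]
        congr 1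
        refine List.map_congr_left fun q _ => ?_
        exact MvPowerSeries.rename_coe _ _
      have h4 : (L.drop (s + 1)).map Prod.snd = (List.finRange r).drop (s + 1) := by
        rw [List.map_drop, hmap]
      have h5 : Finset.Ioi s = ((List.finRange r).drop (s + 1)).toFinset := by
        ext j
        simp only [Finset.mem_Ioi, List.mem_toFinset, List.mem_drop_iff_getElem]
        constructor
        · intro h
          refine ⟨j - (s + 1), ?_, ?_⟩
          · have := j.2
            have : (s : ℕ) < j := h
            simp
            omega
          · ext
            have : (s : ℕ) < j := h
            simp
            omega
        · rintro ⟨i, hi, rfl⟩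
          rw [Fin.lt_def]
          simp
          omega
      rw [h3, h4, h5, List.prod_toFinset _ ((List.nodup_finRange r).sublist (List.drop_sublist _ _))]
      have h6 : ∀ l : List (Fin r), (l.map fun j =>
          ((MvPolynomial.rename ![s, j] p : MvPolynomial (Fin r) ℂ) :
            MvPowerSeries (Fin r) ℂ)).prod =
          (((l.map fun j => MvPolynomial.rename ![s, j] p).prod : MvPolynomial (Fin r) ℂ) :
            MvPowerSeries (Fin r) ℂ) := fun l => by
        induction l with
        | nil => simp
        | cons a l ih => simp [ih]
      exact h6 _
    rw [h1, ← h2]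
    exact h w
  choose P hP hb using key
  refine ⟨∏ s, P s, Finset.prod_ne_zero_iff.2 fun s _ => hP s, fun w => ?_⟩
  have hmem : ∀ s, ((pairProduct r (∏ s, P s) : MvPolynomial (Fin r) ℂ) :
      MvPowerSeries (Fin r) ℂ) • wordSeries L hex w ∈ boundedIn s := by
    intro s
    -- Only the pairs `(s, j)` with `s < j` and the factor `P s` are needed for `x_s`; the rest of
    -- the pair product is a harmless multiplier.
    have hd : ∏ j ∈ Finset.Ioi s, MvPolynomial.rename ![s, j] (P s) ∣
        pairProduct r (∏ s, P s) := by
      refine dvd_trans (Finset.prod_dvd_prod_of_dvd _ _ fun j _ => ?_) (pairProduct_dvd s _)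
      exact map_dvd _ (Finset.dvd_prod_of_mem P (Finset.mem_univ s))
    obtain ⟨g, hg⟩ := hd
    rw [hg, mul_comm, MvPolynomial.coe_mul, mul_smul]
    exact Submodule.smul_mem _ _ (hb s w)
  choose N hN using fun s => mem_boundedIn_iff.1 (hmem s)
  obtain ⟨M, hM⟩ := (Set.finite_range N).bddBelow
  refine ⟨M, fun k hk s => (hM ⟨s, rfl⟩).trans (hN s k ?_)⟩
  rwa [smul_apply_eq_laurentMul _ (opProd ψ) w]
  intro k
  rw [wordSeries_apply, opProd_eq_wordOp]

end QuasiCompatibility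

/-! ### The substitution `x₁ = x₂ + x₀` -/

section Shift

variable {V : Type*} [AddCommGroup V] [Module ℂ V]

variable (V) in
/-- The series in `x₁, x₂, x₃` having finitely many nonzero terms with bounded degree in `x₃` and
bounded total degree in `x₁, x₂`. -/
def shiftSmall : Submodule (MvPowerSeries (Fin 3) ℂ) (SmallSeries (Fin 3) V) where
  carrier := {F | ∀ K : ℤ, ∃ N : ℤ, ∀ k, k 0 + k 1 ≤ K → k 2 ≤ K → F k ≠ 0 → ∀ s, N ≤ k s}
  zero_mem' K := ⟨0, fun k _ _ h => (h rfl).elim⟩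
  add_mem' {F G} hF hG K := by
    obtain ⟨N, hN⟩ := hF K
    obtain ⟨M, hM⟩ := hG K
    refine ⟨min N M, fun k h1 h2 h s => ?_⟩
    by_cases hf : F k = 0
    · exact (min_le_right _ _).trans (hM k h1 h2 (fun hg => h (by simp [hf, hg])) s)
    · exact (min_le_left _ _).trans (hN k h1 h2 hf s)
  smul_mem' f F hF K := by
    obtain ⟨N, hN⟩ := hF K
    refine ⟨N, fun k h1 h2 h s => ?_⟩
    obtain ⟨l, hl, h0⟩ := SmallSeries.exists_of_smul_ne_zero h
    have h3 : l 0 ≤ k 0 := hl 0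
    have h4 : l 1 ≤ k 1 := hl 1
    have h5 : l 2 ≤ k 2 := hl 2
    exact (hN l (by omega) (by omega) h0 s).trans (hl s)

theorem mem_shiftSmall_iff {F : SmallSeries (Fin 3) V} : F ∈ shiftSmall V ↔
    ∀ K : ℤ, ∃ N : ℤ, ∀ k, k 0 + k 1 ≤ K → k 2 ≤ K → F k ≠ 0 → ∀ s, N ≤ k s := Iff.rfl

/-- A coefficient of the substituted series collects terms of one total degree `d` in `x₁, x₂`. This
is why `shiftSmall` bounds that total degree rather than the two exponents separately. -/
theorem shift_finite (F : shiftSmall V) (t : ℕ) (d c : ℤ) : (Function.support fun i : ℤ =>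
    Ring.choose i t • (F : SmallSeries (Fin 3) V) ![i, d - i, c]).Finite := by
  obtain ⟨N, hN⟩  := mem_shiftSmall_iff.1 F.2 (max d c)
  refine (Set.finite_Icc N (d - N)).subset fun i hi => ?_
  have hne : (F : SmallSeries (Fin 3) V) ![i, d - i, c] ≠ 0 := fun h => hi (by simp [h])
  have := hN _ (by simp) (by simp) hne
  have h0 := this 0
  have h1 := this 1
  simp at h0 h1
  exact ⟨h0, by omega⟩

/-- The coefficients of `F(x₂ + x₀, x₂, x₃)`, expanded in nonnegative powers of `x₀`. -/
def shiftFun (F : (Fin 3 → ℤ) → V) (k : Fin 3 → ℤ) : V :=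
  if 0 ≤ k 0 then ∑ᶠ i : ℤ, Ring.choose i (k 0).toNat • F ![i, k 1 + k 0 - i, k 2] else 0

theorem isSmall_shiftFun (F : shiftSmall V) : IsSmall (shiftFun (F : SmallSeries (Fin 3) V)) := by
  intro K
  -- Terms contributing at `k` have total degree `k 0 + k 1 ≤ 2K` in `x₁, x₂` and degree at most `K`
  -- in `x₃`. Both exponents `i` and `k 1 + k 0 - i` are at least `N`, so `k 1 ≥ 2N - K`.
  obtain ⟨N, hN⟩ := mem_shiftSmall_iff.1 F.2 (max (2 * K) K)
  refine ⟨min 0 (min N (2 * N - K)), fun k hk h => ?_⟩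
  unfold shiftFun at h
  by_cases h0 : 0 ≤ k 0
  · rw [if_pos h0] at h
    obtain ⟨i, hi⟩ := not_forall.1 fun h' => h (finsum_eq_zero_of_forall_eq_zero h')
    have hne : (F : SmallSeries (Fin 3) V) ![i, k 1 + k 0 - i, k 2] ≠ 0 :=
      fun h => hi (by simp [h])
    have hk0 := hk 0
    have hk1 := hk 1
    have hk2 := hk 2
    have := hN _ (by simp; omega) (by simp [hk2]) hne
    have h1 := this 0
    have h2 := this 1
    have h3 := this 2
    simp at h1 h2 h3
    intro s
    fin_cases s
    · simp [h0]
    · simp only [Fin.mk_one, inf_le_iff]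
      omega
    · simp only [Fin.reduceFinMk, inf_le_iff]
      omega
  · rw [if_neg h0] at h
    exact (h rfl).elim

/-- The substitution `x₁ = x₂ + x₀`, expanded in nonnegative powers of `x₀`. -/
def shift : shiftSmall V →+ SmallSeries (Fin 3) V where
  toFun F := SmallSeries.mk (shiftFun (F : SmallSeries (Fin 3) V)) (isSmall_shiftFun F)
  map_zero' := by
    ext k
    simp [shiftFun]
  map_add' F G := by
    ext k
    simp only [SmallSeries.mk_apply, SmallSeries.add_apply, shiftFun]
    split_ifs
    · rw [← finsum_add_distrib (shift_finite F _ _ _) (shift_finite G _ _ _)]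
      simp [smul_add]
    · simp

theorem shift_apply (F : shiftSmall V) (k : Fin 3 → ℤ) :
    shift F k = if 0 ≤ k 0 then ∑ᶠ i : ℤ, Ring.choose i (k 0).toNat •
      (F : SmallSeries (Fin 3) V) ![i, k 1 + k 0 - i, k 2] else 0 := rfl

/-- The power series `f(x₂ + x₀, x₂, x₃)`. -/
def shiftCoeff (f : MvPowerSeries (Fin 3) ℂ) : MvPowerSeries (Fin 3) ℂ :=
  fun m => ∑ n ∈ Finset.range (m 0 + m 1 + 1),
    (n.choose (m 0) : ℂ) * intCoeff f ![n, m 0 + m 1 - n, m 2]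

/-- The formula stays valid for all integers `d` and `c`: if `d < a`, every binomial coefficient on
the right vanishes, and if `c < 0`, every coefficient of `f` does. -/
theorem intCoeff_shiftCoeff (f : MvPowerSeries (Fin 3) ℂ) (a : ℕ) (d c : ℤ) :
    intCoeff (shiftCoeff f) ![a, d - a, c] =
      ∑ n ∈ Finset.range (d + 1).toNat, (n.choose a : ℂ) * intCoeff f ![n, d - n, c] := by
  by_cases hc : 0 ≤ c
  · by_cases hd : (a : ℤ) ≤ d
    · obtain ⟨b, hb⟩ := Int.eq_ofNat_of_zero_le (sub_nonneg.2 hd)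
      obtain ⟨c', rfl⟩ := Int.eq_ofNat_of_zero_le hc
      have hm : ![(a : ℤ), d - a, (c' : ℤ)] = fun s =>
          (((Finsupp.equivFunOnFinite.symm ![a, b, c'] : Fin 3 →₀ ℕ) s : ℕ) : ℤ) := by
        ext s
        fin_cases s <;> simp [hb]
      rw [hm, intCoeff_natCast]
      change ∑ n ∈ Finset.range (a + b + 1), _ = _
      have : (d + 1).toNat = a + b + 1 := by omega
      rw [this]
      refine Finset.sum_congr rfl fun n _ => ?_
      have hd' : d = a + b := by omega
      simp [hd']
    · rw [intCoeff_of_not_nonneg, Finset.sum_eq_zero]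
      · intro n hn
        rw [Finset.mem_range] at hn
        rw [Nat.choose_eq_zero_of_lt (by omega)]
        simp
      · intro h
        have := h 1
        simp at this
        omega
  · rw [intCoeff_of_not_nonneg _ fun h => hc (h 2), Finset.sum_eq_zero]
    intro n _
    rw [intCoeff_of_not_nonneg _ fun h => hc (h 2), mul_zero]

/-- Put `i = l + n` with `n` an exponent of `f`, and expand `choose (l + n) t` by Vandermonde's
identity. This is the coefficient form of the multiplicativity of the substitution, for one term
with `x₁`-exponent `l`. -/
theorem sum_choose_mul_intCoeff (f : MvPowerSeries (Fin 3) ℂ) (t : ℕ) (l d c : ℤ) (I : Finset ℤ)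
    (hI : Finset.Icc l (l + d) ⊆ I) :
    ∑ i ∈ I, ((Ring.choose i t : ℤ) : ℂ) * intCoeff f ![i - l, d - (i - l), c] =
      ∑ t' ∈ Finset.range (t + 1), ((Ring.choose l t' : ℤ) : ℂ) *
        intCoeff (shiftCoeff f) ![((t - t' : ℕ) : ℤ), d - ((t - t' : ℕ) : ℤ), c] := by
  have h1 : ∑ i ∈ I, ((Ring.choose i t : ℤ) : ℂ) * intCoeff f ![i - l, d - (i - l), c] =
      ∑ n ∈ Finset.range (d + 1).toNat,
        (Ring.choose (l + n) t : ℤ) * intCoeff f ![n, d - n, c] := by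
    symm
    refine Finset.sum_of_injOn (fun n : ℕ => l + n) ?_ ?_ ?_ ?_
    · intro a _ b _ h
      simpa using h
    · intro n hn
      have := Finset.mem_range.1 (Finset.mem_coe.1 hn)
      exact hI (Finset.mem_Icc.2 ⟨by dsimp only; omega, by dsimp only; omega⟩)
    · intro i _ hi
      rw [intCoeff_of_not_nonneg, mul_zero]
      intro h
      have h0 := h 0
      have h1 := h 1
      simp at h0 h1
      exact hi ⟨(i - l).toNat, by simp; omega, by simp; omega⟩
    · intro n _
      simp
  rw [h1]
  simp_rw [intCoeff_shiftCoeff, Finset.mul_sum]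
  rw [Finset.sum_comm]
  refine Finset.sum_congr rfl fun n _ => ?_
  rw [Ring.add_choose_eq t (Commute.all l (n : ℤ)),
    Finset.Nat.sum_antidiagonal_eq_sum_range_succ_mk, Int.cast_sum, Finset.sum_mul]
  refine Finset.sum_congr rfl fun t' _ => ?_
  rw [Ring.choose_natCast]
  push_cast
  ring

theorem shift_smul (f : MvPowerSeries (Fin 3) ℂ) (F : shiftSmall V) :
    shift (f • F) = shiftCoeff f • shift F := by
  classical
  ext k
  by_cases hk : 0 ≤ k 0
  swap
  · rw [shift_apply, if_neg hk, SmallSeries.smul_eq_sum _ _ k ∅, Finset.sum_empty]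
    intro l hl _ h
    rw [shift_apply, if_neg] at h
    · exact (h rfl).elim
    · have : l 0 ≤ k 0 := hl 0
      omega
  obtain ⟨t, ht⟩ := Int.eq_ofNat_of_zero_le hk
  set d := k 1 + k 0 with hd
  obtain ⟨N, hN⟩  := mem_shiftSmall_iff.1 F.2 (max d (k 2))
  set G : SmallSeries (Fin 3) V := F.1 with hG
  -- All exponents of `F` that can matter on either side: the first two are at least `N` with sum at
  -- most `d`, hence each is at most `d - N`.
  set A : Finset (Fin 3 → ℤ) := (Finset.Icc (fun _ => N) ![d - N, d - N, k 2]).filter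
    fun l => l 0 + l 1 ≤ d with hA
  have hAmem : ∀ l : Fin 3 → ℤ, l 0 + l 1 ≤ d → l 2 ≤ k 2 → G l ≠ 0 → l ∈ A := by
    intro l h1 h2 h
    have h3 := hN l (by simp [h1]) (by simp [h2]) h
    refine Finset.mem_filter.2 ⟨Finset.mem_Icc.2 ⟨h3, fun s => ?_⟩, h1⟩
    have h4 := h3 0
    have h5 := h3 1
    fin_cases s <;> simp <;> omega
  have hA2 : ∀ l ∈ A, l 0 + l 1 ≤ d ∧ l 2 ≤ k 2 := fun l hl => by
    have := Finset.mem_filter.1 hl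
    exact ⟨this.2, (Finset.mem_Icc.1 this.1).2 2⟩
  -- left-hand side
  have hL : shift (f • F) k = ∑ l ∈ A, (∑ t' ∈ Finset.range (t + 1), ((Ring.choose (l 0) t' : ℤ) : ℂ) *
      intCoeff (shiftCoeff f) ![((t - t' : ℕ) : ℤ), (d - l 0 - l 1) - ((t - t' : ℕ) : ℤ),
        k 2 - l 2]) • G l := by
    rw [shift_apply, if_pos hk, ← hd]
    have hval : ∀ i : ℤ, ((f • F : shiftSmall V) : SmallSeries (Fin 3) V) ![i, d - i, k 2] =
        ∑ l ∈ A, intCoeff f ![i - l 0, (d - l 0 - l 1) - (i - l 0), k 2 - l 2] • G l := by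
      intro i
      rw [Submodule.coe_smul, SmallSeries.smul_eq_sum f (F : SmallSeries (Fin 3) V) _ A]
      · refine Finset.sum_congr rfl fun l _ => ?_
        congr 2
        ext s
        fin_cases s <;> simp
        ring
      · intro l hl _ h
        have h0 := hl 0
        have h1 := hl 1
        have h2 := hl 2
        simp at h0 h1 h2
        exact hAmem l (by omega) h2 h
    simp_rw [hval]
    set I := A.biUnion fun l => Finset.Icc (l 0) (l 0 + (d - l 0 - l 1)) with hI
    rw [finsum_eq_sum_of_support_subset (s := I)]
    · simp_rw [← Int.cast_smul_eq_zsmul ℂ, Finset.smul_sum, smul_smul]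
      rw [Finset.sum_comm]
      refine Finset.sum_congr rfl fun l hl => ?_
      rw [← Finset.sum_smul, ← sum_choose_mul_intCoeff f t (l 0) _ _ I
        (Finset.subset_biUnion_of_mem (fun l : Fin 3 → ℤ =>
          Finset.Icc (l 0) (l 0 + (d - l 0 - l 1))) hl)]
      rw [ht]
      simp
    · intro i hi
      have : ∑ l ∈ A, intCoeff f ![i - l 0, (d - l 0 - l 1) - (i - l 0), k 2 - l 2] • G l ≠ 0 :=
        fun h => hi (by simp [h])
      obtain ⟨l, hl, h⟩ := Finset.exists_ne_zero_of_sum_ne_zero this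
      have h' := nonneg_of_intCoeff_ne_zero (fun h0 => h (by rw [h0, zero_smul]))
      have h0 := h' 0
      have h1 := h' 1
      simp at h0 h1
      exact Finset.mem_coe.2 (Finset.mem_biUnion.2 ⟨l, hl, Finset.mem_Icc.2 ⟨h0, by omega⟩⟩)
  -- right-hand side
  have hS : ∀ l' : Fin 3 → ℤ, 0 ≤ l' 0 → l' 0 + l' 1 ≤ d → l' 2 ≤ k 2 → shift F l' =
      ∑ l ∈ A, if l 0 + l 1 = l' 0 + l' 1 ∧ l 2 = l' 2 then
        ((Ring.choose (l 0) (l' 0).toNat : ℤ) : ℂ) • G l else 0 := by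
    intro l' h0 h1 h2
    rw [shift_apply, if_pos h0, ← Finset.sum_filter]
    rw [finsum_eq_sum_of_support_subset (s := (A.filter fun l =>
      l 0 + l 1 = l' 0 + l' 1 ∧ l 2 = l' 2).image fun l => l 0), Finset.sum_image]
    · refine Finset.sum_congr rfl fun l hl => ?_
      obtain ⟨_, h3, h4⟩ := Finset.mem_filter.1 hl
      rw [Int.cast_smul_eq_zsmul]
      congr 2
      ext s
      fin_cases s
      · rfl
      · simp
        omega
      · simp [h4]
    · intro l hl m hm h
      obtain ⟨_, h3, h4⟩ := Finset.mem_filter.1 (Finset.mem_coe.1 hl)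
      obtain ⟨_, h5, h6⟩ := Finset.mem_filter.1 (Finset.mem_coe.1 hm)
      simp only at h
      ext s
      fin_cases s
      · exact h
      · simp
        omega
      · simp [h4, h6]
    · intro i hi
      have hne : G ![i, l' 1 + l' 0 - i, l' 2] ≠ 0 := fun h => hi (by simp [← hG, h])
      refine Finset.mem_coe.2 (Finset.mem_image.2 ⟨_, Finset.mem_filter.2
        ⟨hAmem _ ?_ ?_ hne, ?_, ?_⟩, rfl⟩)
      · simp
        omega
      · simpa using h2
      · simp
        omega
      · simp
  -- These are the exponents reached from `A`: `t'` is the power of `x₀`, while the total degree in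
  -- `x₀, x₂` equals the former one in `x₁, x₂`.
  rw [hL, SmallSeries.smul_eq_sum _ _ k ((A ×ˢ Finset.range (t + 1)).image fun q =>
    ![(q.2 : ℤ), q.1 0 + q.1 1 - q.2, q.1 2])]
  · set T := (A ×ˢ Finset.range (t + 1)).image fun q : (Fin 3 → ℤ) × ℕ =>
      ![(q.2 : ℤ), q.1 0 + q.1 1 - q.2, q.1 2] with hT
    have hTS : ∀ l' ∈ T, intCoeff (shiftCoeff f) (k - l') • shift F l' =
        ∑ l ∈ A, if l 0 + l 1 = l' 0 + l' 1 ∧ l 2 = l' 2 then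
          (((Ring.choose (l 0) (l' 0).toNat : ℤ) : ℂ) * intCoeff (shiftCoeff f) (k - l')) • G l
          else 0 := by
      intro l' hl'
      obtain ⟨⟨l, t'⟩, hq, rfl⟩ := Finset.mem_image.1 hl'
      have hl := hA2 l (Finset.mem_product.1 hq).1
      rw [hS _ (by simp) (by simpa using hl.1) (by simpa using hl.2), Finset.smul_sum]
      refine Finset.sum_congr rfl fun m _ => ?_
      split_ifs
      · rw [smul_smul, mul_comm]
      · rw [smul_zero]
    rw [Finset.sum_congr rfl hTS, Finset.sum_comm]
    refine Finset.sum_congr rfl fun l hl => ?_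
    rw [Finset.sum_smul]
    refine Finset.sum_of_injOn (fun t' : ℕ => ![(t' : ℤ), l 0 + l 1 - t', l 2]) ?_ ?_ ?_ ?_
    · intro a _ b _ h
      simpa using congrFun h 0
    · intro t' ht'
      exact Finset.mem_coe.2 (Finset.mem_image.2 ⟨(l, t'), Finset.mem_product.2 ⟨hl, ht'⟩, rfl⟩)
    · intro l' hl' hn
      rw [if_neg]
      rintro ⟨h1, h2⟩
      obtain ⟨⟨m, t'⟩, hq, rfl⟩ := Finset.mem_image.1 hl'
      apply hn
      refine ⟨t', (Finset.mem_product.1 hq).2, ?_⟩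
      simp at h1 h2
      ext s
      fin_cases s <;> simp [h1, h2]
    · intro t' ht'
      have := Finset.mem_range.1 ht'
      rw [if_pos (by simp)]
      congr 2
      congr 1
      ext s
      fin_cases s
      · simp
        omega
      · simp
        omega
      · simp
  · intro l' hl' _ h
    have h0 : 0 ≤ l' 0 := by
      by_contra h0
      rw [shift_apply, if_neg h0] at h
      exact h rfl
    have e0 : l' 0 ≤ k 0 := hl' 0
    have e1 : l' 1 ≤ k 1 := hl' 1
    rw [hS l' h0 (by omega) (hl' 2)] at h
    obtain ⟨l, hl, hne⟩ := Finset.exists_ne_zero_of_sum_ne_zero h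
    obtain ⟨h1, h2⟩ : l 0 + l 1 = l' 0 + l' 1 ∧ l 2 = l' 2 := by
      by_contra hc
      exact hne (if_neg hc)
    refine Finset.mem_image.2 ⟨(l, (l' 0).toNat), Finset.mem_product.2 ⟨hl, ?_⟩, ?_⟩
    · rw [Finset.mem_range]
      dsimp only
      omega
    · ext s
      fin_cases s <;> simp [h1, h2, h0]

end Shift

/-! ### The substitution on polynomials, and cancellation of `p(x₂ + x₀, x₂)` -/

section ShiftPolynomial

variable {V : Type*} [AddCommGroup V] [Module ℂ V]

theorem SmallSeries.X_smul_apply {σ : Type*} [Fintype σ] [DecidableEq σ] (s : σ)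
    (F : SmallSeries σ V) (k : σ → ℤ) :
    ((MvPowerSeries.X s : MvPowerSeries σ ℂ) • F) k = F (fun t => k t - ((Finsupp.single s 1 t : ℕ) : ℤ)) := by
  rw [MvPowerSeries.X, SmallSeries.monomial_smul_apply, one_smul]

theorem SmallSeries.C_smul_apply {σ : Type*} [Fintype σ] (c : ℂ) (F : SmallSeries σ V)
    (k : σ → ℤ) : ((MvPowerSeries.C c : MvPowerSeries σ ℂ) • F) k = c • F k := by
  classical
  rw [← MvPowerSeries.monomial_zero_eq_C_apply, SmallSeries.monomial_smul_apply]
  simp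

/-- After shifting the summation index by one, this is Pascal's rule for `choose (i + 1) (k 0)`. -/
theorem shift_X_zero_smul (F : shiftSmall V) :
    shift ((MvPowerSeries.X 0 : MvPowerSeries (Fin 3) ℂ) • F) =
      (MvPowerSeries.X 0 + MvPowerSeries.X 1 : MvPowerSeries (Fin 3) ℂ) • shift F := by
  ext k
  have e0 : (fun t => k t - ((Finsupp.single (0 : Fin 3) 1 t : ℕ) : ℤ)) = ![k 0 - 1, k 1, k 2] := by
    ext s
    fin_cases s <;> simp
  have e1 : (fun t => k t - ((Finsupp.single (1 : Fin 3) 1 t : ℕ) : ℤ)) = ![k 0, k 1 - 1, k 2] := by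
    ext s
    fin_cases s <;> simp
  have e : ∀ i : ℤ, (fun t => ![i, k 1 + k 0 - i, k 2] t - ((Finsupp.single (0 : Fin 3) 1 t : ℕ) : ℤ))
      = ![i - 1, (k 1 + k 0 - 1) - (i - 1), k 2] := by
    intro i
    ext s
    fin_cases s <;> simp
  have hshift : (∑ᶠ i : ℤ, Ring.choose i (k 0).toNat •
      (F : SmallSeries (Fin 3) V) ![i - 1, (k 1 + k 0 - 1) - (i - 1), k 2]) =
      ∑ᶠ i : ℤ, Ring.choose (i + 1) (k 0).toNat •
        (F : SmallSeries (Fin 3) V) ![i, (k 1 + k 0 - 1) - i, k 2] := by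
    rw [← finsum_comp_equiv (Equiv.addRight (1 : ℤ))]
    simp
  have a0 : k 1 + (k 0 - 1) = k 1 + k 0 - 1 := by ring
  have a1 : k 1 - 1 + k 0 = k 1 + k 0 - 1 := by ring
  rw [add_smul, SmallSeries.add_apply, SmallSeries.X_smul_apply, SmallSeries.X_smul_apply, e0, e1]
  simp only [shift_apply, Submodule.coe_smul, SmallSeries.X_smul_apply, e, hshift,
    Matrix.cons_val_zero, Matrix.cons_val_one, Matrix.cons_val, a0, a1]
  rcases lt_trichotomy (k 0) 0 with h | h | h
  · rw [if_neg (by omega), if_neg (by omega), if_neg (by omega), add_zero]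
  · rw [if_pos (by omega), if_neg (by omega), if_pos (by omega), zero_add]
    simp [h]
  · rw [if_pos (by omega), if_pos (by omega), if_pos (by omega)]
    obtain ⟨m, hm⟩ : ∃ m : ℕ, k 0 = m + 1 := ⟨(k 0 - 1).toNat, by omega⟩
    have h1 : (k 0).toNat = m + 1 := by omega
    have h2 : (k 0 - 1).toNat = m := by omega
    simp only [h1, h2, Ring.choose_succ_succ, add_smul]
    exact finsum_add_distrib (shift_finite F _ _ _) (shift_finite F _ _ _)

theorem shift_X_one_smul (F : shiftSmall V) :
    shift ((MvPowerSeries.X 1 : MvPowerSeries (Fin 3) ℂ) • F) =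
      (MvPowerSeries.X 1 : MvPowerSeries (Fin 3) ℂ) • shift F := by
  ext k
  rw [SmallSeries.X_smul_apply]
  simp only [shift_apply, Submodule.coe_smul, SmallSeries.X_smul_apply]
  have e : ∀ i : ℤ, (fun t => ![i, k 1 + k 0 - i, k 2] t - ((Finsupp.single (1 : Fin 3) 1 t : ℕ) : ℤ))
      = ![i, (k 1 - 1 + k 0) - i, k 2] := by
    intro i
    ext s
    fin_cases s <;> simp
    ring
  simp_rw [e]
  simp

theorem shift_X_two_smul (F : shiftSmall V) :
    shift ((MvPowerSeries.X 2 : MvPowerSeries (Fin 3) ℂ) • F) =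
      (MvPowerSeries.X 2 : MvPowerSeries (Fin 3) ℂ) • shift F := by
  ext k
  rw [SmallSeries.X_smul_apply]
  simp only [shift_apply, Submodule.coe_smul, SmallSeries.X_smul_apply]
  have e : ∀ i : ℤ, (fun t => ![i, k 1 + k 0 - i, k 2] t - ((Finsupp.single (2 : Fin 3) 1 t : ℕ) : ℤ))
      = ![i, k 1 + k 0 - i, k 2 - 1] := by
    intro i
    ext s
    fin_cases s <;> simp
  simp_rw [e]
  simp

theorem shift_C_smul (c : ℂ) (F : shiftSmall V) :
    shift ((MvPowerSeries.C c : MvPowerSeries (Fin 3) ℂ) • F) =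
      (MvPowerSeries.C c : MvPowerSeries (Fin 3) ℂ) • shift F := by
  ext k
  rw [SmallSeries.C_smul_apply]
  simp only [shift_apply, Submodule.coe_smul, SmallSeries.C_smul_apply]
  split_ifs
  · rw [smul_finsum' c (shift_finite F _ _ _)]
    simp [smul_comm c]
  · simp

/-- The substitution `x₁ = x₂ + x₀` on polynomials in `x₁, x₂, x₃`. -/
def shiftPoly₃ : MvPolynomial (Fin 3) ℂ →ₐ[ℂ] MvPolynomial (Fin 3) ℂ :=
  MvPolynomial.aeval ![MvPolynomial.X 0 + MvPolynomial.X 1, MvPolynomial.X 1, MvPolynomial.X 2]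

/-- It suffices to check constants and variables. Unlike `shift_smul`, this exhibits the multiplier
as a polynomial obtained by substitution, which can then be shown to be nonzero and cancelled. -/
theorem shift_polynomial_smul (p : MvPolynomial (Fin 3) ℂ) : ∀ F : shiftSmall V,
    shift ((p : MvPowerSeries (Fin 3) ℂ) • F) =
      (shiftPoly₃ p : MvPowerSeries (Fin 3) ℂ) • shift F := by
  induction p using MvPolynomial.induction_on with
  | C c =>
    intro F
    rw [shiftPoly₃, MvPolynomial.aeval_C, MvPolynomial.algebraMap_eq, MvPolynomial.coe_C]
    exact shift_C_smul c F
  | add p q hp hq =>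
    intro F
    rw [MvPolynomial.coe_add, add_smul, map_add, hp, hq, map_add, MvPolynomial.coe_add, add_smul]
  | mul_X p s hp =>
    intro F
    rw [MvPolynomial.coe_mul, mul_smul, hp, map_mul, MvPolynomial.coe_mul, mul_smul,
      MvPolynomial.coe_X]
    congr 1
    rw [shiftPoly₃, MvPolynomial.aeval_X]
    fin_cases s
    · simpa using shift_X_zero_smul F
    · simpa using shift_X_one_smul F
    · simpa using shift_X_two_smul F

theorem shiftPoly₃_rename (p : MvPolynomial (Fin 2) ℂ) :
    shiftPoly₃ (MvPolynomial.rename ![0, 1] p) = MvPolynomial.rename ![0, 1] (shiftPoly p) := by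
  rw [shiftPoly₃, shiftPoly, MvPolynomial.aeval_rename]
  induction p using MvPolynomial.induction_on with
  | C c => simp
  | add p q hp hq => simp only [map_add, hp, hq]
  | mul_X p s hp =>
    rw [map_mul, map_mul, map_mul, hp]
    congr 1
    fin_cases s <;> simp

/-- The polynomial `p(x₁, x₂)` as a power series in `x₁, x₂, x₃`. -/
def firstTwo (p : MvPolynomial (Fin 2) ℂ) : MvPowerSeries (Fin 3) ℂ :=
  MvPowerSeries.rename ![0, 1] (p : MvPowerSeries (Fin 2) ℂ)

theorem firstTwo_mul (p q : MvPolynomial (Fin 2) ℂ) :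
    firstTwo (p * q) = firstTwo p * firstTwo q := by
  simp [firstTwo]

theorem shift_firstTwo_smul (p : MvPolynomial (Fin 2) ℂ) (F : shiftSmall V) :
    shift (firstTwo p • F) = firstTwo (shiftPoly p) • shift F := by
  have h : ∀ p : MvPolynomial (Fin 2) ℂ, firstTwo p =
      ((MvPolynomial.rename ![0, 1] p : MvPolynomial (Fin 3) ℂ) : MvPowerSeries (Fin 3) ℂ) :=
    fun p => MvPowerSeries.rename_coe _ p
  rw [h, h, shift_polynomial_smul, shiftPoly₃_rename]

theorem shiftPoly_mul (p q : MvPolynomial (Fin 2) ℂ) :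
    shiftPoly (p * q) = shiftPoly p * shiftPoly q := by
  simp [shiftPoly]

/-- The substitution `x₀ ↦ x₀ - x` is a left inverse. -/
theorem shiftPoly_ne_zero {p : MvPolynomial (Fin 2) ℂ} (hp : p ≠ 0) : shiftPoly p ≠ 0 := by
  have h : ((MvPolynomial.aeval
      ![MvPolynomial.X 0 - MvPolynomial.X 1, MvPolynomial.X 1]).comp (MvPolynomial.aeval
      ![MvPolynomial.X 0 + MvPolynomial.X 1, MvPolynomial.X 1]) :
      MvPolynomial (Fin 2) ℂ →ₐ[ℂ] MvPolynomial (Fin 2) ℂ) = AlgHom.id ℂ _ := by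
    apply MvPolynomial.algHom_ext
    intro s
    fin_cases s <;> simp
  intro h0
  apply hp
  have h1 := DFunLike.congr_fun h p
  rw [AlgHom.comp_apply, AlgHom.id_apply] at h1
  rw [← h1]
  exact (congrArg _ h0).trans (map_zero _)

/-- Series bounded below in `x₀` have no torsion with respect to polynomials in `x₀, x₂`. -/
theorem eq_zero_of_firstTwo_smul_eq_zero {p : MvPolynomial (Fin 2) ℂ} (hp : p ≠ 0)
    {F : SmallSeries (Fin 3) V} {N : ℤ} (hN : ∀ k, F k ≠ 0 → N ≤ k 0)
    (h : firstTwo p • F = 0) : F = 0 := by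
  have hinj : Function.Injective (![0, 1] : Fin 2 → Fin 3) := by decide
  have hext : ∀ (n : Fin 2 → ℤ) (k : Fin 3 → ℤ),
      Function.extend (![0, 1] : Fin 2 → Fin 3) n k = ![n 0, n 1, k 2] := by
    intro n k
    ext s
    fin_cases s
    · exact hinj.extend_apply n k 0
    · exact hinj.extend_apply n k 1
    · exact Function.extend_apply' n k _ (by decide)
  -- The multiplier does not involve `x₃`, so the exponent `c` of `x₃` can be frozen and the absence
  -- of torsion in two variables applied.
  have key : ∀ c : ℤ, ∃ G : SmallSeries (Fin 2) V, ∀ n, G n = F ![n 0, n 1, c] := by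
    intro c
    refine ⟨SmallSeries.mk (fun n => F ![n 0, n 1, c]) fun K => ?_, fun n => rfl⟩
    obtain ⟨M, hM⟩ := F.isSmall (max K c)
    refine ⟨M, fun k hk h s => ?_⟩
    have := hM _ (fun s => by fin_cases s <;> simp [hk]) h
    fin_cases s
    · exact this 0
    · exact this 1
  have hzero : ∀ (c : ℤ) (G : SmallSeries (Fin 2) V), (∀ n, G n = F ![n 0, n 1, c]) → G = 0 := by
    intro c G hG
    refine eq_zero_of_smul_eq_zero (f := (p : MvPowerSeries (Fin 2) ℂ)) (by simpa using hp)
      (N := N) (fun k hk => hN ![k 0, k 1, c] (by rwa [← hG])) ?_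
    ext n
    have h1 := SmallSeries.rename_smul_apply hinj (p : MvPowerSeries (Fin 2) ℂ) F
      ![n 0, n 1, c] G (fun m => by rw [hG, hext]; rfl)
    have h2 := DFunLike.congr_fun h ![n 0, n 1, c]
    rw [firstTwo, h1] at h2
    have h3 : (![n 0, n 1, c] : Fin 3 → ℤ) ∘ ![0, 1] = n := by
      ext s
      fin_cases s <;> rfl
    rwa [h3] at h2
  ext k
  obtain ⟨G, hG⟩ := key (k 2)
  have h1 := hG ![k 0, k 1]
  rw [hzero _ G hG] at h1
  have h2 : (![k 0, k 1, k 2] : Fin 3 → ℤ) = k := by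
    ext s
    fin_cases s <;> rfl
  simpa [h2] using h1.symm

end ShiftPolynomial

/-! ### Taylor coefficients after the substitution -/

section Hasse

/-- The divided power derivative `∂_i ^ t / t!` of power series. -/
def hasse {σ : Type*} (i : σ) (t : ℕ) (f : MvPowerSeries σ ℂ) : MvPowerSeries σ ℂ :=
  fun m => ((m i + t).choose t : ℂ) * MvPowerSeries.coeff (m + Finsupp.single i t) f

theorem coeff_hasse {σ : Type*} (i : σ) (t : ℕ) (f : MvPowerSeries σ ℂ) (m : σ →₀ ℕ) :
    MvPowerSeries.coeff m (hasse i t f) =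
      ((m i + t).choose t : ℂ) * MvPowerSeries.coeff (m + Finsupp.single i t) f := rfl

theorem hasse_zero {σ : Type*} (i : σ) (f : MvPowerSeries σ ℂ) : hasse i 0 f = f := by
  ext m
  simp [coeff_hasse]

/-- Taylor's formula `f(x₂ + x₀, x₃) = ∑ x₀ ^ t (∂ ^ t f / t!)(x₂, x₃)`. It is the reason the
scalars must be stable under divided derivatives. -/
theorem sliceCoeff_shiftCoeff_first (t : ℕ) (f : MvPowerSeries (Fin 2) ℂ) :
    sliceCoeff t (shiftCoeff (MvPowerSeries.rename ![0, 2] f)) = hasse 0 t f := by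
  have hinj : Function.Injective (![0, 2] : Fin 2 → Fin 3) := by decide
  ext m
  have h : MvPowerSeries.coeff m (sliceCoeff t (shiftCoeff (MvPowerSeries.rename ![0, 2] f))) =
      ∑ n ∈ Finset.range (t + m 0 + 1), (n.choose t : ℂ) *
        intCoeff (MvPowerSeries.rename ![0, 2] f) ![n, t + m 0 - n, m 1] := rfl
  -- A series in `x₁, x₃` has no `x₂`, which forces `n` to be the whole degree `t + m 0`.
  rw [h, coeff_hasse, Finset.sum_eq_single (t + m 0)]
  · rw [intCoeff_rename hinj]
    · have e : (![((t + m 0 : ℕ) : ℤ), t + m 0 - ((t + m 0 : ℕ) : ℤ), m 1] : Fin 3 → ℤ) ∘ ![0, 2]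
          = fun s => (((m + Finsupp.single 0 t : Fin 2 →₀ ℕ) s : ℕ) : ℤ) := by
        ext s
        fin_cases s
        · simp
          ring
        · simp
      rw [e, intCoeff_natCast, add_comm t]
    · intro s hs
      fin_cases s
      · exact (hs ⟨0, rfl⟩).elim
      · simp
      · exact (hs ⟨1, rfl⟩).elim
  · intro n _ hn
    have : intCoeff (MvPowerSeries.rename ![0, 2] f) ![n, t + m 0 - n, m 1] = 0 := by
      by_contra h0
      have := eq_zero_of_intCoeff_rename_ne_zero h0 1 (by decide)
      simp at this
      omega
    rw [this, mul_zero]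
  · simp

/-- A series in `x₂, x₃` is untouched by the substitution and contributes only to `x₀ ^ 0`. -/
theorem sliceCoeff_shiftCoeff_second (t : ℕ) (f : MvPowerSeries (Fin 2) ℂ) :
    sliceCoeff t (shiftCoeff (MvPowerSeries.rename ![1, 2] f)) = if t = 0 then f else 0 := by
  have hinj : Function.Injective (![1, 2] : Fin 2 → Fin 3) := by decide
  ext m
  have h : MvPowerSeries.coeff m (sliceCoeff t (shiftCoeff (MvPowerSeries.rename ![1, 2] f))) =
      ∑ n ∈ Finset.range (t + m 0 + 1), (n.choose t : ℂ) *
        intCoeff (MvPowerSeries.rename ![1, 2] f) ![n, t + m 0 - n, m 1] := rfl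
  rw [h, Finset.sum_eq_single 0]
  · split_ifs with ht
    · subst ht
      rw [intCoeff_rename hinj]
      · have e : (![((0 : ℕ) : ℤ), ((0 : ℕ) : ℤ) + m 0 - ((0 : ℕ) : ℤ), m 1] : Fin 3 → ℤ) ∘ ![1, 2]
            = fun s => ((m s : ℕ) : ℤ) := by
          ext s
          fin_cases s <;> simp
        rw [e, intCoeff_natCast]
        simp
      · intro s hs
        fin_cases s
        · simp
        · exact (hs ⟨0, rfl⟩).elim
        · exact (hs ⟨1, rfl⟩).elim
    · rw [Nat.choose_eq_zero_of_lt (by omega)]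
      simp
  · intro n _ hn
    have : intCoeff (MvPowerSeries.rename ![1, 2] f) ![n, t + m 0 - n, m 1] = 0 := by
      by_contra h0
      have := eq_zero_of_intCoeff_rename_ne_zero h0 0 (by decide)
      simp at this
      omega
    rw [this, mul_zero]
  · simp

end Hasse

/-! ### Passing relations through the substitution -/

section Core

variable {ι V : Type*} [AddCommGroup V] [Module ℂ V] {Q : Subalgebra ℂ (MvPowerSeries (Fin 2) ℂ)}

/-- The families of series in `x₀, x₂, x₃`, uniformly bounded below in `x₀`, all whose
coefficients of powers of `x₀` lie in `N`. -/
def SlicesIn (N : Submodule Q (ι → SmallSeries (Fin 2) V)) (g : ι → SmallSeries (Fin 3) V) :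
    Prop :=
  (∃ M : ℤ, ∀ w k, g w k ≠ 0 → M ≤ k 0) ∧ ∀ t : ℤ, (fun w => (g w).slice t) ∈ N

variable {N : Submodule Q (ι → SmallSeries (Fin 2) V)}

theorem SlicesIn.zero : SlicesIn N 0 := by
  refine ⟨⟨0, fun w k h => (h rfl).elim⟩, fun t => ?_⟩
  simp only [Pi.zero_apply, map_zero]
  exact N.zero_mem

theorem SlicesIn.add {g g' : ι → SmallSeries (Fin 3) V} (h : SlicesIn N g) (h' : SlicesIn N g') :
    SlicesIn N (g + g') := by
  obtain ⟨⟨M, hM⟩, h⟩ := h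
  obtain ⟨⟨M', hM'⟩, h'⟩ := h'
  refine ⟨⟨min M M', fun w k hk => ?_⟩, fun t => ?_⟩
  · by_cases h0 : g w k = 0
    · exact (min_le_right _ _).trans (hM' w k fun h1 => hk (by simp [h0, h1]))
    · exact (min_le_left _ _).trans (hM w k h0)
  · simp only [Pi.add_apply, map_add]
    exact N.add_mem (h t) (h' t)

/-- Each coefficient of `f • g` is a finite combination of coefficients of `g` with scalars in `Q`.
The bound `M` must be uniform in the index, so that the same combination works for the whole family.
-/
theorem SlicesIn.smul {g : ι → SmallSeries (Fin 3) V} (h : SlicesIn N g)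
    {f : MvPowerSeries (Fin 3) ℂ} (hf : ∀ t, sliceCoeff t f ∈ Q) : SlicesIn N (f • g) := by
  obtain ⟨⟨M, hM⟩, h⟩ := h
  refine ⟨⟨M, fun w k hk => ?_⟩, fun t => ?_⟩
  · obtain ⟨l, hl, h0⟩ := SmallSeries.exists_of_smul_ne_zero hk
    exact (hM w l h0).trans (hl 0)
  · have : (fun w => ((f • g) w).slice t) = ∑ i ∈ Finset.range (t - M + 1).toNat,
        (⟨sliceCoeff i f, hf i⟩ : Q) • fun w => (g w).slice (t - i) := by
      ext1 w
      rw [Pi.smul_apply, SmallSeries.slice_smul f (g w) (hM w) t, Finset.sum_apply]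
      rfl
    rw [this]
    exact N.sum_mem fun i _ => N.smul_mem _ (h _)

/-- After multiplication by some `p(x₁, x₂)`, the substitution `x₁ = x₂ + x₀` is defined on `X`
and gives `p(x₂ + x₀, x₂)` times a series with coefficients in `N`. -/
def Shiftable (N : Submodule Q (ι → SmallSeries (Fin 2) V)) (X : ι → SmallSeries (Fin 3) V) :
    Prop :=
  ∃ p : MvPolynomial (Fin 2) ℂ, p ≠ 0 ∧ ∃ Z : ι → shiftSmall V,
    (∀ w, (Z w : SmallSeries (Fin 3) V) = firstTwo p • X w) ∧
    ∃ g, SlicesIn N g ∧ ∀ w, shift (Z w) = firstTwo (shiftPoly p) • g w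

theorem Shiftable.zero : Shiftable N 0 :=
  ⟨1, one_ne_zero, 0, fun w => by simp, 0, SlicesIn.zero, fun w => by simp⟩

/-- The two multipliers are brought to the common multiplier `p * p'`; each term is multiplied by
the other's polynomial. -/
theorem Shiftable.add {X Y : ι → SmallSeries (Fin 3) V} (hX : Shiftable N X)
    (hY : Shiftable N Y) : Shiftable N (X + Y) := by
  obtain ⟨p, hp, Z, hZ, g, hg, h⟩ := hX
  obtain ⟨p', hp', Z', hZ', g', hg', h'⟩ := hY
  refine ⟨p * p', mul_ne_zero hp hp', fun w => firstTwo p' • Z w + firstTwo p • Z' w, fun w => ?_,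
    g + g', hg.add hg', fun w => ?_⟩
  · rw [Submodule.coe_add, Submodule.coe_smul, Submodule.coe_smul, hZ, hZ', firstTwo_mul,
      smul_smul, smul_smul, Pi.add_apply, smul_add, mul_comm (firstTwo p')]
  · rw [map_add, shift_firstTwo_smul, shift_firstTwo_smul, h, h', shiftPoly_mul, firstTwo_mul,
      smul_smul, smul_smul, Pi.add_apply, smul_add, mul_comm (firstTwo (shiftPoly p'))]

theorem Shiftable.sum {κ : Type*} (s : Finset κ) {X : κ → ι → SmallSeries (Fin 3) V}
    (hX : ∀ i ∈ s, Shiftable N (X i)) : Shiftable N (∑ i ∈ s, X i) := by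
  classical
  induction s using Finset.induction_on with
  | empty => exact Shiftable.zero
  | insert a s ha ih =>
    rw [Finset.sum_insert ha]
    exact (hX a (Finset.mem_insert_self a s)).add
      (ih fun i hi => hX i (Finset.mem_insert_of_mem hi))

theorem Shiftable.smul {X : ι → SmallSeries (Fin 3) V} (hX : Shiftable N X)
    {f : MvPowerSeries (Fin 3) ℂ} (hf : ∀ t, sliceCoeff t (shiftCoeff f) ∈ Q) :
    Shiftable N (f • X) := by
  obtain ⟨p, hp, Z, hZ, g, hg, h⟩ := hX
  refine ⟨p, hp, fun w => f • Z w, fun w => ?_, shiftCoeff f • g, hg.smul hf, fun w => ?_⟩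
  · rw [Submodule.coe_smul, hZ, Pi.smul_apply, smul_comm]
  · rw [shift_smul, h, Pi.smul_apply, smul_comm]

theorem Shiftable.smul_first (hQ : ∀ t, ∀ f ∈ Q, hasse 0 t f ∈ Q)
    {X : ι → SmallSeries (Fin 3) V} (hX : Shiftable N X) {f : MvPowerSeries (Fin 2) ℂ}
    (hf : f ∈ Q) : Shiftable N (MvPowerSeries.rename (![0, 2] : Fin 2 → Fin 3) f • X) :=
  hX.smul fun t => by
    rw [sliceCoeff_shiftCoeff_first]
    exact hQ t f hf

theorem Shiftable.smul_second {X : ι → SmallSeries (Fin 3) V} (hX : Shiftable N X)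
    {f : MvPowerSeries (Fin 2) ℂ} (hf : f ∈ Q) :
    Shiftable N (MvPowerSeries.rename (![1, 2] : Fin 2 → Fin 3) f • X) :=
  hX.smul fun t => by
    rw [sliceCoeff_shiftCoeff_second]
    split_ifs
    · exact hf
    · exact Q.zero_mem

/-- If `p₂(x₂, x₃) p₁(x₁, x₃) X` is shiftable, then the series `Y` obtained from `X` by the
substitution `x₁ = x₂ + x₀` satisfies the corresponding relation. -/
theorem Shiftable.slicesIn {X Y : ι → SmallSeries (Fin 3) V}
    (hY : ∃ M : ℤ, ∀ w k, Y w k ≠ 0 → M ≤ k 0) {p : MvPolynomial (Fin 2) ℂ} (hp : p ≠ 0)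
    {Z : ι → shiftSmall V} (hZ : ∀ w, (Z w : SmallSeries (Fin 3) V) = firstTwo p • X w)
    (hZY : ∀ w, shift (Z w) = firstTwo (shiftPoly p) • Y w) {f f' : MvPowerSeries (Fin 3) ℂ}
    (h : Shiftable N (f • f' • X)) : SlicesIn N (shiftCoeff f • shiftCoeff f' • Y) := by
  obtain ⟨p', hp', Z', hZ', g, hg, hZg⟩ := h
  suffices shiftCoeff f • shiftCoeff f' • Y = g by rwa [this]
  obtain ⟨⟨M, hM⟩, -⟩ := hg
  obtain ⟨M', hM'⟩ := hY
  ext1 w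
  have hb : ∀ k, (shiftCoeff f • shiftCoeff f' • Y w - g w) k ≠ 0 → min M M' ≤ k 0 := by
    intro k hk
    by_cases h0 : g w k = 0
    · rw [SmallSeries.sub_apply, h0, sub_zero] at hk
      obtain ⟨l, hl, h1⟩ := SmallSeries.exists_of_smul_ne_zero hk
      obtain ⟨l', hl', h2⟩ := SmallSeries.exists_of_smul_ne_zero h1
      exact (min_le_right _ _).trans ((hM' w l' h2).trans ((hl' 0).trans (hl 0)))
    · exact (min_le_left _ _).trans (hM w k h0)
  -- Before the substitution both sides are `p p' f f' X`.
  have hEq : firstTwo p • Z' w = firstTwo p' • f • f' • Z w := by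
    apply Subtype.ext
    simp only [Submodule.coe_smul, hZ, hZ', Pi.smul_apply]
    simp only [smul_smul]
    congr 1
    ring
  have hEq' := congrArg shift hEq
  rw [shift_firstTwo_smul, shift_firstTwo_smul, shift_smul, shift_smul, hZY, hZg] at hEq'
  -- Both series are bounded below in `x₀`, so the nonzero factor `p(x₂+x₀,x₂) p'(x₂+x₀,x₂)` may be
  -- cancelled.
  have hzero := eq_zero_of_firstTwo_smul_eq_zero (p := shiftPoly p * shiftPoly p')
    (mul_ne_zero (shiftPoly_ne_zero hp) (shiftPoly_ne_zero hp')) hb (by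
      rw [smul_sub, firstTwo_mul, mul_smul _ _ (g w), hEq', sub_eq_zero]
      simp only [smul_smul]
      congr 1
      ring)
  exact sub_eq_zero.1 hzero

/-- The coefficients of `Y`, up to denominators. -/
theorem SlicesIn.exists_denominator (hQ : ∀ t, ∀ f ∈ Q, hasse 0 t f ∈ Q)
    {D : Submonoid (MvPowerSeries (Fin 2) ℂ)} (hD : ∀ f ∈ D, f ∈ Q)
    {Y : ι → SmallSeries (Fin 3) V} (hY : ∃ M : ℤ, ∀ w k, Y w k ≠ 0 → M ≤ k 0)
    {f f' : MvPowerSeries (Fin 2) ℂ} (hf : f ∈ D) (hf' : f' ∈ D)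
    (h : SlicesIn N (shiftCoeff (MvPowerSeries.rename ![1, 2] f) •
      shiftCoeff (MvPowerSeries.rename ![0, 2] f') • Y)) (t : ℤ) :
    ∃ p ∈ D, (fun w => p • (Y w).slice t) ∈ N := by
  classical
  obtain ⟨M, hM⟩ := hY
  obtain ⟨-, h⟩ := h
  set y : ℤ → ι → SmallSeries (Fin 2) V := fun t w => (Y w).slice t with hy
  -- The coefficient of `x₀ ^ t` in `f(x₂,x₃) f'(x₂+x₀,x₃) Y`: a triangular system for the
  -- coefficients `y t`, with diagonal entry `f * f'`.
  have hslice : ∀ t : ℤ, f • (∑ i ∈ Finset.range (t - M + 1).toNat, hasse 0 i f' • y (t - i)) ∈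
      N := by
    intro t
    convert h t using 1
    ext1 w
    have hb : ∀ k, (shiftCoeff (MvPowerSeries.rename ![0, 2] f') • Y w) k ≠ 0 → M ≤ k 0 := by
      intro k hk
      obtain ⟨l, hl, h1⟩ := SmallSeries.exists_of_smul_ne_zero hk
      exact (hM w l h1).trans (hl 0)
    have h1 : ((shiftCoeff (MvPowerSeries.rename ![1, 2] f) •
        shiftCoeff (MvPowerSeries.rename ![0, 2] f') • Y) w).slice t =
        f • ((shiftCoeff (MvPowerSeries.rename ![0, 2] f') • Y w).slice t) := by
      rw [Pi.smul_apply, Pi.smul_apply, SmallSeries.slice_smul _ _ hb t]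
      simp_rw [sliceCoeff_shiftCoeff_second]
      by_cases ht : M ≤ t
      · rw [Finset.sum_eq_single 0]
        · simp
        · intro i _ hi
          rw [if_neg hi, zero_smul]
        · intro h0
          rw [Finset.mem_range] at h0
          omega
      · have h0 : (shiftCoeff (MvPowerSeries.rename ![0, 2] f') • Y w).slice t = 0 := by
          ext k
          by_contra hk
          exact ht (by simpa using hb _ hk)
        have h2 : (t - M + 1).toNat = 0 := by omega
        rw [h0, smul_zero, h2, Finset.sum_range_zero]
    rw [h1, SmallSeries.slice_smul _ _ (hM w) t, Pi.smul_apply, Finset.sum_apply]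
    simp_rw [sliceCoeff_shiftCoeff_first]
    rfl
  have hsmul : ∀ g ∈ Q, ∀ X ∈ N, g • X ∈ N := fun g hg X hX => N.smul_mem ⟨g, hg⟩ hX
  -- Induction on the number of coefficients from `M` up to `t`; below `M` they vanish.
  suffices ∀ (n : ℕ) (t : ℤ), (t - M + 1).toNat ≤ n → ∃ p ∈ D, p • y t ∈ N from
    this _ t le_rfl
  intro n
  induction n with
  | zero =>
    intro t ht
    refine ⟨1, D.one_mem, ?_⟩
    have : y t = 0 := by
      ext w k
      by_contra hk
      have := hM w _ hk
      simp at this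
      omega
    rw [this, smul_zero]
    exact N.zero_mem
  | succ n ih =>
    intro t ht
    by_cases htM : M ≤ t
    · obtain ⟨m, hm⟩ : ∃ m, (t - M + 1).toNat = m + 1 := ⟨(t - M).toNat, by omega⟩
      choose p hpD hp using fun i : ℕ => ih (t - (i + 1 : ℕ)) (by push_cast; omega)
      have h1 := hslice t
      rw [hm, Finset.sum_range_succ'] at h1
      simp only [hasse_zero, Nat.cast_zero, sub_zero] at h1
      set P := ∏ i ∈ Finset.range m, p i with hP
      have hPD : P ∈ D := Submonoid.prod_mem _ fun i _ => hpD i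
      -- `P` clears all earlier coefficients simultaneously and `f * f'` is the diagonal entry;
      -- subtracting the lower terms isolates `y t`.
      refine ⟨P * (f * f'), D.mul_mem hPD (D.mul_mem hf hf'), ?_⟩
      have h2 := hsmul P (hD _ hPD) _ h1
      have h3 : P • f • (∑ i ∈ Finset.range m, hasse 0 (i + 1) f' • y (t - (i + 1 : ℕ))) ∈ N := by
        rw [Finset.smul_sum, Finset.smul_sum]
        refine N.sum_mem fun i hi => ?_
        have h4 : P • f • hasse 0 (i + 1) f' • y (t - (i + 1 : ℕ)) =
            (f * hasse 0 (i + 1) f' * ∏ j ∈ (Finset.range m).erase i, p j) •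
              p i • y (t - (i + 1 : ℕ)) := by
          rw [hP, ← Finset.mul_prod_erase _ _ hi]
          simp only [smul_smul]
          congr 1
          ring
        rw [h4]
        exact hsmul _ (Q.mul_mem (Q.mul_mem (hD _ hf) (hQ _ _ (hD _ hf')))
          (hD _ (Submonoid.prod_mem _ fun j _ => hpD j))) _ (hp i)
      have h5 : (P * (f * f')) • y t = P • f • (∑ i ∈ Finset.range m,
          hasse 0 (i + 1) f' • y (t - (i + 1 : ℕ)) + f' • y t) -
          P • f • (∑ i ∈ Finset.range m, hasse 0 (i + 1) f' • y (t - (i + 1 : ℕ))) := by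
        rw [smul_add, smul_add, add_sub_cancel_left, smul_smul, smul_smul, mul_assoc]
      rw [h5]
      exact N.sub_mem h2 h3
    · exact ih t (by omega)

end Core

/-! ### Assembling a series from its slices -/

section SliceGluing

variable {V : Type*} [AddCommGroup V] [Module ℂ V] {n : ℕ}

/-- The series `∑_t S_t x₀ ^ t`. -/
def SmallSeries.ofSlices (S : ℤ → SmallSeries (Fin n) V) (M : ℤ) (hM : ∀ t < M, S t = 0) :
    SmallSeries (Fin (n + 1)) V :=
  SmallSeries.mk (fun k => S (k 0) (Fin.tail k)) fun K => by
    choose b hb using fun t => (S t).isSmall K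
    obtain ⟨B, hB⟩ := ((Finset.Icc M K).image b).bddBelow
    refine ⟨min M B, fun k hk h s => ?_⟩
    have h0 : M ≤ k 0 := by
      by_contra hlt
      apply h
      dsimp only
      rw [hM _ (not_le.1 hlt)]
      rfl
    refine Fin.cases ?_ (fun i => ?_) s
    · exact (min_le_left _ _).trans h0
    · exact (min_le_right _ _).trans ((hB (Finset.mem_coe.2 (Finset.mem_image_of_mem b
        (Finset.mem_Icc.2 ⟨h0, hk 0⟩)))).trans (hb (k 0) _ (fun s => hk _) h i))

theorem SmallSeries.ofSlices_apply (S : ℤ → SmallSeries (Fin n) V) (M : ℤ)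
    (hM : ∀ t < M, S t = 0) (k : Fin (n + 1) → ℤ) :
    ofSlices S M hM k = S (k 0) (Fin.tail k) := rfl

theorem SmallSeries.slice_ofSlices (S : ℤ → SmallSeries (Fin n) V) (M : ℤ)
    (hM : ∀ t < M, S t = 0) (t : ℤ) : (ofSlices S M hM).slice t = S t := by
  ext k
  rw [slice_apply, ofSlices_apply, Fin.cons_zero, Fin.tail_cons]

end SliceGluing

/-! ### The generating series of `n`th products as a substituted product -/

section VertexSeries

variable {W : Type*} [AddCommGroup W] [Module ℂ W]

theorem coeff_nthProduct (p : MvPolynomial (Fin 2) ℂ) (a b : E W) (h : Clears p a b) (t s : ℤ)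
    (w : W) : HVertexOperator.coeff (nthProduct p a b h (-t - 1)) s w =
      coeff₂ (vertexOp p a b h w) t s := by
  change coeff₂ (vertexOp p a b h w) (-(-t - 1) - 1) s = _
  congr 1
  ring

/-- Negative powers of `x₀` come only from the inverse of `p(x₀+x,x)`, since the substituted series
has only nonnegative ones. The bound is therefore uniform in `w`, and `a(x)ₙb(x) = 0` for all large
`n`. -/
theorem coeff₂_vertexOp_bound (p : MvPolynomial (Fin 2) ℂ) (a b : E W) (h : Clears p a b) :
    ∃ M : ℤ, ∀ (w : W) (t s : ℤ), coeff₂ (vertexOp p a b h w) t s ≠ 0 → M ≤ t := by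
  set x : IterLaurent := (expandPS (shiftPoly p : MvPowerSeries (Fin 2) ℂ))⁻¹ with hx
  obtain ⟨N, hN⟩ := hahnSeries_bddBelow (IterLaurent.equiv.symm x)
  refine ⟨N, fun w t s hts => ?_⟩
  by_contra hlt
  apply hts
  rw [vertexOp, ← hx, coeff₂_smul x _ t s ∅, Finset.sum_empty]
  intro q h1 h2
  exfalso
  have h3 : N ≤ t - q.1 := hN _ fun h0 => h1 (by
    change ((IterLaurent.equiv.symm x).coeff (t - q.1)).coeff (s - q.2) = 0
    rw [h0]
    rfl)
  rw [coeff₂_substShift] at h2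
  unfold substCoeff at h2
  split_ifs at h2 with h4
  · omega
  · exact h2 rfl

theorem nthProduct_eq_zero (p : MvPolynomial (Fin 2) ℂ) (a b : E W) (h : Clears p a b) :
    ∃ M : ℤ, ∀ t < M, nthProduct p a b h (-t - 1) = 0 := by
  obtain ⟨M, hM⟩ := coeff₂_vertexOp_bound p a b h
  refine ⟨M, fun t ht => ?_⟩
  apply HVertexOperator.coeff_inj
  ext s w
  rw [coeff_nthProduct]
  simp only [map_zero, Pi.zero_apply, LinearMap.zero_apply]
  by_contra h0
  exact absurd (hM w t s h0) (not_le.2 ht)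

/-- The defining formula of `Y_ℰ`, multiplied by `p(x₀+x,x)`. In this form the inverse disappears
and the identity can be read in small series. -/
theorem smul_toSmall_vertexOp {p : MvPolynomial (Fin 2) ℂ} (hp : p ≠ 0) (a b : E W)
    (h : Clears p a b) (w : W) (k : Fin 2 → ℤ) :
    ((shiftPoly p : MvPowerSeries (Fin 2) ℂ) • toSmall (vertexOp p a b h w)) k =
      substCoeff (laurentMul (toLaurent p) (opProd ![a, b])) (k 0) (k 1) w := by
  have hne : expandPS (shiftPoly p : MvPowerSeries (Fin 2) ℂ) ≠ 0 := by
    intro h0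
    have := expandPS_injective (h0.trans (map_zero _).symm)
    exact shiftPoly_ne_zero hp (by simpa using this)
  rw [← toSmall_smul, vertexOp, smul_smul, mul_inv_cancel₀ hne, one_smul, toSmall_apply,
    coeff₂_substShift]

theorem opProd_pair (a b : E W) (k : Fin 2 → ℤ) (w : W) :
    pairSeries a b w k = opProd ![a, b] k w := by
  rw [pairSeries_apply]
  simp [opProd]

variable {L R : List (E W × Fin 3)} {a b : E W}

theorem firstTwo_smul_wordSeries (hL : ∀ q ∈ L, q.2 = 2) (hR : ∀ q ∈ R, q.2 = 2)
    (hex : Exhausts (L ++ (a, 0) :: (b, 1) :: R)) (p : MvPolynomial (Fin 2) ℂ) (w : W)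
    (k : Fin 3 → ℤ) : (firstTwo p • wordSeries _ hex w) k =
      wordOp L k (laurentMul (toLaurent p) (opProd ![a, b]) ![k 0, k 1] (wordOp R k w)) := by
  have h2 : ∀ A : List (E W × Fin 3), (∀ q ∈ A, q.2 = 2) → ∀ q ∈ A, q.2 ≠ 0 ∧ q.2 ≠ 1 := by
    intro A hA q hq
    rw [hA q hq]
    decide
  rw [firstTwo, rename_smul_context (by decide) L R (h2 L hL) (h2 R hR) (pairSeries a b) _ w,
    smul_apply_eq_laurentMul p (opProd ![a, b]) (wordOp R k w) _ (fun k => opProd_pair a b k _)]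
  intro k
  simp [pairSeries_apply]

/-- The word `R` yields finitely many vectors, on which `p a(x₁)b(x₂)` has a common lower bound `M`
in both variables. Given a bound on the total degree, only finitely many exponents remain, so `L`
again acts on finitely many vectors. A nonempty `L ++ R` is needed to bound `x₃`. -/
theorem firstTwo_smul_mem_shiftSmall (hL : ∀ q ∈ L, q.2 = 2) (hR : ∀ q ∈ R, q.2 = 2)
    (hne : L ++ R ≠ []) (hex : Exhausts (L ++ (a, 0) :: (b, 1) :: R))
    (p : MvPolynomial (Fin 2) ℂ) (h : Clears p a b) (w : W) :
    firstTwo p • wordSeries _ hex w ∈ shiftSmall W := by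
  classical
  intro K
  obtain ⟨A, NR, hA⟩ := wordOp_finite R w K
  set F := laurentMul (toLaurent p) (opProd ![a, b])
  choose b hb using h
  obtain ⟨M, hM⟩ := (A.image b).bddBelow
  have hM' : ∀ v ∈ A, M ≤ b v := fun v hv =>
    hM (Finset.mem_coe.2 (Finset.mem_image_of_mem b hv))
  -- Both exponents are at least `M` and their sum is at most `K`, so neither exceeds `K - M`.
  set B : Finset W := (Finset.Icc (M, M) (K - M, K - M) ×ˢ A).image
    fun q => F ![q.1.1, q.1.2] q.2 with hB
  choose A' NL hNL using fun v => wordOp_finite L v K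
  obtain ⟨M', hM'⟩ := (B.image NL).bddBelow
  refine ⟨min M (min NR M'), fun k h1 h2 h0 => ?_⟩
  rw [firstTwo_smul_wordSeries hL hR] at h0
  have hkR : ∀ q ∈ R, k q.2 ≤ K := fun q hq => by rwa [hR q hq]
  have hkL : ∀ q ∈ L, k q.2 ≤ K := fun q hq => by rwa [hL q hq]
  obtain ⟨hv, hv'⟩ := hA k hkR
  have h3 : F ![k 0, k 1] (wordOp R k w) ≠ 0 := fun h => h0 (by rw [h, map_zero])
  have h4 : wordOp R k w ≠ 0 := fun h => h3 (by rw [h, map_zero])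
  have h5 : M ≤ k 0 := (‹∀ v ∈ A, M ≤ b v› _ hv).trans (hb _ _ h3 0)
  have h6 : M ≤ k 1 := (‹∀ v ∈ A, M ≤ b v› _ hv).trans (hb _ _ h3 1)
  have h7 : F ![k 0, k 1] (wordOp R k w) ∈ B := by
    refine Finset.mem_image.2 ⟨((k 0, k 1), wordOp R k w), Finset.mem_product.2
      ⟨Finset.mem_Icc.2 ⟨⟨h5, h6⟩, ⟨?_, ?_⟩⟩, hv⟩, rfl⟩
    · dsimp only
      omega
    · dsimp only
      omega
  have h8 : min NR M' ≤ k 2 := by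
    obtain ⟨q, hq⟩ := List.exists_mem_of_ne_nil _ hne
    rcases List.mem_append.1 hq with hq | hq
    · have := (hNL _ k hkL).2 h0 q hq
      rw [hL q hq] at this
      exact (min_le_right _ _).trans
        ((hM' (Finset.mem_coe.2 (Finset.mem_image_of_mem NL h7))).trans this)
    · have := hv' h4 q hq
      rw [hR q hq] at this
      exact (min_le_left _ _).trans this
  intro s
  fin_cases s
  · exact (min_le_left _ _).trans h5
  · exact (min_le_left _ _).trans h6
  · exact (min_le_right _ _).trans h8

/-- Composition of the products `a(x)ₙ b(x)` with further operators in the variable `x₃` is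
obtained from `a(x₁) b(x₂)` by the substitution `x₁ = x₂ + x₀`. -/
theorem exists_shift_eq (hL : ∀ q ∈ L, q.2 = 2) (hR : ∀ q ∈ R, q.2 = 2)
    (hne : L ++ R ≠ []) (hex : Exhausts (L ++ (a, 0) :: (b, 1) :: R))
    {p : MvPolynomial (Fin 2) ℂ} (hp : p ≠ 0) (h : Clears p a b)
    (S : E W → W → SmallSeries (Fin 2) W) (hS0 : S 0 = 0)
    (hS : ∀ (d : E W) w (k : Fin 3 → ℤ), S d w (Fin.tail k) =
      wordOp L k (HVertexOperator.coeff d (k 1) (wordOp R k w))) :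
    ∃ Y : W → SmallSeries (Fin 3) W, (∃ M : ℤ, ∀ w k, Y w k ≠ 0 → M ≤ k 0) ∧
      (∀ t w, (Y w).slice t = S (nthProduct p a b h (-t - 1)) w) ∧
      ∃ Z : W → shiftSmall W,
        (∀ w, (Z w : SmallSeries (Fin 3) W) = firstTwo p • wordSeries _ hex w) ∧
        ∀ w, shift (Z w) = firstTwo (shiftPoly p) • Y w := by
  obtain ⟨M, hM⟩ := nthProduct_eq_zero p a b h
  have hM' : ∀ w, ∀ t < M, S (nthProduct p a b h (-t - 1)) w = 0 := fun w t ht => by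
    rw [hM t ht, hS0]
    rfl
  have h2 : ∀ A : List (E W × Fin 3), (∀ q ∈ A, q.2 = 2) → ∀ q ∈ A, q.2 ≠ 0 ∧ q.2 ≠ 1 := by
    intro A hA q hq
    rw [hA q hq]
    decide
  refine ⟨fun w => SmallSeries.ofSlices (fun t => S (nthProduct p a b h (-t - 1)) w) M (hM' w),
    ⟨M, fun w k hk => ?_⟩, fun t w => SmallSeries.slice_ofSlices _ _ _ _,
    fun w => ⟨firstTwo p • wordSeries _ hex w,
      firstTwo_smul_mem_shiftSmall hL hR hne hex p h w⟩, fun w => rfl, fun w => ?_⟩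
  · by_contra hlt
    apply hk
    rw [SmallSeries.ofSlices_apply, hM' w _ (not_le.1 hlt)]
    rfl
  · ext k
    have hcongr : ∀ (A : List (E W × Fin 3)), (∀ q ∈ A, q.2 = 2) → ∀ i j,
        wordOp A ![i, j, k 2] = wordOp A k := fun A hA i j =>
      wordOp_congr fun q hq => by rw [hA q hq]; rfl
    -- After the substitution, variables `0` and `1` stand for `x₀` and `x₂`. The factor
    -- `p(x₂+x₀,x₂)` acts inside the word, where `smul_toSmall_vertexOp` applies.
    refine Eq.trans ?_ (rename_smul_context (by decide) L R (h2 L hL) (h2 R hR)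
      (fun v => toSmall (vertexOp p a b h v)) _ w ?_ _ k).symm
    · rw [smul_toSmall_vertexOp hp, shift_apply]
      change _ = wordOp L k (substCoeff _ (k 0) (k 1) (wordOp R k w))
      have e : ∀ i : ℤ, (firstTwo p • wordSeries _ hex w) ![i, k 1 + k 0 - i, k 2] = wordOp L k
          (laurentMul (toLaurent p) (opProd ![a, b]) ![i, k 1 + k 0 - i] (wordOp R k w)) := by
        intro i
        rw [firstTwo_smul_wordSeries hL hR, hcongr L hL, hcongr R hR]
        rfl
      by_cases h0 : 0 ≤ k 0
      · rw [if_pos h0, substCoeff, if_pos h0, map_finsum _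
          (substCoeff_finite h (k 0) (k 1) (wordOp R k w))]
        exact finsum_congr fun i => (congrArg _ (e i)).trans (map_zsmul (wordOp L k) _ _).symm
      · rw [if_neg h0, substCoeff, if_neg h0, map_zero]
    · intro k
      rw [SmallSeries.ofSlices_apply, hS, coeff_nthProduct]
      rfl

end VertexSeries

/-! ### Exchanging the two variables -/

section Swap

/-- Exchanging the two variables of a power series. -/
def swapCoeff : MvPowerSeries (Fin 2) ℂ →ₐ[ℂ] MvPowerSeries (Fin 2) ℂ :=
  MvPowerSeries.rename ![1, 0]

theorem coeff_swapCoeff (f : MvPowerSeries (Fin 2) ℂ) (m : Fin 2 →₀ ℕ) :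
    MvPowerSeries.coeff m (swapCoeff f) =
      MvPowerSeries.coeff (Finsupp.equivFunOnFinite.symm ![m 1, m 0]) f := by
  rw [← intCoeff_natCast, ← intCoeff_natCast, swapCoeff, intCoeff_rename (by decide)]
  · congr 1
    ext s
    fin_cases s <;> simp
  · intro s hs
    fin_cases s
    · exact (hs ⟨1, rfl⟩).elim
    · exact (hs ⟨0, rfl⟩).elim

theorem swapCoeff_swapCoeff (f : MvPowerSeries (Fin 2) ℂ) : swapCoeff (swapCoeff f) = f := by
  ext m
  rw [coeff_swapCoeff, coeff_swapCoeff]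
  congr 2
  ext s
  fin_cases s <;> simp

theorem swapCoeff_hasse_zero (t : ℕ) (f : MvPowerSeries (Fin 2) ℂ) :
    swapCoeff (hasse 0 t f) = hasse 1 t (swapCoeff f) := by
  ext m
  rw [coeff_swapCoeff, coeff_hasse, coeff_hasse, coeff_swapCoeff]
  congr 3
  ext s
  fin_cases s <;> simp

theorem rename_swapCoeff {σ : Type*} [Finite σ] (s j : σ) (f : MvPowerSeries (Fin 2) ℂ) :
    MvPowerSeries.rename ![s, j] (swapCoeff f) = MvPowerSeries.rename ![j, s] f := by
  rw [swapCoeff, MvPowerSeries.rename_rename]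
  congr 2
  ext i
  fin_cases i <;> rfl

variable {V : Type*} [AddCommGroup V] [Module ℂ V]

/-- Exchanging the two variables of a series. -/
def SmallSeries.swap : SmallSeries (Fin 2) V →+ SmallSeries (Fin 2) V where
  toFun F := SmallSeries.mk (fun k => F ![k 1, k 0]) fun K => by
    obtain ⟨N, hN⟩ := F.isSmall K
    refine ⟨N, fun k hk h s => ?_⟩
    have := hN _ (fun s => by fin_cases s <;> simp [hk]) h
    fin_cases s
    · exact this 1
    · exact this 0
  map_zero' := rfl
  map_add' _ _ := rfl

theorem SmallSeries.swap_apply (F : SmallSeries (Fin 2) V) (k : Fin 2 → ℤ) :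
    swap F k = F ![k 1, k 0] := rfl

theorem SmallSeries.swap_smul (f : MvPowerSeries (Fin 2) ℂ) (F : SmallSeries (Fin 2) V) :
    swap (f • F) = swapCoeff f • swap F := by
  ext k
  rw [swapCoeff, SmallSeries.rename_smul_apply (by decide) f (swap F) k F, swap_apply]
  · congr 1
    ext i
    fin_cases i <;> rfl
  · intro n
    rw [swap_apply]
    have hinj : Function.Injective (![1, 0] : Fin 2 → Fin 2) := by decide
    congr 1
    ext i
    fin_cases i
    · exact (hinj.extend_apply n k 0).symm
    · exact (hinj.extend_apply n k 1).symm

theorem swap_pairSeries {W : Type*} [AddCommGroup W] [Module ℂ W] (a b : E W) (w : W) :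
    (pairSeries a b w).swap = oppSeries a b w := by
  ext k
  rw [SmallSeries.swap_apply, pairSeries_apply, oppSeries_apply]
  rfl

theorem swap_oppSeries {W : Type*} [AddCommGroup W] [Module ℂ W] (a b : E W) (w : W) :
    (oppSeries a b w).swap = pairSeries a b w := by
  ext k
  rw [SmallSeries.swap_apply, pairSeries_apply, oppSeries_apply]
  rfl

/-- The families which lie in `N` after exchanging the variables. -/
def swapSubmodule {ι : Type*} {Q : Subalgebra ℂ (MvPowerSeries (Fin 2) ℂ)}
    (N : Submodule Q (ι → SmallSeries (Fin 2) V)) :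
    Submodule (Q.comap swapCoeff) (ι → SmallSeries (Fin 2) V) where
  carrier := {X | (fun w => (X w).swap) ∈ N}
  zero_mem' := by
    have : (fun w : ι => ((0 : ι → SmallSeries (Fin 2) V) w).swap) = 0 := by
      ext1 w
      exact map_zero _
    exact this ▸ N.zero_mem
  add_mem' {X Y} hX hY := by
    have : (fun w : ι => ((X + Y) w).swap) = (fun w => (X w).swap) + fun w => (Y w).swap := by
      ext1 w
      exact map_add _ _ _
    rw [Set.mem_ofPred_eq, this]
    exact N.add_mem hX hY
  smul_mem' q X hX := by
    have : (fun w : ι => ((q • X) w).swap) =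
        (⟨swapCoeff q, q.2⟩ : Q) • fun w => (X w).swap := by
      ext1 w
      exact SmallSeries.swap_smul _ _
    rw [Set.mem_ofPred_eq, this]
    exact N.smul_mem _ hX

theorem mem_swapSubmodule {ι : Type*} {Q : Subalgebra ℂ (MvPowerSeries (Fin 2) ℂ)}
    {N : Submodule Q (ι → SmallSeries (Fin 2) V)} {X : ι → SmallSeries (Fin 2) V} :
    X ∈ swapSubmodule N ↔ (fun w => (X w).swap) ∈ N := Iff.rfl

end Swap

/-! ### Exchange relations with prescribed denominators and scalars -/

/-- A type of exchange relations: the denominators and the scalars that may occur in them. -/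
structure ExchangeKind where
  /-- The factors that may be cleared. -/
  denoms : Submonoid (MvPowerSeries (Fin 2) ℂ)
  /-- The coefficients that may occur after the exchange. -/
  scalars : Subalgebra ℂ (MvPowerSeries (Fin 2) ℂ)
  exists_poly : ∀ f ∈ denoms, ∃ p : MvPolynomial (Fin 2) ℂ, p ≠ 0 ∧ f = p
  le : ∀ f ∈ denoms, f ∈ scalars
  hasse_mem : ∀ i t, ∀ f ∈ scalars, hasse i t f ∈ scalars

variable {W : Type*} [AddCommGroup W] [Module ℂ W] (K : ExchangeKind)

/-- The combinations of the products `b(y) a(x)`. -/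
def oppSpan (A B : Set (E W)) : Submodule K.scalars (W → SmallSeries (Fin 2) W) :=
  Submodule.span K.scalars (Set.image2 (fun b a => oppSeries b a) B A)

/-- Products `a(x) b(y)` with `a ∈ A`, `b ∈ B` can be reordered, after clearing denominators. -/
def Exchanges (A B : Set (E W)) : Prop :=
  ∀ a ∈ A, ∀ b ∈ B, ∃ p ∈ K.denoms, (fun w => p • pairSeries a b w) ∈ oppSpan K A B

variable {K}

theorem oppSeries_mem_oppSpan {A B : Set (E W)} {a b : E W} (ha : a ∈ A) (hb : b ∈ B) :
    oppSeries b a ∈ oppSpan K A B :=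
  Submodule.subset_span ⟨b, hb, a, ha, rfl⟩

theorem oppSpan_mono {A A' B B' : Set (E W)} (hA : A ⊆ A') (hB : B ⊆ B') :
    oppSpan K A B ≤ oppSpan K A' B' :=
  Submodule.span_mono (Set.image2_subset hB hA)

theorem smul_mem_oppSpan {A B : Set (E W)} {f : MvPowerSeries (Fin 2) ℂ} (hf : f ∈ K.scalars)
    {X : W → SmallSeries (Fin 2) W} (hX : X ∈ oppSpan K A B) : f • X ∈ oppSpan K A B :=
  (oppSpan K A B).smul_mem ⟨f, hf⟩ hX

/-- The span is taken in families indexed by `W` so that one choice of scalars and operators serves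
all vectors, as locality requires. -/
theorem mem_oppSpan_iff {A B : Set (E W)} {X : W → SmallSeries (Fin 2) W} :
    X ∈ oppSpan K A B ↔ ∃ (n : ℕ) (f : Fin n → MvPowerSeries (Fin 2) ℂ) (u v : Fin n → E W),
      (∀ l, f l ∈ K.scalars ∧ u l ∈ B ∧ v l ∈ A) ∧
      ∀ w, X w = ∑ l, f l • oppSeries (u l) (v l) w := by
  constructor
  · intro h
    obtain ⟨n, f, g, rfl⟩ := Submodule.mem_span_set'.1 h
    choose u hu v hv huv using fun l => (g l).2
    refine ⟨n, fun l => f l, u, v, fun l => ⟨(f l).2, hu l, hv l⟩, fun w => ?_⟩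
    rw [Finset.sum_apply]
    refine Finset.sum_congr rfl fun l _ => ?_
    rw [Pi.smul_apply, ← huv l]
    rfl
  · rintro ⟨n, f, u, v, h, hX⟩
    have : X = ∑ l, f l • oppSeries (u l) (v l) := by
      ext1 w
      rw [hX, Finset.sum_apply]
      rfl
    rw [this]
    exact Submodule.sum_mem _ fun l _ =>
      smul_mem_oppSpan (h l).1 (oppSeries_mem_oppSpan (h l).2.2 (h l).2.1)

theorem Exchanges.hasExchange {U : Set (E W)} (h : Exchanges K U U) : HasExchange U := by
  intro a ha b hb
  obtain ⟨p, hp, hX⟩ := h a ha b hb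
  obtain ⟨q, hq, rfl⟩ := K.exists_poly p hp
  obtain ⟨n, f, u, v, hl, hX⟩ := mem_oppSpan_iff.1 hX
  exact ⟨q, hq, n, f, u, v, fun l => (hl l).2, hX⟩

theorem exists_clears {U : Set (E W)} (h : IsQuasiCompatible U) {a b : E W} (ha : a ∈ U)
    (hb : b ∈ U) : ∃ p : MvPolynomial (Fin 2) ℂ, p ≠ 0 ∧ Clears p a b := by
  obtain ⟨p, hp, h⟩ := h 2 ![a, b] (fun i => by fin_cases i <;> simp [ha, hb])
  have e : pairProduct 2 p = p := by
    have h0 : Finset.Ioi (0 : Fin 2) = {1} := by decide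
    have h1 : Finset.Ioi (1 : Fin 2) = ∅ := by decide
    rw [pairProduct, Fin.prod_univ_two, h0, h1, Finset.prod_singleton, Finset.prod_empty, mul_one]
    have : (![0, 1] : Fin 2 → Fin 2) = id := by decide
    rw [this, MvPolynomial.rename_id_apply]
  rw [e] at h
  exact ⟨p, hp, h⟩

/-! ### Composing exchanges -/

section Reordering

variable {ι V : Type*} [AddCommGroup V] [Module ℂ V] {Q : Subalgebra ℂ (MvPowerSeries (Fin 2) ℂ)}
  {N : Submodule Q (ι → SmallSeries (Fin 2) V)}

/-- Two successive exchanges. -/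
theorem Shiftable.of_exchange {S : Set (MvPowerSeries (Fin 2) ℂ)}
    {r r' : MvPowerSeries (Fin 2) ℂ →ₐ[ℂ] MvPowerSeries (Fin 3) ℂ}
    (hr : ∀ f ∈ S, ∀ X, Shiftable N X → Shiftable N (r f • X))
    (hr' : ∀ f ∈ S, ∀ X, Shiftable N X → Shiftable N (r' f • X))
    {p : MvPowerSeries (Fin 2) ℂ} {n : ℕ} {f P : Fin n → MvPowerSeries (Fin 2) ℂ} {m : Fin n → ℕ}
    {f' : ∀ l, Fin (m l) → MvPowerSeries (Fin 2) ℂ} (hf : ∀ l, f l ∈ S)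
    (hP : ∀ s : Finset (Fin n), ∏ l ∈ s, P l ∈ S) (hf' : ∀ l i, f' l i ∈ S)
    {X : ι → SmallSeries (Fin 3) V} {X' : Fin n → ι → SmallSeries (Fin 3) V}
    {X'' : ∀ l, Fin (m l) → ι → SmallSeries (Fin 3) V}
    (h : ∀ w, r p • X w = ∑ l, r (f l) • X' l w)
    (h' : ∀ l w, r' (P l) • X' l w = ∑ i, r' (f' l i) • X'' l i w)
    (hX : ∀ l i, Shiftable N (X'' l i)) : Shiftable N (r p • r' (∏ l, P l) • X) := by
  classical
  -- In the `l`-th term only `P l` is needed for the second exchange; the other factors of the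
  -- product remain as scalars.
  have e : r p • r' (∏ l, P l) • X = ∑ l, r (f l) • r' (∏ i ∈ Finset.univ.erase l, P i) •
      ∑ i, r' (f' l i) • X'' l i := by
    ext1 w
    rw [Pi.smul_apply, Pi.smul_apply, smul_comm, h, Finset.smul_sum, Finset.sum_apply]
    refine Finset.sum_congr rfl fun l _ => ?_
    have e' : (∑ i, r' (f' l i) • X'' l i) w = r' (P l) • X' l w := by
      rw [h', Finset.sum_apply]
      rfl
    rw [Pi.smul_apply, Pi.smul_apply, e', smul_comm, smul_smul (r' _) (r' _), ← map_mul,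
      Finset.prod_erase_mul _ _ (Finset.mem_univ l)]
  rw [e]
  exact Shiftable.sum _ fun l _ => hr _ (hf l) _ (hr' _ (hP _) _
    (Shiftable.sum _ fun i _ => hr' _ (hf' l i) _ (hX l i)))

end Reordering

/-! ### From relations in three variables to relations for `n`th products -/

section Products

variable {Q : Subalgebra ℂ (MvPowerSeries (Fin 2) ℂ)} {N : Submodule Q (W → SmallSeries (Fin 2) W)}
  {L R : List (E W × Fin 3)} {a b : E W}

/-- When `a` and `b` are adjacent, the substitution produces the generating series of their `n`th
products, inserted in the word by `S`. Its coefficients lie in `N` by assumption; this is where the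
chains of exchanges end. -/
theorem shiftable_wordSeries (hL : ∀ q ∈ L, q.2 = 2) (hR : ∀ q ∈ R, q.2 = 2)
    (hne : L ++ R ≠ []) (hex : Exhausts (L ++ (a, 0) :: (b, 1) :: R))
    {p : MvPolynomial (Fin 2) ℂ} (hp : p ≠ 0) (h : Clears p a b)
    (S : E W → W → SmallSeries (Fin 2) W) (hS0 : S 0 = 0)
    (hS : ∀ (d : E W) w (k : Fin 3 → ℤ), S d w (Fin.tail k) =
      wordOp L k (HVertexOperator.coeff d (k 1) (wordOp R k w)))
    (hN : ∀ n, S (nthProduct p a b h n) ∈ N) : Shiftable N (wordSeries _ hex) := by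
  obtain ⟨Y, hY, hYS, Z, hZ, hZY⟩ := exists_shift_eq hL hR hne hex hp h S hS0 hS
  refine ⟨p, hp, Z, hZ, Y, ⟨hY, fun t => ?_⟩, hZY⟩
  simp only [hYS]
  exact hN _

/-- The family `S` describes how `a(x)ₙb(x)` stands next to the third operator, so both orders are
covered. The relation for the generating series is solved for the coefficient of `x₀ ^ (-n-1)`. -/
theorem exists_smul_nthProduct_mem (hQ : ∀ t, ∀ f ∈ Q, hasse 0 t f ∈ Q)
    {D : Submonoid (MvPowerSeries (Fin 2) ℂ)} (hD : ∀ f ∈ D, f ∈ Q)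
    (hL : ∀ q ∈ L, q.2 = 2) (hR : ∀ q ∈ R, q.2 = 2)
    (hne : L ++ R ≠ []) (hex : Exhausts (L ++ (a, 0) :: (b, 1) :: R))
    {p : MvPolynomial (Fin 2) ℂ} (hp : p ≠ 0) (h : Clears p a b)
    (S : E W → W → SmallSeries (Fin 2) W) (hS0 : S 0 = 0)
    (hS : ∀ (d : E W) w (k : Fin 3 → ℤ), S d w (Fin.tail k) =
      wordOp L k (HVertexOperator.coeff d (k 1) (wordOp R k w)))
    {f f' : MvPowerSeries (Fin 2) ℂ} (hf : f ∈ D) (hf' : f' ∈ D)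
    (hX : Shiftable N (MvPowerSeries.rename (![1, 2] : Fin 2 → Fin 3) f •
      MvPowerSeries.rename (![0, 2] : Fin 2 → Fin 3) f' • wordSeries _ hex)) (n : ℤ) :
    ∃ q ∈ D, (fun w => q • S (nthProduct p a b h n) w) ∈ N := by
  obtain ⟨Y, hY, hYS, Z, hZ, hZY⟩ := exists_shift_eq hL hR hne hex hp h S hS0 hS
  obtain ⟨q, hq, hq'⟩ := (hX.slicesIn hY hp hZ hZY).exists_denominator hQ hD hY hf hf' (-n - 1)
  refine ⟨q, hq, ?_⟩
  simp only [hYS] at hq'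
  have e : -(-n - 1) - 1 = n := by ring
  rwa [e] at hq'

end Products

/-! ### Exchanging a third operator with `a(x)ₙ b(x)`, on either side -/

theorem oppSeries_zero_right (c : E W) : oppSeries c 0 = 0 := by
  ext w k
  rw [oppSeries_apply]
  simp

theorem pairSeries_zero_left (c : E W) : pairSeries 0 c = 0 := by
  ext w k
  rw [pairSeries_apply]
  simp

theorem pairSeries_tail (d c : E W) (w : W) (k : Fin 3 → ℤ) : pairSeries d c w (Fin.tail k) =
    wordOp [] k (HVertexOperator.coeff d (k 1) (wordOp [(c, 2)] k w)) := by
  simp only [pairSeries_apply, Fin.tail, wordOp_nil, wordOp_cons, Fin.succ_zero_eq_one,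
    Fin.succ_one_eq_two, Module.End.one_apply, Module.End.mul_apply]

theorem oppSeries_tail (d c : E W) (w : W) (k : Fin 3 → ℤ) : oppSeries c d w (Fin.tail k) =
    wordOp [(c, 2)] k (HVertexOperator.coeff d (k 1) (wordOp [] k w)) := by
  simp only [oppSeries_apply, Fin.tail, wordOp_nil, wordOp_cons, Fin.succ_zero_eq_one,
    Fin.succ_one_eq_two, Module.End.one_apply, Module.End.mul_apply]

theorem exhausts_middle (a b c : E W) :
    Exhausts ([] ++ (a, (0 : Fin 3)) :: (b, 1) :: [(c, 2)]) := by
  intro s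
  fin_cases s <;> simp

theorem exhausts_middle_swap (a b c : E W) :
    Exhausts ([] ++ (a, (0 : Fin 3)) :: (c, 2) :: [(b, 1)]) := by
  intro s
  fin_cases s <;> simp

theorem exhausts_first (a b c : E W) :
    Exhausts ([(c, 2)] ++ (a, (0 : Fin 3)) :: (b, 1) :: []) := by
  intro s
  fin_cases s <;> simp

theorem exchange_last_two {a b c : E W} {q : MvPowerSeries (Fin 2) ℂ} {m : ℕ}
    {f : Fin m → MvPowerSeries (Fin 2) ℂ} {u v : Fin m → E W}
    (h : ∀ w, q • pairSeries b c w = ∑ l, f l • oppSeries (u l) (v l) w) (w : W) :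
    MvPowerSeries.rename (![1, 2] : Fin 2 → Fin 3) q • wordSeries _ (exhausts_middle a b c) w =
      ∑ l, MvPowerSeries.rename (![1, 2] : Fin 2 → Fin 3) (f l) •
        wordSeries _ (exhausts_middle_swap a (v l) (u l)) w :=
  exchange_in_word h (by decide) [(a, 0)] [] (by simp) (by simp) (exhausts_middle a b c)
    (fun l => exhausts_middle_swap a (v l) (u l)) w

theorem exchange_first_two {a b c : E W} {q : MvPowerSeries (Fin 2) ℂ} {m : ℕ}
    {f : Fin m → MvPowerSeries (Fin 2) ℂ} {u v : Fin m → E W}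
    (h : ∀ w, q • pairSeries a c w = ∑ l, f l • oppSeries (u l) (v l) w) (w : W) :
    MvPowerSeries.rename (![0, 2] : Fin 2 → Fin 3) q •
        wordSeries _ (exhausts_middle_swap a b c) w =
      ∑ l, MvPowerSeries.rename (![0, 2] : Fin 2 → Fin 3) (f l) •
        wordSeries _ (exhausts_first (v l) b (u l)) w :=
  exchange_in_word h (by decide) [] [(b, 1)] (by simp) (by simp) (exhausts_middle_swap a b c)
    (fun l => exhausts_first (v l) b (u l)) w

/-- In `c(x₃)a(x₁)b(x₂)` the operators `a, b` are adjacent to the right of `c`. The coefficients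
after substitution are products `c(y)d(x)` with `d` an `n`th product, already in the desired order.
-/
theorem shiftable_wordSeries_first {U U' C : Set (E W)} (hU : IsQuasiCompatible U)
    (hU' : ∀ a ∈ U, ∀ b ∈ U, ∀ p : MvPolynomial (Fin 2) ℂ, p ≠ 0 → ∀ (h : Clears p a b) n,
      nthProduct p a b h n ∈ U') {a b c : E W} (ha : a ∈ U) (hb : b ∈ U) (hc : c ∈ C) :
    Shiftable (oppSpan K U' C) (wordSeries _ (exhausts_first a b c)) := by
  obtain ⟨p', hp', h'⟩ := exists_clears hU ha hb
  exact shiftable_wordSeries (by simp) (by simp) (by simp) _ hp' h'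
        (fun d => oppSeries c d) (oppSeries_zero_right _) (fun d => oppSeries_tail d _)
        fun n => oppSeries_mem_oppSpan (hU' _ ha _ hb p' hp' h' n) hc

theorem Shiftable.of_exchange_left {N : Submodule K.scalars (W → SmallSeries (Fin 2) W)}
    {p : MvPowerSeries (Fin 2) ℂ} {n : ℕ} {f P : Fin n → MvPowerSeries (Fin 2) ℂ} {m : Fin n → ℕ}
    {f' : ∀ l, Fin (m l) → MvPowerSeries (Fin 2) ℂ} (hf : ∀ l, f l ∈ K.scalars)
    (hP : ∀ l, P l ∈ K.denoms) (hf' : ∀ l i, f' l i ∈ K.scalars)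
    {X : W → SmallSeries (Fin 3) W} {X' : Fin n → W → SmallSeries (Fin 3) W}
    {X'' : ∀ l, Fin (m l) → W → SmallSeries (Fin 3) W}
    (h : ∀ w, MvPowerSeries.rename (![1, 2] : Fin 2 → Fin 3) p • X w =
      ∑ l, MvPowerSeries.rename (![1, 2] : Fin 2 → Fin 3) (f l) • X' l w)
    (h' : ∀ l w, MvPowerSeries.rename (![0, 2] : Fin 2 → Fin 3) (P l) • X' l w =
      ∑ i, MvPowerSeries.rename (![0, 2] : Fin 2 → Fin 3) (f' l i) • X'' l i w)
    (hX : ∀ l i, Shiftable N (X'' l i)) :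
    Shiftable N (MvPowerSeries.rename
      (![1, 2] : Fin 2 → Fin 3) p •
      MvPowerSeries.rename (![0, 2] : Fin 2 → Fin 3) (∏ l, P l) • X) := by
    refine Shiftable.of_exchange (S := K.scalars) (fun f hf X hX => ?_) (fun f hf X hX => ?_)
      hf (fun s => K.le _ (K.denoms.prod_mem fun l _ => hP l)) hf' h h' hX
    · exact hX.smul_second hf
    · exact hX.smul_first (K.hasse_mem 0) hf

theorem exists_smul_nthProduct_left_mem {U' C : Set (E W)}
    {a b c : E W}
    {p : MvPolynomial (Fin 2) ℂ} (hp : p ≠ 0) (h : Clears p a b) (n : ℤ)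
    {q Q : MvPowerSeries (Fin 2) ℂ} (hq : q ∈ K.denoms) (hQ' : Q ∈ K.denoms)
    (hX0 : Shiftable (oppSpan K U' C) (MvPowerSeries.rename
      (![1, 2] : Fin 2 → Fin 3) q • MvPowerSeries.rename (![0, 2] : Fin 2 → Fin 3) Q •
        wordSeries _ (exhausts_middle a b c))) :
    ∃ q ∈ K.denoms, (fun w => q • pairSeries (nthProduct p a b h n) c w) ∈ oppSpan K U' C := by
  exact exists_smul_nthProduct_mem (L := []) (R := [(c, 2)]) (K.hasse_mem 0) K.le (by simp) (by simp)
    (by simp) (exhausts_middle a b c) hp h (fun d => pairSeries d c) (pairSeries_zero_left c)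
    (fun d => pairSeries_tail d c) hq hQ' hX0 n

/-- Exchange relations pass to the products `a(x)ₙ b(x)` on the left. -/
theorem Exchanges.nthProduct_left {U U' C : Set (E W)} (hUC : Exchanges K U C)
    (hU : IsQuasiCompatible U)
    (hU' : ∀ a ∈ U, ∀ b ∈ U, ∀ p : MvPolynomial (Fin 2) ℂ, p ≠ 0 → ∀ (h : Clears p a b) n,
      nthProduct p a b h n ∈ U') {a b c : E W} (ha : a ∈ U) (hb : b ∈ U) (hc : c ∈ C)
    {p : MvPolynomial (Fin 2) ℂ} (hp : p ≠ 0) (h : Clears p a b) (n : ℤ) :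
    ∃ q ∈ K.denoms, (fun w => q • pairSeries (nthProduct p a b h n) c w) ∈ oppSpan K U' C := by
  -- First `c` passes `b`; then each operator of `C` so produced passes `a`.
  obtain ⟨q, hq, hX⟩ := hUC b hb c hc
  obtain ⟨m, f, u, v, huv, hX⟩ := mem_oppSpan_iff.1 hX
  choose q' hq' hX' using fun l => hUC a ha (u l) (huv l).2.1
  choose m' f' u' v' huv' hX' using fun l => mem_oppSpan_iff.1 (hX' l)
  exact exists_smul_nthProduct_left_mem hp h n hq (K.denoms.prod_mem fun l _ => hq' l)
    (Shiftable.of_exchange_left (fun l => (huv l).1) hq' (fun l i => (huv' l i).1)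
      (exchange_last_two hX) (fun l => exchange_first_two (hX' l)) fun l i =>
        shiftable_wordSeries_first hU hU' (huv' l i).2.2 (huv l).2.2 (huv' l i).2.1)

/-- Exchanging the variables turns derivatives in `x` into derivatives in `y`; for this reason an
exchange kind requires stability in both variables. -/
theorem hasse_mem_comap_swapCoeff (t : ℕ) (f : MvPowerSeries (Fin 2) ℂ)
    (hf : f ∈ K.scalars.comap swapCoeff) : hasse 0 t f ∈ K.scalars.comap swapCoeff := by
  rw [Subalgebra.mem_comap, swapCoeff_hasse_zero]
  exact K.hasse_mem 1 t _ hf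

theorem swapCoeff_mem_comap {f : MvPowerSeries (Fin 2) ℂ} (hf : f ∈ K.scalars) :
    swapCoeff f ∈ K.scalars.comap swapCoeff := by
  rwa [Subalgebra.mem_comap, swapCoeff_swapCoeff]

theorem exchange_first_two' {a b c : E W} {q : MvPowerSeries (Fin 2) ℂ} {m : ℕ}
    {f : Fin m → MvPowerSeries (Fin 2) ℂ} {u v : Fin m → E W}
    (h : ∀ w, q • pairSeries c a w = ∑ l, f l • oppSeries (u l) (v l) w) (w : W) :
    MvPowerSeries.rename (![2, 0] : Fin 2 → Fin 3) q • wordSeries _ (exhausts_first a b c) w =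
      ∑ l, MvPowerSeries.rename (![2, 0] : Fin 2 → Fin 3) (f l) •
        wordSeries _ (exhausts_middle_swap (u l) b (v l)) w :=
  exchange_in_word h (by decide) [] [(b, 1)] (by simp) (by simp) (exhausts_first a b c)
    (fun l => exhausts_middle_swap (u l) b (v l)) w

theorem exchange_last_two' {a b c : E W} {q : MvPowerSeries (Fin 2) ℂ} {m : ℕ}
    {f : Fin m → MvPowerSeries (Fin 2) ℂ} {u v : Fin m → E W}
    (h : ∀ w, q • pairSeries c b w = ∑ l, f l • oppSeries (u l) (v l) w) (w : W) :
    MvPowerSeries.rename (![2, 1] : Fin 2 → Fin 3) q •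
        wordSeries _ (exhausts_middle_swap a b c) w =
      ∑ l, MvPowerSeries.rename (![2, 1] : Fin 2 → Fin 3) (f l) •
        wordSeries _ (exhausts_middle a (u l) (v l)) w :=
  exchange_in_word h (by decide) [(a, 0)] [] (by simp) (by simp) (exhausts_middle_swap a b c)
    (fun l => exhausts_middle a (u l) (v l)) w

/-- Here the exchanges end with `a(x₁)b(x₂)c(x₃)`. In the variables `x₂, x₃` its coefficients are
`d(x)c(y)`, which is the target order only after the two variables are swapped. -/
theorem shiftable_wordSeries_last {U U' C : Set (E W)} (hU : IsQuasiCompatible U)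
    (hU' : ∀ a ∈ U, ∀ b ∈ U, ∀ p : MvPolynomial (Fin 2) ℂ, p ≠ 0 → ∀ (h : Clears p a b) n,
      nthProduct p a b h n ∈ U') {a b c : E W} (ha : a ∈ U) (hb : b ∈ U) (hc : c ∈ C) :
    Shiftable (swapSubmodule (oppSpan K C U')) (wordSeries _ (exhausts_middle a b c)) := by
  obtain ⟨p', hp', h'⟩ := exists_clears hU ha hb
  refine shiftable_wordSeries (by simp) (by simp) (by simp) _ hp' h'
    (fun d => pairSeries d c) (pairSeries_zero_left _) (fun d => pairSeries_tail d _) fun n => ?_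
  rw [mem_swapSubmodule]
  simp only [swap_pairSeries]
  exact oppSeries_mem_oppSpan hc (hU' _ ha _ hb p' hp' h' n)

theorem exists_smul_nthProduct_right_mem {U' C : Set (E W)} {a b c : E W}
    {p : MvPolynomial (Fin 2) ℂ} (hp : p ≠ 0) (h : Clears p a b) (n : ℤ)
    {q r : MvPowerSeries (Fin 2) ℂ} (hq : q ∈ K.denoms) (hr : r ∈ K.denoms)
    (hX : Shiftable (swapSubmodule (oppSpan K C U')) (MvPowerSeries.rename
      (![2, 0] : Fin 2 → Fin 3) q • MvPowerSeries.rename (![2, 1] : Fin 2 → Fin 3) r •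
        wordSeries _ (exhausts_first a b c))) :
    ∃ q ∈ K.denoms, (fun w => q • pairSeries c (nthProduct p a b h n) w) ∈ oppSpan K C U' := by
  have hmem : ∀ f ∈ K.denoms, swapCoeff f ∈ K.denoms.comap swapCoeff := fun f hf => by
    rwa [Submonoid.mem_comap, swapCoeff_swapCoeff]
  -- The relations are in `(x₃,x₁)` and `(x₃,x₂)`; swapping variables brings them to the form
  -- `(x₁,x₃)` and `(x₂,x₃)` expected by the substitution.
  rw [smul_comm, ← rename_swapCoeff 0 2, ← rename_swapCoeff 1 2] at hX
  obtain ⟨g, hg, hg'⟩ := exists_smul_nthProduct_mem (L := [(c, 2)]) (R := [])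
    hasse_mem_comap_swapCoeff (D := K.denoms.comap swapCoeff) (fun f hf => K.le _ hf) (by simp)
    (by simp) (by simp) (exhausts_first a b c) hp h (fun d => oppSeries c d)
    (oppSeries_zero_right c) (fun d => oppSeries_tail d c) (hmem _ hr) (hmem q hq) hX n
  refine ⟨swapCoeff g, hg, ?_⟩
  rw [mem_swapSubmodule] at hg'
  simpa only [SmallSeries.swap_smul, swap_oppSeries] using hg'

theorem Shiftable.of_exchange_right
    {N : Submodule (K.scalars.comap swapCoeff) (W → SmallSeries (Fin 2) W)}
    {p : MvPowerSeries (Fin 2) ℂ} {n : ℕ} {f P : Fin n → MvPowerSeries (Fin 2) ℂ} {m : Fin n → ℕ}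
    {f' : ∀ l, Fin (m l) → MvPowerSeries (Fin 2) ℂ} (hf : ∀ l, f l ∈ K.scalars)
    (hP : ∀ l, P l ∈ K.denoms) (hf' : ∀ l i, f' l i ∈ K.scalars)
    {X : W → SmallSeries (Fin 3) W} {X' : Fin n → W → SmallSeries (Fin 3) W}
    {X'' : ∀ l, Fin (m l) → W → SmallSeries (Fin 3) W}
    (h : ∀ w, MvPowerSeries.rename (![2, 0] : Fin 2 → Fin 3) p • X w =
      ∑ l, MvPowerSeries.rename (![2, 0] : Fin 2 → Fin 3) (f l) • X' l w)
    (h' : ∀ l w, MvPowerSeries.rename (![2, 1] : Fin 2 → Fin 3) (P l) • X' l w =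
      ∑ i, MvPowerSeries.rename (![2, 1] : Fin 2 → Fin 3) (f' l i) • X'' l i w)
    (hX : ∀ l i, Shiftable N (X'' l i)) :
    Shiftable N (MvPowerSeries.rename
      (![2, 0] : Fin 2 → Fin 3) p •
      MvPowerSeries.rename (![2, 1] : Fin 2 → Fin 3) (∏ l, P l) • X) := by
    refine Shiftable.of_exchange (S := K.scalars) (fun f hf X hX => ?_) (fun f hf X hX => ?_)
      hf (fun s => K.le _ (K.denoms.prod_mem fun l _ => hP l)) hf' h h' hX
    · rw [← rename_swapCoeff]
      exact hX.smul_first hasse_mem_comap_swapCoeff (swapCoeff_mem_comap hf)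
    · rw [← rename_swapCoeff]
      exact hX.smul_second (swapCoeff_mem_comap hf)

/-- Exchange relations pass to the products `a(x)ₙ b(x)` on the right. -/
theorem Exchanges.nthProduct_right {U U' C : Set (E W)} (hCU : Exchanges K C U)
    (hU : IsQuasiCompatible U)
    (hU' : ∀ a ∈ U, ∀ b ∈ U, ∀ p : MvPolynomial (Fin 2) ℂ, p ≠ 0 → ∀ (h : Clears p a b) n,
      nthProduct p a b h n ∈ U') {a b c : E W} (ha : a ∈ U) (hb : b ∈ U) (hc : c ∈ C)
    {p : MvPolynomial (Fin 2) ℂ} (hp : p ≠ 0) (h : Clears p a b) (n : ℤ) :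
    ∃ q ∈ K.denoms, (fun w => q • pairSeries c (nthProduct p a b h n) w) ∈ oppSpan K C U' := by
  obtain ⟨q, hq, hX⟩ := hCU c hc a ha
  obtain ⟨m, f, u, v, huv, hX⟩ := mem_oppSpan_iff.1 hX
  choose q' hq' hX' using fun l => hCU (v l) (huv l).2.2 b hb
  choose m' f' u' v' huv' hX' using fun l => mem_oppSpan_iff.1 (hX' l)
  exact exists_smul_nthProduct_right_mem hp h n hq (K.denoms.prod_mem fun l _ => hq' l)
    (Shiftable.of_exchange_right (fun l => (huv l).1) hq' (fun l i => (huv' l i).1)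
      (exchange_first_two' hX) (fun l => exchange_last_two' (hX' l)) fun l i =>
        shiftable_wordSeries_last hU hU' (huv l).2.1 (huv' l i).2.1 (huv' l i).2.2)

/-! ### Generating the closed subspace -/

section Closure

variable {W : Type*} [AddCommGroup W] [Module ℂ W] {K : ExchangeKind}

variable (K) in
/-- The product `a(x) b(y)` can be reordered, after clearing denominators, within the given
families of operators. -/
def ExchangesPair (A B : Set (E W)) (a b : E W) : Prop :=
  ∃ p ∈ K.denoms, (fun w => p • pairSeries a b w) ∈ oppSpan K A B

theorem ExchangesPair.mono {A A' B B' : Set (E W)} (hA : A ⊆ A') (hB : B ⊆ B') {a b : E W}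
    (h : ExchangesPair K A B a b) : ExchangesPair K A' B' a b := by
  obtain ⟨p, hp, h⟩ := h
  exact ⟨p, hp, oppSpan_mono hA hB h⟩

theorem ExchangesPair.of_add {A B : Set (E W)} {a b a' b' c d : E W}
    (h : ExchangesPair K A B a b) (h' : ExchangesPair K A B a' b')
    (hadd : ∀ w, pairSeries c d w = pairSeries a b w + pairSeries a' b' w) :
    ExchangesPair K A B c d := by
  obtain ⟨p, hp, h⟩ := h
  obtain ⟨p', hp', h'⟩ := h'
  refine ⟨p * p', K.denoms.mul_mem hp hp', ?_⟩
  have e : (fun w => (p * p') • pairSeries c d w) =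
      p' • (fun w => p • pairSeries a b w) + p • (fun w => p' • pairSeries a' b' w) := by
    ext1 w
    rw [Pi.add_apply, Pi.smul_apply, Pi.smul_apply, hadd, smul_add, smul_smul, smul_smul,
      mul_comm p']
  rw [e]
  exact Submodule.add_mem _ (smul_mem_oppSpan (K.le _ hp') h) (smul_mem_oppSpan (K.le _ hp) h')

theorem ExchangesPair.of_smul {A B : Set (E W)} {a b c d : E W} (r : ℂ)
    (h : ExchangesPair K A B a b)
    (hsmul : ∀ w, pairSeries c d w = (MvPowerSeries.C r : MvPowerSeries (Fin 2) ℂ) •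
      pairSeries a b w) :
    ExchangesPair K A B c d := by
  obtain ⟨p, hp, h⟩ := h
  refine ⟨p, hp, ?_⟩
  have e : (fun w => p • pairSeries c d w) =
      (MvPowerSeries.C r : MvPowerSeries (Fin 2) ℂ) • (fun w => p • pairSeries a b w) := by
    ext1 w
    rw [Pi.smul_apply, hsmul, smul_comm]
  rw [e]
  exact smul_mem_oppSpan (K.scalars.algebraMap_mem r) h

theorem ExchangesPair.zero_left (A B : Set (E W)) (b : E W) : ExchangesPair K A B 0 b := by
  refine ⟨1, K.denoms.one_mem, ?_⟩
  have e : (fun w => (1 : MvPowerSeries (Fin 2) ℂ) • pairSeries 0 b w) = 0 := by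
    rw [pairSeries_zero_left]
    ext1 w
    exact smul_zero _
  rw [e]
  exact Submodule.zero_mem _

theorem ExchangesPair.zero_right (A B : Set (E W)) (a : E W) : ExchangesPair K A B a 0 := by
  refine ⟨1, K.denoms.one_mem, ?_⟩
  have e : (fun w => (1 : MvPowerSeries (Fin 2) ℂ) • pairSeries a 0 w) = 0 := by
    ext w k
    rw [one_smul, pairSeries_apply]
    simp
  rw [e]
  exact Submodule.zero_mem _

/-- The product is bilinear: a sum is cleared by the product of two denominators, and complex
multiples are absorbed by the constants in the scalar algebra. -/
theorem Exchanges.span {A B : Set (E W)} (h : Exchanges K A B) :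
    Exchanges K (Submodule.span ℂ A : Set (E W)) (Submodule.span ℂ B) := by
  intro a ha b hb
  change ExchangesPair K _ _ a b
  induction ha using Submodule.span_induction with
  | zero => exact ExchangesPair.zero_left _ _ b
  | add a a' _ _ ha ha' =>
    refine ha.of_add ha' fun w => ?_
    ext k
    simp [pairSeries_apply]
  | smul r a _ ha =>
    refine ha.of_smul r fun w => ?_
    ext k
    rw [SmallSeries.C_smul_apply]
    simp [pairSeries_apply]
  | mem a ha =>
    induction hb using Submodule.span_induction with
    | zero => exact ExchangesPair.zero_right _ _ a
    | add b b' _ _ hb hb' =>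
      refine hb.of_add hb' fun w => ?_
      ext k
      simp [pairSeries_apply]
    | smul r b _ hb =>
      refine hb.of_smul r fun w => ?_
      ext k
      rw [SmallSeries.C_smul_apply]
      simp [pairSeries_apply]
    | mem b hb =>
      exact ExchangesPair.mono Submodule.subset_span Submodule.subset_span (h a ha b hb)

theorem coeff_oneW (i : ℤ) (w : W) :
    HVertexOperator.coeff (oneW W) i w = if i = 0 then w else 0 := by
  change (HahnSeries.single (0 : ℤ) w).coeff i = _
  rw [HahnSeries.coeff_single]
  split_ifs <;> rfl

/-- The identity operator commutes with every series, so the exchange needs neither a denominator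
nor a correction. -/
theorem Exchanges.insert_oneW {S : Set (E W)} (h : Exchanges K S S) :
    Exchanges K (S ∪ {oneW W}) (S ∪ {oneW W}) := by
  have key : ∀ a b : E W, a ∈ S ∪ {oneW W} → b ∈ S ∪ {oneW W} →
      pairSeries a b = oppSeries b a →
      ExchangesPair K (S ∪ {oneW W}) (S ∪ {oneW W}) a b := by
    intro a b ha hb e
    refine ⟨1, K.denoms.one_mem, ?_⟩
    simp only [one_smul, e]
    exact oppSeries_mem_oppSpan ha hb
  have hleft : ∀ b : E W, pairSeries (oneW W) b = oppSeries b (oneW W) := by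
    intro b
    ext w k
    rw [pairSeries_apply, oppSeries_apply, coeff_oneW, coeff_oneW]
    split_ifs <;> simp
  have hright : ∀ a : E W, pairSeries a (oneW W) = oppSeries (oneW W) a := by
    intro a
    ext w k
    rw [pairSeries_apply, oppSeries_apply, coeff_oneW, coeff_oneW]
    split_ifs <;> simp
  intro a ha b hb
  rcases ha with ha | rfl
  · rcases hb with hb | rfl
    · exact ExchangesPair.mono Set.subset_union_left Set.subset_union_left (h a ha b hb)
    · exact key _ _ (Or.inl ha) (Or.inr rfl) (hright a)
  · exact key _ _ (Or.inr rfl) hb (hleft b)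

/-- The products `a(x)ₙ b(x)` of elements of `U`. -/
def productSet (U : Set (E W)) : Set (E W) :=
  {d | ∃ a ∈ U, ∃ b ∈ U, ∃ p : MvPolynomial (Fin 2) ℂ, p ≠ 0 ∧ ∃ (h : Clears p a b) (n : ℤ),
    d = nthProduct p a b h n}

/-- Products are first allowed on the left, with the right operator still in `U`. This enlarged
relation is then fed into the right-hand case. Only `U` itself has to be quasi compatible, which
follows from its exchange relations. -/
theorem Exchanges.union_productSet {U : Set (E W)} (h : Exchanges K U U) :
    Exchanges K (U ∪ productSet U) (U ∪ productSet U) := by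
  have hU := h.hasExchange.isQuasiCompatible
  have hU' : ∀ a ∈ U, ∀ b ∈ U, ∀ p : MvPolynomial (Fin 2) ℂ, p ≠ 0 → ∀ (h : Clears p a b) n,
      nthProduct p a b h n ∈ U ∪ productSet U := fun a ha b hb p hp h n =>
    Or.inr ⟨a, ha, b, hb, p, hp, h, n, rfl⟩
  have h1 : Exchanges K (U ∪ productSet U) U := by
    rintro d (hd | ⟨a, ha, b, hb, p, hp, hc, n, rfl⟩) c hc'
    · exact ExchangesPair.mono Set.subset_union_left subset_rfl (h d hd c hc')
    · exact h.nthProduct_left hU hU' ha hb hc' hp hc n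
  rintro c hc' d (hd | ⟨a, ha, b, hb, p, hp, hc, n, rfl⟩)
  · exact ExchangesPair.mono subset_rfl Set.subset_union_left (h1 c hc' d hd)
  · exact h1.nthProduct_right hU hU' ha hb hc' hp hc n

/-- The subspaces obtained from `S` by repeatedly adjoining all products `a(x)ₙ b(x)`. -/
def iteratedProducts (S : Set (E W)) : ℕ → Submodule ℂ (E W)
  | 0 => Submodule.span ℂ (S ∪ {oneW W})
  | n + 1 => Submodule.span ℂ (iteratedProducts S n ∪ productSet (iteratedProducts S n))

theorem iteratedProducts_mono (S : Set (E W)) : Monotone (iteratedProducts S) :=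
  monotone_nat_of_le_succ fun n => by
    intro a ha
    exact Submodule.subset_span (Or.inl ha)

theorem Exchanges.iteratedProducts {S : Set (E W)} (h : Exchanges K S S) (n : ℕ) :
    Exchanges K (iteratedProducts S n : Set (E W)) (iteratedProducts S n) := by
  induction n with
  | zero => exact h.insert_oneW.span
  | succ n ih => exact ih.union_productSet.span

theorem mem_iSup_iteratedProducts {S : Set (E W)} {a : E W} :
    a ∈ ⨆ n, iteratedProducts S n ↔ ∃ n, a ∈ iteratedProducts S n :=
  Submodule.mem_iSup_of_directed _ (iteratedProducts_mono S).directed_le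

theorem exists_mem_iteratedProducts {S : Set (E W)} {a b : E W}
    (ha : a ∈ ⨆ n, iteratedProducts S n) (hb : b ∈ ⨆ n, iteratedProducts S n) :
    ∃ n, a ∈ iteratedProducts S n ∧ b ∈ iteratedProducts S n := by
  obtain ⟨n, hn⟩ := mem_iSup_iteratedProducts.1 ha
  obtain ⟨m, hm⟩ := mem_iSup_iteratedProducts.1 hb
  exact ⟨max n m, iteratedProducts_mono S (le_max_left n m) hn,
    iteratedProducts_mono S (le_max_right n m) hm⟩

theorem Exchanges.iSup_iteratedProducts {S : Set (E W)} (h : Exchanges K S S) :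
    Exchanges K ((⨆ n, FormalCalculus.iteratedProducts S n : Submodule ℂ (E W)) : Set (E W))
      (⨆ n, FormalCalculus.iteratedProducts S n : Submodule ℂ (E W)) := by
  intro a ha b hb
  obtain ⟨n, ha, hb⟩ := exists_mem_iteratedProducts ha hb
  have hle : (FormalCalculus.iteratedProducts S n : Set (E W)) ⊆
      (⨆ n, FormalCalculus.iteratedProducts S n : Submodule ℂ (E W)) :=
    le_iSup (FormalCalculus.iteratedProducts S) n
  exact ExchangesPair.mono hle hle (h.iteratedProducts n a ha b hb)

/-- The closed subspace generated by a set with exchange relations. -/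
theorem Exchanges.isLeast_generated {S : Set (E W)} (h : Exchanges K S S) :
    IsLeast (closedSubspacesContaining S) (generated S) ∧
      Exchanges K (generated S : Set (E W)) (generated S) := by
  have h' := h.iSup_iteratedProducts
  have hmem : (⨆ n, FormalCalculus.iteratedProducts S n) ∈ closedSubspacesContaining S := by
    refine ⟨h'.hasExchange.isQuasiCompatible, fun a ha b hb p hp hc n => ?_, ?_⟩
    · obtain ⟨m, ha, hb⟩ := exists_mem_iteratedProducts ha hb
      exact mem_iSup_iteratedProducts.2 ⟨m + 1,
        Submodule.subset_span (Or.inr ⟨a, ha, b, hb, p, hp, hc, n, rfl⟩)⟩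
    · exact fun a ha => mem_iSup_iteratedProducts.2 ⟨0, Submodule.subset_span ha⟩
  have hle : ∀ U ∈ closedSubspacesContaining S,
      (⨆ n, FormalCalculus.iteratedProducts S n) ≤ U := by
    rintro U ⟨-, hU, hS⟩
    refine iSup_le fun n => ?_
    induction n with
    | zero => exact Submodule.span_le.2 hS
    | succ n ih =>
      refine Submodule.span_le.2 (Set.union_subset ih ?_)
      rintro d ⟨a, ha, b, hb, p, hp, hc, n, rfl⟩
      exact hU a (ih ha) b (ih hb) p hp hc n
  have e : generated S = ⨆ n, FormalCalculus.iteratedProducts S n :=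
    le_antisymm (sInf_le hmem) (le_sInf hle)
  rw [e]
  exact ⟨⟨hmem, fun U hU => hle U hU⟩, h'⟩

end Closure

/-! ### Expansions and passage from Laurent polynomials to polynomials -/

section Expansions

variable {W : Type*} [AddCommGroup W] [Module ℂ W]

theorem toSmall_oppositeProd (u v : E W) (w : W) :
    toSmall (oppositeProd u v w) = oppSeries u v w := by
  ext k
  rw [oppSeries_apply]
  rfl

theorem iota_algebraMap (f : MvPowerSeries (Fin 2) ℂ) :
    iota (algebraMap (MvPowerSeries (Fin 2) ℂ) CStar f) = expandPS f :=
  IsLocalization.lift_eq _ f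

theorem laurentMul_toLaurent_pair (p : MvPolynomial (Fin 2) ℂ) (a b : E W) (w : W)
    (k : Fin 2 → ℤ) : laurentMul (toLaurent p) (opProd ![a, b]) k w =
      ((p : MvPowerSeries (Fin 2) ℂ) • pairSeries a b w) k :=
  (smul_apply_eq_laurentMul p (opProd ![a, b]) w _ (fun k => opProd_pair a b k w) k).symm

theorem coeff_toLaurent {σ : Type*} [Fintype σ] [DecidableEq σ] (p : MvPolynomial σ ℂ)
    (m : σ →₀ ℕ) : (toLaurent p).coeff (fun s => (m s : ℤ)) = p.coeff m := by
  induction p using MvPolynomial.induction_on' with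
  | monomial n c =>
    rw [toLaurent_monomial, MvPolynomial.coeff_monomial]
    have : (fun s => (n s : ℤ)) = (fun s => (m s : ℤ)) ↔ n = m := by
      rw [funext_iff, Finsupp.ext_iff]
      simp
    simp [AddMonoidAlgebra.coeff_single, Finsupp.single_apply, this]
  | add p q hp hq => simp [hp, hq]

theorem toLaurent_ne_zero {σ : Type*} [Fintype σ] [DecidableEq σ] {p : MvPolynomial σ ℂ}
    (hp : p ≠ 0) : toLaurent p ≠ 0 := by
  intro h
  apply hp
  ext m
  rw [← coeff_toLaurent, h]
  simp

theorem laurentMul_monomial_mul {σ : Type*} [Fintype σ] [DecidableEq σ] (m : σ →₀ ℕ)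
    (p : LaurentPoly σ) (F : OpSeries σ W) (k : σ → ℤ) :
    laurentMul (toLaurent (MvPolynomial.monomial m 1) * p) F k =
      laurentMul p F (fun s => k s - m s) := by
  induction p using AddMonoidAlgebra.induction_linear with
  | zero => simp [laurentMul]
  | add p q hp hq =>
    rw [mul_add, laurentMul_add, laurentMul_add, Pi.add_apply, Pi.add_apply, hp, hq]
  | single n c =>
    rw [toLaurent_monomial, AddMonoidAlgebra.single_mul_single, one_mul, laurentMul_single,
      laurentMul_single]
    congr 2
    ext s
    simp
    ring

/-- Every Laurent polynomial becomes a polynomial after multiplication by a monomial. -/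
theorem exists_toLaurent_eq {σ : Type*} [Fintype σ] [DecidableEq σ] (p : LaurentPoly σ) :
    ∃ (m : σ →₀ ℕ) (q : MvPolynomial σ ℂ),
      toLaurent q = toLaurent (MvPolynomial.monomial m 1) * p := by
  induction p using AddMonoidAlgebra.induction_linear with
  | zero => exact ⟨0, 0, by simp⟩
  | add p q hp hq =>
    obtain ⟨m, P, hP⟩ := hp
    obtain ⟨m', P', hP'⟩ := hq
    refine ⟨m + m', MvPolynomial.monomial m' 1 * P + MvPolynomial.monomial m 1 * P', ?_⟩
    have e : (MvPolynomial.monomial (m + m') 1 : MvPolynomial σ ℂ) =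
        MvPolynomial.monomial m 1 * MvPolynomial.monomial m' 1 := by
      rw [MvPolynomial.monomial_mul, one_mul]
    rw [map_add, map_mul, map_mul, hP, hP', e, map_mul]
    ring
  | single n c =>
    refine ⟨Finsupp.equivFunOnFinite.symm fun s => (-n s).toNat,
      MvPolynomial.monomial (Finsupp.equivFunOnFinite.symm fun s => (n s).toNat) c, ?_⟩
    rw [toLaurent_monomial, toLaurent_monomial, AddMonoidAlgebra.single_mul_single, one_mul]
    congr 1
    ext s
    simp only [Finsupp.equivFunOnFinite_symm_apply_apply, Pi.add_apply]
    omega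

end Expansions

/-! ### Pseudo-locality as exchange relations -/

section PseudoLocality

variable {W : Type*} [AddCommGroup W] [Module ℂ W]

/-- The exchange relations of pseudo-local sets. -/
def pseudoKind : ExchangeKind where
  denoms := nonzeroPolys
  scalars := ⊤
  exists_poly := by
    rintro _ ⟨p, hp, rfl⟩
    exact ⟨p, nonZeroDivisors.ne_zero hp, rfl⟩
  le _ _ := Algebra.mem_top
  hasse_mem _ _ _ _ := Algebra.mem_top

theorem coe_mem_nonzeroPolys {p : MvPolynomial (Fin 2) ℂ} (hp : p ≠ 0) :
    (p : MvPowerSeries (Fin 2) ℂ) ∈ nonzeroPolys :=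
  ⟨p, mem_nonZeroDivisors_of_ne_zero hp, rfl⟩

theorem Exchanges.isPseudoLocal {U : Set (E W)} (h : Exchanges pseudoKind U U) :
    IsPseudoLocal U := by
  intro a ha b hb
  obtain ⟨p, hp, n, f, u, v, huv, h⟩ := h.hasExchange a ha b hb
  refine ⟨toLaurent p, toLaurent_ne_zero hp, n,
    fun l => algebraMap (MvPowerSeries (Fin 2) ℂ) CStar (f l), u, v, huv, fun w i j => ?_⟩
  have e : coeff₂ (∑ l, iota (algebraMap (MvPowerSeries (Fin 2) ℂ) CStar (f l)) •
      oppositeProd (u l) (v l) w) i j = toSmall (∑ l, iota (algebraMap (MvPowerSeries (Fin 2) ℂ)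
        CStar (f l)) • oppositeProd (u l) (v l) w) ![i, j] := rfl
  rw [laurentMul_toLaurent_pair, h, e, map_sum]
  simp only [iota_algebraMap, toSmall_smul, toSmall_oppositeProd]

/-- A monomial clears the negative exponents of `p`, and a common denominator in `nonzeroPolys`
turns the finitely many `q_l` into power series. -/
theorem IsPseudoLocal.exchanges {U : Set (E W)} (h : IsPseudoLocal U) :
    Exchanges pseudoKind U U := by
  intro a ha b hb
  obtain ⟨p, hp, r, q, u, v, huv, h⟩ := h a ha b hb
  obtain ⟨m, P, hP⟩ := exists_toLaurent_eq p
  obtain ⟨s, hs⟩ := IsLocalization.exist_integer_multiples_of_finite nonzeroPolys q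
  choose f hf using hs
  -- Monomials are units among the Laurent polynomials, so `P = 0` would force `p = 0`.
  have hP0 : P ≠ 0 := by
    rintro rfl
    rw [map_zero, eq_comm] at hP
    apply hp
    have e : AddMonoidAlgebra.single (fun s => -(m s : ℤ)) (1 : ℂ) *
        toLaurent (MvPolynomial.monomial m 1) = (1 : LaurentPoly (Fin 2)) := by
      rw [toLaurent_monomial, AddMonoidAlgebra.single_mul_single, one_mul,
        AddMonoidAlgebra.one_def]
      congr 1
      ext i
      simp
    rw [← one_mul p, ← e, mul_assoc, hP, mul_zero]
  refine ⟨s * (P : MvPowerSeries (Fin 2) ℂ),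
    nonzeroPolys.mul_mem s.2 (coe_mem_nonzeroPolys hP0), mem_oppSpan_iff.2
      ⟨r, fun l => MvPowerSeries.monomial m 1 * f l, u, v, fun l => ⟨Algebra.mem_top, huv l⟩,
        fun w => ?_⟩⟩
  have h1 : (P : MvPowerSeries (Fin 2) ℂ) • pairSeries a b w =
      (MvPowerSeries.monomial m 1 : MvPowerSeries (Fin 2) ℂ) •
        toSmall (∑ l, iota (q l) • oppositeProd (u l) (v l) w) := by
    ext k
    rw [← laurentMul_toLaurent_pair, hP, laurentMul_monomial_mul,
      SmallSeries.monomial_smul_apply, one_smul, toSmall_apply, ← h]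
    congr 2
    ext i
    fin_cases i <;> rfl
  have h2 : ∀ l, expandPS (s : MvPowerSeries (Fin 2) ℂ) * iota (q l) = expandPS (f l) := by
    intro l
    rw [← iota_algebraMap, ← iota_algebraMap, hf l, ← map_mul, Algebra.smul_def]
  rw [mul_smul, h1, smul_comm, ← toSmall_smul, Finset.smul_sum, map_sum, Finset.smul_sum]
  refine Finset.sum_congr rfl fun l _ => ?_
  rw [smul_smul, h2, toSmall_smul, toSmall_oppositeProd, smul_smul]

end PseudoLocality

/-! ### Power series in `y - x` -/

section DifferenceSeries

/-- The power series `φ(y - x)`, for `φ(z) = ∑ φ_n z ^ n`. -/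
def diffSeries (φ : ℕ → ℂ) : MvPowerSeries (Fin 2) ℂ :=
  fun m => (-1) ^ m 0 * ((m 0 + m 1).choose (m 0) : ℂ) * φ (m 0 + m 1)

theorem coeff_diffSeries (φ : ℕ → ℂ) (m : Fin 2 →₀ ℕ) : MvPowerSeries.coeff m (diffSeries φ) =
    (-1) ^ m 0 * ((m 0 + m 1).choose (m 0) : ℂ) * φ (m 0 + m 1) := rfl

/-- The derivation `∂_x + ∂_y`. -/
def sumDeriv : Derivation ℂ (MvPowerSeries (Fin 2) ℂ) (MvPowerSeries (Fin 2) ℂ) :=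
  MvPowerSeries.pderiv ℂ 0 + MvPowerSeries.pderiv ℂ 1

/-- Power series in `y - x` are treated as the kernel of `∂_x + ∂_y`: the Leibniz rule gives closure
under products, and this recurrence makes membership a matter of coefficients. -/
theorem sumDeriv_eq_zero_iff {f : MvPowerSeries (Fin 2) ℂ} : sumDeriv f = 0 ↔
    ∀ m : Fin 2 →₀ ℕ, ((m 0 : ℂ) + 1) * MvPowerSeries.coeff (m + Finsupp.single 0 1) f +
      ((m 1 : ℂ) + 1) * MvPowerSeries.coeff (m + Finsupp.single 1 1) f = 0 := by
  rw [MvPowerSeries.ext_iff]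
  refine forall_congr' fun m => ?_
  rw [sumDeriv, Derivation.add_apply, map_add, MvPowerSeries.coeff_pderiv,
    MvPowerSeries.coeff_pderiv, map_zero (MvPowerSeries.coeff m), mul_comm,
    mul_comm (MvPowerSeries.coeff _ f)]

/-- The power series in `y - x`. -/
def diffScalars : Subalgebra ℂ (MvPowerSeries (Fin 2) ℂ) where
  carrier := {f | sumDeriv f = 0}
  mul_mem' {f g} hf hg := by
    rw [Set.mem_ofPred_eq] at *
    rw [Derivation.leibniz, hf, hg, smul_zero, smul_zero, add_zero]
  add_mem' {f g} hf hg := by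
    rw [Set.mem_ofPred_eq] at *
    rw [map_add, hf, hg, add_zero]
  algebraMap_mem' r := Derivation.map_algebraMap _ r

theorem mem_diffScalars {f : MvPowerSeries (Fin 2) ℂ} : f ∈ diffScalars ↔ sumDeriv f = 0 := Iff.rfl

/-- Divided derivatives commute with `∂_x + ∂_y`. On coefficients, the recurrence at `m` is a
multiple of the one for `f` at the exponent raised by `t` in direction `i`. -/
theorem hasse_mem_diffScalars (i : Fin 2) (t : ℕ) (f : MvPowerSeries (Fin 2) ℂ)
    (hf : f ∈ diffScalars) : hasse i t f ∈ diffScalars := by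
  rw [mem_diffScalars, sumDeriv_eq_zero_iff] at *
  intro m
  have h := hf (m + Finsupp.single i t)
  have key : ∀ n : ℕ, ((n : ℂ) + 1) * ((n + 1 + t).choose t : ℂ) =
      ((n + t).choose t : ℂ) * (n + t + 1) := by
    intro n
    have := Nat.choose_mul_succ_eq (n + t) t
    have e1 : n + t + 1 - t = n + 1 := by omega
    have e2 : n + t + 1 = n + 1 + t := by omega
    rw [e1, e2] at this
    have h2 : (((n + t).choose t * (n + 1 + t) : ℕ) : ℂ) =
      (((n + 1 + t).choose t * (n + 1) : ℕ) : ℂ) := congrArg _ this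
    push_cast at h2
    linear_combination -h2
  simp only [coeff_hasse]
  fin_cases i
  · simp only [Fin.zero_eta, Finsupp.add_apply, Finsupp.single_eq_same, ne_eq, zero_ne_one,
      one_ne_zero, not_false_eq_true, Finsupp.single_eq_of_ne, add_zero, Nat.cast_add] at h ⊢
    rw [add_right_comm m, add_right_comm m (Finsupp.single 1 1), ← mul_assoc, key]
    linear_combination ((m 0 + t).choose t : ℂ) * h
  · simp only [Fin.mk_one, Finsupp.add_apply, Finsupp.single_eq_same, ne_eq, zero_ne_one,
      one_ne_zero, not_false_eq_true, Finsupp.single_eq_of_ne, add_zero, Nat.cast_add] at h ⊢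
    rw [add_right_comm m, add_right_comm m (Finsupp.single 1 1),
      ← mul_assoc _ _ (MvPowerSeries.coeff (m + Finsupp.single 1 t + Finsupp.single 1 1) f), key]
    linear_combination ((m 1 + t).choose t : ℂ) * h

theorem diffSeries_mem_diffScalars (φ : ℕ → ℂ) : diffSeries φ ∈ diffScalars := by
  rw [mem_diffScalars, sumDeriv_eq_zero_iff]
  intro m
  simp only [coeff_diffSeries, Finsupp.add_apply, Finsupp.single_eq_same, ne_eq, zero_ne_one,
      one_ne_zero, not_false_eq_true, Finsupp.single_eq_of_ne, add_zero]
  have h := Nat.choose_succ_right_eq (m 0 + m 1 + 1) (m 0)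
  have e : m 0 + m 1 + 1 - m 0 = m 1 + 1 := by omega
  have e1 : m 0 + 1 + m 1 = m 0 + m 1 + 1 := by omega
  have e2 : m 0 + (m 1 + 1) = m 0 + m 1 + 1 := by omega
  rw [e] at h
  have h2 : (((m 0 + m 1 + 1).choose (m 0 + 1) * (m 0 + 1) : ℕ) : ℂ) =
      (((m 0 + m 1 + 1).choose (m 0) * (m 1 + 1) : ℕ) : ℂ) := congrArg _ h
  push_cast at h2
  rw [e1, e2, pow_succ]
  linear_combination (-(-1) ^ m 0 * φ (m 0 + m 1 + 1)) * h2

/-- The recurrence lowers the exponent of `x` while raising that of `y`, so the coefficients of the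
pure powers of `y` determine `f`; they are the coefficients of `φ`. -/
theorem exists_eq_diffSeries {f : MvPowerSeries (Fin 2) ℂ} (hf : f ∈ diffScalars) :
    ∃ φ, f = diffSeries φ := by
  rw [mem_diffScalars, sumDeriv_eq_zero_iff] at hf
  refine ⟨fun n => MvPowerSeries.coeff (Finsupp.single 1 n) f, ?_⟩
  suffices h : ∀ i j : ℕ, MvPowerSeries.coeff (Finsupp.single 0 i + Finsupp.single 1 j) f =
      (-1) ^ i * ((i + j).choose i : ℂ) * MvPowerSeries.coeff (Finsupp.single 1 (i + j)) f by
    ext m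
    rw [coeff_diffSeries, ← h]
    congr 2
    ext s
    fin_cases s <;> simp
  intro i
  induction i with
  | zero => simp
  | succ i ih =>
    intro j
    have h1 := hf (Finsupp.single 0 i + Finsupp.single 1 j)
    have e1 : (Finsupp.single 0 i + Finsupp.single 1 j + Finsupp.single 0 1 : Fin 2 →₀ ℕ) =
        Finsupp.single 0 (i + 1) + Finsupp.single 1 j := by
      rw [add_right_comm, ← Finsupp.single_add]
    have e2 : (Finsupp.single 0 i + Finsupp.single 1 j + Finsupp.single 1 1 : Fin 2 →₀ ℕ) =
        Finsupp.single 0 i + Finsupp.single 1 (j + 1) := by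
      rw [add_assoc, ← Finsupp.single_add]
    rw [e1, e2, ih] at h1
    simp only [Finsupp.add_apply, Finsupp.single_eq_same, ne_eq, zero_ne_one,
      one_ne_zero, not_false_eq_true, Finsupp.single_eq_of_ne, add_zero, zero_add] at h1
    have h := Nat.choose_succ_right_eq (i + j + 1) i
    have e : i + j + 1 - i = j + 1 := by omega
    have e3 : i + 1 + j = i + j + 1 := by omega
    have e4 : i + (j + 1) = i + j + 1 := by omega
    rw [e] at h
    have h2 : (((i + j + 1).choose (i + 1) * (i + 1) : ℕ) : ℂ) =
        (((i + j + 1).choose i * (j + 1) : ℕ) : ℂ) := congrArg _ h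
    push_cast at h2
    rw [e4] at h1
    rw [e3, pow_succ]
    have hne : (i : ℂ) + 1 ≠ 0 := by exact_mod_cast Nat.succ_ne_zero i
    apply mul_left_cancel₀ hne
    linear_combination h1 +
      ((-1) ^ i * MvPowerSeries.coeff (Finsupp.single 1 (i + j + 1)) f) * h2

end DifferenceSeries

/-! ### The expansion of `ψ(x₂ - x₁)` -/

section ExpandDiff

theorem iterLaurent_ext {x y : IterLaurent} (h : ∀ i j, x.coeff₂ i j = y.coeff₂ i j) : x = y := by
  apply IterLaurent.equiv.symm.injective
  ext i j
  exact h i j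

theorem coeff₂_expandDiff (ψ : LaurentSeries ℂ) (i j : ℤ) : (expandDiff ψ).coeff₂ i j =
    if 0 ≤ i then (-1 : ℂ) ^ i.toNat * (Ring.choose (i + j) i.toNat : ℤ) * ψ.coeff (i + j)
    else 0 := by
  by_cases h : 0 ≤ i
  · rw [if_pos h]
    exact if_pos h
  · rw [if_neg h]
    exact if_neg h

theorem coeff₂_single_mul (a b : ℤ) (x : IterLaurent) (i j : ℤ) :
    (IterLaurent.equiv (HahnSeries.single a (HahnSeries.single b 1)) * x).coeff₂ i j =
      x.coeff₂ (i - a) (j - b) := by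
  set y := IterLaurent.equiv.symm x with hy
  have h : (IterLaurent.equiv (HahnSeries.single a (HahnSeries.single b 1)) * x).coeff₂ i j =
    ((HahnSeries.single a (HahnSeries.single b (1 : ℂ)) * y).coeff i).coeff j := by
    rfl
  have h' : x.coeff₂ (i - a) (j - b) = (y.coeff (i - a)).coeff (j - b) := rfl
  obtain ⟨i, rfl⟩ : ∃ i', i = i' + a := ⟨i - a, by ring⟩
  obtain ⟨j, rfl⟩ : ∃ j', j = j' + b := ⟨j - b, by ring⟩
  rw [h, h', HahnSeries.coeff_single_mul_add, HahnSeries.coeff_single_mul_add, one_mul,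
    add_sub_cancel_right, add_sub_cancel_right]

theorem expandPS_X_zero : expandPS (MvPowerSeries.X 0) =
    IterLaurent.equiv (HahnSeries.single 1 (HahnSeries.single 0 1)) := by
  apply iterLaurent_ext
  intro i j
  have h := coeff₂_single_mul 1 0 1 i j
  rw [mul_one] at h
  rw [h, ← map_one expandPS, expandPS_coeff₂, expandPS_coeff₂, intCoeff_one, MvPowerSeries.X,
    intCoeff_monomial]
  congr 1
  simp only [funext_iff, Fin.forall_fin_two]
  simp
  omega

theorem expandPS_X_one : expandPS (MvPowerSeries.X 1) =
    IterLaurent.equiv (HahnSeries.single 0 (HahnSeries.single 1 1)) := by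
  apply iterLaurent_ext
  intro i j
  have h := coeff₂_single_mul 0 1 1 i j
  rw [mul_one] at h
  rw [h, ← map_one expandPS, expandPS_coeff₂, expandPS_coeff₂, intCoeff_one, MvPowerSeries.X,
    intCoeff_monomial]
  congr 1
  simp only [funext_iff, Fin.forall_fin_two]
  simp
  omega

/-- With `z = y - x`, the factor `x - y` is `-z`, hence the multiplier `single 1 (-1)`. On
coefficients this is Pascal's rule. -/
theorem expandPS_sub_mul_expandDiff (ψ : LaurentSeries ℂ) :
    expandPS (MvPowerSeries.X 0 - MvPowerSeries.X 1) * expandDiff ψ =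
      expandDiff (HahnSeries.single 1 (-1) * ψ) := by
  apply iterLaurent_ext
  intro i j
  have hsub : ∀ x y : IterLaurent, (x - y).coeff₂ i j = x.coeff₂ i j - y.coeff₂ i j :=
    fun _ _ => rfl
  have hz : (HahnSeries.single 1 (-1) * ψ : LaurentSeries ℂ).coeff (i + j) =
      -ψ.coeff (i + j - 1) := by
    have := HahnSeries.coeff_single_mul_add (r := (-1 : ℂ)) (x := ψ) (a := i + j - 1) (b := 1)
    rw [sub_add_cancel] at this
    rw [this, neg_one_mul]
  rw [map_sub, sub_mul, hsub, expandPS_X_zero, expandPS_X_one, coeff₂_single_mul,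
    coeff₂_single_mul]
  simp only [coeff₂_expandDiff, sub_zero, hz]
  have e1 : i - 1 + j = i + j - 1 := by ring
  have e2 : i + (j - 1) = i + j - 1 := by ring
  rw [e1, e2]
  rcases lt_trichotomy i 0 with h | rfl | h
  · rw [if_neg (by omega), if_neg (by omega), if_neg (by omega), sub_zero]
  · rw [if_neg (by omega), if_pos le_rfl, if_pos le_rfl]
    simp
  · obtain ⟨n, rfl⟩ : ∃ n : ℕ, i = n + 1 := ⟨(i - 1).toNat, by omega⟩
    rw [if_pos (by omega), if_pos (by omega), if_pos (by omega)]
    have h1 : ((n : ℤ) + 1 - 1).toNat = n := by omega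
    have h2 : ((n : ℤ) + 1).toNat = n + 1 := by omega
    rw [h1, h2]
    have h3 := Ring.choose_succ_succ ((n : ℤ) + 1 + j - 1) n
    rw [sub_add_cancel] at h3
    rw [h3, pow_succ]
    push_cast
    ring

theorem expandPS_sub_pow_mul_expandDiff (k : ℕ) (ψ : LaurentSeries ℂ) :
    expandPS (MvPowerSeries.X 0 - MvPowerSeries.X 1) ^ k * expandDiff ψ =
      expandDiff (HahnSeries.single 1 (-1) ^ k * ψ) := by
  induction k generalizing ψ with
  | zero => rw [pow_zero, pow_zero, one_mul, one_mul]
  | succ k ih => rw [pow_succ, mul_assoc, expandPS_sub_mul_expandDiff, ih, pow_succ, mul_assoc]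

theorem expandDiff_ofPowerSeries (φ : PowerSeries ℂ) :
    expandDiff (HahnSeries.ofPowerSeries ℤ ℂ φ) =
      expandPS (diffSeries fun n => PowerSeries.coeff n φ) := by
  apply iterLaurent_ext
  intro i j
  rw [coeff₂_expandDiff, expandPS_coeff₂]
  by_cases hi : 0 ≤ i
  · rw [if_pos hi]
    obtain ⟨n, rfl⟩ := Int.eq_ofNat_of_zero_le hi
    by_cases hj : 0 ≤ j
    · obtain ⟨m, rfl⟩ := Int.eq_ofNat_of_zero_le hj
      have e : (![(n : ℤ), (m : ℤ)] : Fin 2 → ℤ) =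
          fun s => ((Finsupp.equivFunOnFinite.symm ![n, m] s : ℕ) : ℤ) := by
        ext s
        fin_cases s <;> rfl
      rw [e, intCoeff_natCast, coeff_diffSeries, ofPowerSeries_coeff, ← Nat.cast_add,
        if_pos (by positivity), Int.toNat_natCast, Int.toNat_natCast, Ring.choose_natCast]
      simp
    · rw [intCoeff_of_not_nonneg _ (fun h => hj (h 1)), ofPowerSeries_coeff]
      split_ifs with h
      -- Here `j < 0 ≤ i + j`, so `i + j < i` and the binomial coefficient vanishes: no negative
      -- power of `y` occurs.
      · obtain ⟨m, hm⟩ := Int.eq_ofNat_of_zero_le h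
        rw [hm, Int.toNat_natCast, Ring.choose_natCast, Nat.choose_eq_zero_of_lt (by omega)]
        simp
      · rw [mul_zero]
  · rw [if_neg hi, intCoeff_of_not_nonneg _ (fun h => hi (h 0))]

theorem single_one_ne_zero : (HahnSeries.single 1 (-1) : LaurentSeries ℂ) ≠ 0 := by
  simp

/-- Laurent series become power series after multiplication by a power of the variable. -/
theorem exists_pow_mul_eq_ofPowerSeries (ψ : LaurentSeries ℂ) :
    ∃ n : ℕ, ∀ m, n ≤ m → ∃ φ : PowerSeries ℂ,
      (HahnSeries.single 1 (-1) : LaurentSeries ℂ) ^ m * ψ = HahnSeries.ofPowerSeries ℤ ℂ φ := by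
  obtain ⟨N, hN⟩ := hahnSeries_bddBelow ψ
  refine ⟨(-N).toNat, fun m hm => ⟨PowerSeries.mk fun n =>
    (-1) ^ m * ψ.coeff ((n : ℤ) - m), ?_⟩⟩
  ext i
  rw [HahnSeries.single_pow, ofPowerSeries_coeff]
  have h := HahnSeries.coeff_single_mul_add (r := (-1 : ℂ) ^ m) (x := ψ) (a := i - m)
    (b := m • (1 : ℤ))
  have e : i - m + m • (1 : ℤ) = i := by simp
  rw [e] at h
  rw [h]
  split_ifs with hi
  · rw [PowerSeries.coeff_mk, Int.toNat_of_nonneg hi]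
  · have : ψ.coeff (i - m) = 0 := by
      by_contra h0
      have := hN _ h0
      omega
    rw [this, mul_zero]

end ExpandDiff

/-! ### `𝒮`-locality as exchange relations -/

section SLocality

variable {W : Type*} [AddCommGroup W] [Module ℂ W]

/-- The polynomial `x - y`. -/
def diffPoly : MvPolynomial (Fin 2) ℂ := MvPolynomial.X 0 - MvPolynomial.X 1

theorem coe_diffPoly :
    (diffPoly : MvPowerSeries (Fin 2) ℂ) = MvPowerSeries.X 0 - MvPowerSeries.X 1 := by
  have h := MvPolynomial.coe_add (diffPoly) (MvPolynomial.X 1 : MvPolynomial (Fin 2) ℂ)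
  rw [diffPoly, sub_add_cancel, MvPolynomial.coe_X, MvPolynomial.coe_X] at h
  exact eq_sub_of_add_eq h.symm

theorem diffPoly_ne_zero : diffPoly ≠ 0 := by
  intro h
  have := congrArg (MvPolynomial.eval ![1, 0]) h
  simp [diffPoly] at this

theorem diffPoly_mem_diffScalars : (diffPoly : MvPowerSeries (Fin 2) ℂ) ∈ diffScalars := by
  rw [mem_diffScalars, coe_diffPoly, map_sub, sumDeriv]
  simp [MvPowerSeries.pderiv_X]

/-- The exchange relations of `𝒮`-local sets. -/
def localKind : ExchangeKind where
  denoms := Submonoid.powers (diffPoly : MvPowerSeries (Fin 2) ℂ)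
  scalars := diffScalars
  exists_poly := by
    rintro _ ⟨k, rfl⟩
    exact ⟨diffPoly ^ k, pow_ne_zero k diffPoly_ne_zero, (MvPolynomial.coe_pow _).symm⟩
  le := by
    rintro _ ⟨k, rfl⟩
    exact diffScalars.pow_mem diffPoly_mem_diffScalars k
  hasse_mem := hasse_mem_diffScalars

theorem coeff₂_sum_smul_oppositeProd {r : ℕ} (x : Fin r → IterLaurent) (u v : Fin r → E W) (w : W)
    (i j : ℤ) : coeff₂ (∑ l, x l • oppositeProd (u l) (v l) w) i j =
      toSmall (∑ l, x l • oppositeProd (u l) (v l) w) ![i, j] := rfl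

theorem Exchanges.isSLocal {U : Set (E W)} (h : Exchanges localKind U U) : IsSLocal U := by
  intro a ha b hb
  obtain ⟨_, ⟨k, rfl⟩, h⟩ := h a ha b hb
  obtain ⟨n, f, u, v, huv, h⟩ := mem_oppSpan_iff.1 h
  choose φ hφ using fun l => exists_eq_diffSeries (huv l).1
  set z : LaurentSeries ℂ := HahnSeries.single 1 (-1) with hz
  -- The definition multiplies the right side by `(x₁ - x₂) ^ k`, which acts on Laurent series as `z
  -- ^ k`. Dividing by it in advance recovers the power series `f l`.
  refine ⟨k, n, fun l => (z ^ k)⁻¹ * HahnSeries.ofPowerSeries ℤ ℂ (PowerSeries.mk (φ l)), u, v,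
    fun l => (huv l).2, fun w i j => ?_⟩
  have e : ∀ l, expandPS (MvPowerSeries.X 0 - MvPowerSeries.X 1) ^ k *
      expandDiff ((z ^ k)⁻¹ * HahnSeries.ofPowerSeries ℤ ℂ (PowerSeries.mk (φ l))) =
        expandPS (f l) := by
    intro l
    rw [expandPS_sub_pow_mul_expandDiff, ← hz,
      mul_inv_cancel_left₀ (pow_ne_zero k single_one_ne_zero), expandDiff_ofPowerSeries, hφ l]
    simp only [PowerSeries.coeff_mk]
  rw [coeff₂_sum_smul_oppositeProd, map_sum]
  simp only [e, toSmall_smul, toSmall_oppositeProd]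
  rw [laurentMul_toLaurent_pair, MvPolynomial.coe_pow]
  exact DFunLike.congr_fun (h w) _

theorem IsSLocal.exchanges {U : Set (E W)} (h : IsSLocal U) : Exchanges localKind U U := by
  intro a ha b hb
  obtain ⟨k, r, ψ, u, v, huv, h⟩ := h a ha b hb
  choose N hN using fun l => exists_pow_mul_eq_ofPowerSeries (ψ l)
  obtain ⟨M, hM⟩ := (Set.finite_range N).bddAbove
  choose φ hφ using fun l => hN l M (hM ⟨l, rfl⟩)
  set δ : MvPowerSeries (Fin 2) ℂ := (diffPoly : MvPowerSeries (Fin 2) ℂ) with hδ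
  have hδmem : ∀ n, δ ^ n ∈ diffScalars := fun n => diffScalars.pow_mem diffPoly_mem_diffScalars n
  -- The power `k` comes from the given relation, and the further power `M` removes the poles of all
  -- `ψ_l` at once.
  refine ⟨δ ^ (M + k), ⟨M + k, rfl⟩, mem_oppSpan_iff.2 ⟨r, fun l =>
    δ ^ k * diffSeries fun n => PowerSeries.coeff n (φ l), u, v, fun l =>
      ⟨diffScalars.mul_mem (hδmem k) (diffSeries_mem_diffScalars _), huv l⟩, fun w => ?_⟩⟩
  have h1 : δ ^ k • pairSeries a b w = toSmall (∑ l, (expandPS (MvPowerSeries.X 0 -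
      MvPowerSeries.X 1) ^ k * expandDiff (ψ l)) • oppositeProd (u l) (v l) w) := by
    ext k'
    rw [toSmall_apply, ← h, ← diffPoly, laurentMul_toLaurent_pair, MvPolynomial.coe_pow]
    congr 1
    ext i
    fin_cases i <;> rfl
  rw [pow_add, mul_smul, h1, ← toSmall_smul, Finset.smul_sum, map_sum]
  refine Finset.sum_congr rfl fun l _ => ?_
  rw [smul_smul, mul_left_comm, ← coe_diffPoly, ← hδ, map_pow, hδ, coe_diffPoly,
    expandPS_sub_pow_mul_expandDiff, hφ, expandDiff_ofPowerSeries, ← map_pow, ← map_mul,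
    toSmall_smul, toSmall_oppositeProd]

end SLocality

end FormalCalculus

end

theorem proposition3p9 {W : Type*} [AddCommGroup W] [Module ℂ W]
    (S : Set (FormalCalculus.E W)) :
    (FormalCalculus.IsPseudoLocal S →
      IsLeast (FormalCalculus.closedSubspacesContaining S) (FormalCalculus.generated S) ∧
      FormalCalculus.IsPseudoLocal (FormalCalculus.generated S : Set (FormalCalculus.E W))) ∧
    (FormalCalculus.IsSLocal S →
      IsLeast (FormalCalculus.closedSubspacesContaining S) (FormalCalculus.generated S) ∧
      FormalCalculus.IsSLocal (FormalCalculus.generated S : Set (FormalCalculus.E W))) := by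
  refine ⟨fun h => ?_, fun h => ?_⟩
  · obtain ⟨h1, h2⟩ := h.exchanges.isLeast_generated
    exact ⟨h1, h2.isPseudoLocal⟩
  · obtain ⟨h1, h2⟩ := h.exchanges.isLeast_generated
    exact ⟨h1, h2.isSLocal⟩
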